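/- Let $K$ be a number field, $p$ a rational prime, $\mathfrak p$ a prime of $K$ above $p$, and let $E: y^2+a_1xy+a_3y=x^3+a_2x^2+a_4x+a_6$ be an elliptic curve over $K$ given by a Weierstrass equation that has good supersingular reduction at $\mathfrak p$. Let $v$ be the valuation on $\overline{K_{\mathfrak p}}$ extending the $\mathfrak p$-adic one, normalized by $v(p)=1$. Let $\hat E$ be the formal group of $E$, identified with the kernel of reduction in $E(\overline{K_{\mathfrak p}})$ by $Q\mapsto \hat Q=-x(Q)/y(Q)$ (and $O\mapsto 0$), and let $\hat E[=p^n]$ be the set of its elements of exact order $p^n$. If $p$ is odd, let $\mu$ be the valuation of the coefficient of $x^{(p^2-p)/2}$ in the $p$-th division polynomial of $E$; if $p=2$, let $\mu=v(a_1^2+4a_2)/2$. Suppose that $E$ has a canonical subgroup $C_{\mathrm{can}}$ at $\mathfrak p$, i.e. there are $\hat R,\hat Q\in\hat E[=p]$ with $v(\hat R)>v(\hat Q)$, and $C_{\mathrm{can}}=\langle \hat R\rangle$. Say that $\hat P\in\hat E[=p^n]$ is above $C_{\mathrm{can}}$ if $[p^{n-1}]\hat P\in C_{\mathrm{can}}$.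 Then $\mu$ is finite, there is a smallest integer $s\ge 0$ with $\mu\ge \frac{1}{p^s(p+1)}$, and for every $n\ge 1$ the following hold. 1. If $n\le s+1$, then exactly $p^{n-1}(p-1)$ elements of $\hat E[=p^n]$ above $C_{\mathrm{can}}$ have valuation $\frac{1-p^{n-1}\mu}{p^{n-1}(p-1)}$, and, for all $2\le j\le n$, exactly $p^{2(n-j)}(p^2-p)p^{j-2}(p-1)$ elements of $\hat E[=p^n]$ have valuation $\frac{\mu}{p^{2(n-j)}(p^2-p)}$; all of these are above $C_{\mathrm{can}}$. 2. If $n>s+1$, then exactly $p^{2(n-s-1)}p^s(p-1)$ elements of $\hat E[=p^n]$ above $C_{\mathrm{can}}$ have valuation $\frac{1-p^{s}\mu}{p^{2(n-s-1)}p^s(p-1)}$, and, for all $2\le j\le s+1$, exactly $p^{2(n-j)}(p^2-p)p^{j-2}(p-1)$ elements of $\hat E[=p^n]$ have valuation $\frac{\mu}{p^{2(n-j)}(p^2-p)}$; all of these are above $C_{\mathrm{can}}$. 3. In either case, exactly $p^{2(n-1)}(p^2-p)$ elements of $\hat E[=p^n]$ are not above $C_{\mathrm{can}}$, and each of them has valuation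 $\frac{\mu}{p^{2(n-1)}(p^2-p)}$. -/

import Mathlib

open IsDedekindDomain NumberField

namespace SupersingularTorsion

/-! ### Supersingular curves over fields of positive characteristic -/

/-- An elliptic curve over a field `k` of characteristic `p` is supersingular if it has no
non-trivial `p`-torsion point over an algebraic closure of `k`. -/
def IsSupersingular {k : Type*} [Field k] (W : WeierstrassCurve k) (p : ℕ) : Prop :=
  letI : DecidableEq (AlgebraicClosure k) := Classical.decEq _
  ∀ P : (W.baseChange (AlgebraicClosure k)).toAffine.Point, p • P = 0 → P = 0

/-! ### The algebraic closure of the completion at `𝔭` and its valuation -/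

section Completion

variable {K : Type*} [Field K] [NumberField K] (𝔭 : HeightOneSpectrum (𝓞 K))

/-- An algebraic closure of the completion of the number field `K` at the prime `𝔭`. -/
abbrev LocalClosure : Type _ := AlgebraicClosure (𝔭.adicCompletion K)

noncomputable instance instDecidableEqLocalClosure : DecidableEq (LocalClosure 𝔭) :=
  Classical.decEq _

open Classical in
/-- The valuation on the algebraic closure of the completion at `𝔭`, written additively and
normalized to be `1` at the rational prime `p` below `𝔭`; it is `⊤` at `0`. Here `spectralNorm` is
the unique extension of the absolute value of the completion. -/
noncomputable def val (p : ℕ) (z : LocalClosure 𝔭) : WithTop ℝ :=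
  if z = 0 then ⊤ else
    ((Real.log (spectralNorm (𝔭.adicCompletion K) (LocalClosure 𝔭) z) /
      Real.log (spectralNorm (𝔭.adicCompletion K) (LocalClosure 𝔭) (p : LocalClosure 𝔭)) : ℝ) :
        WithTop ℝ)

/-- The valuation of an element of `K`, in the normalization of `val`. -/
noncomputable def valK (p : ℕ) (a : K) : WithTop ℝ :=
  val 𝔭 p (algebraMap (𝔭.adicCompletion K) (LocalClosure 𝔭) (algebraMap K (𝔭.adicCompletion K) a))

/-- The invariant `μ`. For odd `p` it is the valuation of the coefficient of `x ^ ((p ^ 2 - p) / 2)`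
in the `p`-th division polynomial (which for odd `p` is the univariate polynomial `W.preΨ p`). For
`p = 2` it is half the valuation of `a₁ ^ 2 + 4 a₂`, the coefficient of `x ^ 2` in the square of the
second division polynomial. -/
noncomputable def mu (W : WeierstrassCurve K) (p : ℕ) : WithTop ℝ :=
  if p = 2 then (valK 𝔭 p (W.a₁ ^ 2 + 4 * W.a₂)).map (fun t : ℝ => t / 2)
  else valK 𝔭 p ((W.preΨ (p : ℤ)).coeff ((p ^ 2 - p) / 2))

/-- The Weierstrass curve `W` over `K`, viewed over the completion at `𝔭`. -/
noncomputable abbrev localCurve (W : WeierstrassCurve K) :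
    WeierstrassCurve (𝔭.adicCompletion K) :=
  W.baseChange (𝔭.adicCompletion K)

/-- The points of `W` over the algebraic closure of the completion at `𝔭`. -/
abbrev LocalPoint (W : WeierstrassCurve K) : Type _ :=
  ((localCurve 𝔭 W).baseChange (LocalClosure 𝔭)).toAffine.Point

/-- `W` is a Weierstrass equation of good reduction at `𝔭`, and its reduction is supersingular. -/
def HasGoodSupersingularReduction (W : WeierstrassCurve K) (p : ℕ) : Prop :=
  ∃ _ : (localCurve 𝔭 W).HasGoodReduction (𝔭.adicCompletionIntegers K),
    IsSupersingular ((localCurve 𝔭 W).reduction (𝔭.adicCompletionIntegers K)) p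

variable {𝔭} {W : WeierstrassCurve K}

/-- The parameter `Q̂ = -x(Q) / y(Q)`, with the point at infinity sent to `0`. -/
noncomputable def param : LocalPoint 𝔭 W → LocalClosure 𝔭
  | .zero => 0
  | .some x y _ => -x / y

/-- `Q` lies in the kernel of reduction: it is the point at infinity or its `x`-coordinate has
negative valuation. Via `param` these points are the elements of the formal group `Ê`. -/
def InKernelOfReduction (p : ℕ) : LocalPoint 𝔭 W → Prop
  | .zero => True
  | .some x _ _ => val 𝔭 p x < 0

/-- `Ê[=p^n]`: the elements of the formal group, seen as points in the kernel of reduction, of exact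
order `p ^ n`. -/
def formalTorsion (𝔭 : HeightOneSpectrum (𝓞 K)) (W : WeierstrassCurve K) (p n : ℕ) :
    Set (LocalPoint 𝔭 W) :=
  {Q | InKernelOfReduction p Q ∧ addOrderOf Q = p ^ n}

/-- `C` is the canonical subgroup: it is generated by some `R` of exact order `p` whose parameter
has larger valuation than that of some other element of exact order `p`. -/
def IsCanonicalSubgroup (p : ℕ) (C : AddSubgroup (LocalPoint 𝔭 W)) : Prop :=
  ∃ R ∈ formalTorsion 𝔭 W p 1, ∃ Q ∈ formalTorsion 𝔭 W p 1,
    val 𝔭 p (param Q) < val 𝔭 p (param R) ∧ C = AddSubgroup.zmultiples R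

/-- The elements of `Ê[=p^n]` above the subgroup `C`: those with `[p ^ (n - 1)] Q ∈ C`. -/
def aboveTorsion (C : AddSubgroup (LocalPoint 𝔭 W)) (p n : ℕ) : Set (LocalPoint 𝔭 W) :=
  {Q | Q ∈ formalTorsion 𝔭 W p n ∧ p ^ (n - 1) • Q ∈ C}

/-- The elements of the set `S` of points whose parameter has valuation exactly `r`. -/
def withVal (S : Set (LocalPoint 𝔭 W)) (p : ℕ) (r : ℝ) : Set (LocalPoint 𝔭 W) :=
  {Q | Q ∈ S ∧ val 𝔭 p (param Q) = (r : WithTop ℝ)}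

end Completion

end SupersingularTorsion

open SupersingularTorsion

/-! Everything follows from a product formula for multiplication by `p` on the formal points, which
replaces the Newton polygon of the power series `[p]`. On `x`-coordinates `[p]` is `Φ_p / ΨSq_p`.
Supersingularity makes `ΨSq_p` reduce to a nonzero constant: a root over the residue closure would
lift to a nonzero `p`-torsion point. So for `|c| > 1` the polynomial `Φ_p - c ΨSq_p` is monic of
degree `p ^ 2`, all its roots have absolute value above `1`, and its constant term has absolute
value `|c|`. Hence the formal points are `p`-divisible with `p ^ 2` points of `p`-torsion
(`exists_kernel`), and the valuation `ν` of the parameter satisfies `∑ ν (P + T) = ν (p • P)`, the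
sum being over the `p`-torsion (`prod_size_add`).

The rest is combinatorics in a `p`-divisible group. The nonzero `p`-torsion has valuation `u` on the
canonical subgroup `C` and `w < u` off it. In the fibre over `S` choose `P` with `ν P` maximal; then
`ν (P + T) = min (ν P) (ν T)` for nonzero `p`-torsion `T`, so the product formula determines the
fibre (`exists_fiber`). If `ν S ≤ p ^ 2 * w`, all `p ^ 2` preimages have valuation `ν S / p ^ 2`. If
`p ^ 2 * w < ν S ≤ u`, one coset of `C` has valuation `(ν S - (p ^ 2 - p) * w) / p` and the other
preimages have `w`. Iterating from `C` gives a main branch, which persists until level `s`, and side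
branches splitting off it at valuation `w`. Starting from the `p`-torsion outside `C`, only the
first case ever occurs.

The constants come from Vieta. The nonzero formal `p`-torsion supplies all roots of the division
polynomial, whose square has leading coefficient `p ^ 2` and unit constant term. This gives `(p - 1)
u + (p ^ 2 - p) w = 1` and `μ = (p ^ 2 - p) w` (`sum_paramValuation`, `mu_eq`).

The description of `[p]` by division polynomials is derived from the addition law (`exists_nsmul`,
`nsmul_eq_zero`), and the zeros of an elliptic divisibility sequence are located by
`dvd_of_normEDS_eq_zero`. -/

namespace WeierstrassCurve.Affine

/-! ### Addition formulas and division polynomials at a point. -/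

variable {F : Type*} [Field F] {W : Affine F}

/-- The value `2 y + a₁ x + a₃` of the second division polynomial. -/
def psiTwo (W : Affine F) (x y : F) : F := 2 * y + W.a₁ * x + W.a₃

lemma psiTwo_sq {x y : F} (h : W.Equation x y) :
    W.psiTwo x y ^ 2 = 4 * x ^ 3 + W.b₂ * x ^ 2 + 2 * W.b₄ * x + W.b₆ := by
  rw [equation_iff] at h
  simp only [psiTwo, b₂, b₄, b₆]
  linear_combination 4 * h

/-- The value of the third division polynomial at `x`. -/
def psiThree (W : Affine F) (x : F) : F :=
  3 * x ^ 4 + W.b₂ * x ^ 3 + 3 * W.b₄ * x ^ 2 + 3 * W.b₆ * x + W.b₈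

/-- The value of the fourth division polynomial at `x`, divided by that of the second. -/
def prePsiFour (W : Affine F) (x : F) : F :=
  2 * x ^ 6 + W.b₂ * x ^ 5 + 5 * W.b₄ * x ^ 4 + 10 * W.b₆ * x ^ 3 + 10 * W.b₈ * x ^ 2 +
    (W.b₂ * W.b₈ - W.b₄ * W.b₆) * x + (W.b₄ * W.b₈ - W.b₆ ^ 2)

/-- Shows that the third and fourth division polynomials can only vanish together where the second
does. -/
lemma prePsiFour_eq (x : F) : W.prePsiFour x =
    W.psiThree x * (6 * x ^ 2 + W.b₂ * x + W.b₄) -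
      (4 * x ^ 3 + W.b₂ * x ^ 2 + 2 * W.b₄ * x + W.b₆) ^ 2 := by
  have := W.b_relation
  simp only [prePsiFour, psiThree]
  linear_combination x ^ 2 * this

/-- The values of the division polynomials at the point `(x, y)`. -/
def psiVal (W : Affine F) (x y : F) (n : ℤ) : F :=
  normEDS (W.psiTwo x y) (W.psiThree x) (W.prePsiFour x) n

lemma psiVal_zero (x y : F) : W.psiVal x y 0 = 0 := normEDS_zero ..

lemma psiVal_one (x y : F) : W.psiVal x y 1 = 1 := normEDS_one ..

lemma psiVal_two (x y : F) : W.psiVal x y 2 = W.psiTwo x y := normEDS_two ..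

lemma psiVal_three (x y : F) : W.psiVal x y 3 = W.psiThree x := normEDS_three ..

lemma psiVal_four (x y : F) : W.psiVal x y 4 = W.prePsiFour x * W.psiTwo x y := normEDS_four ..

lemma psiVal_even (x y : F) (m : ℤ) : W.psiVal x y (2 * m) * W.psiTwo x y =
    W.psiVal x y (m - 1) ^ 2 * W.psiVal x y m * W.psiVal x y (m + 2) -
      W.psiVal x y (m - 2) * W.psiVal x y m * W.psiVal x y (m + 1) ^ 2 := normEDS_even ..

lemma psiVal_odd (x y : F) (m : ℤ) : W.psiVal x y (2 * m + 1) =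
    W.psiVal x y (m + 2) * W.psiVal x y m ^ 3 -
      W.psiVal x y (m - 1) * W.psiVal x y (m + 1) ^ 3 := normEDS_odd ..

namespace Point

lemma some_X_inj {x y x' y' : F} {h : W.Nonsingular x y} {h' : W.Nonsingular x' y'}
    (e : some x y h = some x' y' h') : x = x' := by
  injection e

variable [DecidableEq F]

/-- Replacing `Q` by `-Q` swaps `P + Q` and `P - Q`, so symmetric functions of their `x`-coordinates
involve `x₁` and `x₂` only. Later identities among multiples are linear combinations of these three
relations. -/
lemma exists_add_sub {x₁ y₁ x₂ y₂ : F} (h₁ : W.Nonsingular x₁ y₁) (h₂ : W.Nonsingular x₂ y₂)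
    (hx : x₁ ≠ x₂) : ∃ X Y, ∃ h : W.Nonsingular X Y, ∃ X' Y', ∃ h' : W.Nonsingular X' Y',
      some x₁ y₁ h₁ + some x₂ y₂ h₂ = some X Y h ∧ some x₁ y₁ h₁ - some x₂ y₂ h₂ = some X' Y' h' ∧
      (X + X') * (x₁ - x₂) ^ 2 =
        2 * x₁ * x₂ * (x₁ + x₂) + W.b₂ * x₁ * x₂ + W.b₄ * (x₁ + x₂) + W.b₆ ∧
      X * X' * (x₁ - x₂) ^ 2 =
        x₁ ^ 2 * x₂ ^ 2 - W.b₄ * x₁ * x₂ - W.b₆ * (x₁ + x₂) - W.b₈ ∧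
      (X' - X) * (x₁ - x₂) ^ 2 = W.psiTwo x₁ y₁ * W.psiTwo x₂ y₂ := by
  have hd : x₁ - x₂ ≠ 0 := sub_ne_zero.mpr hx
  have e₁ := (equation_iff ..).mp h₁.1
  have e₂ := (equation_iff ..).mp h₂.1
  refine ⟨_, _, _, _, _, _, add_of_X_ne hx, by rw [sub_eq_add_neg, neg_some, add_of_X_ne hx], ?_⟩
  rw [slope_of_X_ne hx, slope_of_X_ne hx]
  simp only [addX, negY, psiTwo, b₂, b₄, b₆, b₈]
  refine ⟨?_, ?_, ?_⟩
  · field_simp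
    linear_combination 2 * e₁ + 2 * e₂
  · have k₁ : (((y₁ - y₂) / (x₁ - x₂)) ^ 2 + W.a₁ * ((y₁ - y₂) / (x₁ - x₂)) - W.a₂ - x₁ - x₂) *
        (x₁ - x₂) ^ 2 = (x₁ ^ 3 + W.a₂ * x₁ ^ 2 + W.a₄ * x₁ + W.a₆) +
          (x₂ ^ 3 + W.a₂ * x₂ ^ 2 + W.a₄ * x₂ + W.a₆) - (W.a₂ + x₁ + x₂) * (x₁ - x₂) ^ 2 -
          (2 * y₁ * y₂ + W.a₁ * (x₂ * y₁ + x₁ * y₂) + W.a₃ * (y₁ + y₂)) := by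
      field_simp
      linear_combination e₁ + e₂
    have k₂ : (((y₁ - (-y₂ - W.a₁ * x₂ - W.a₃)) / (x₁ - x₂)) ^ 2 +
        W.a₁ * ((y₁ - (-y₂ - W.a₁ * x₂ - W.a₃)) / (x₁ - x₂)) - W.a₂ - x₁ - x₂) *
        (x₁ - x₂) ^ 2 = (x₁ ^ 3 + W.a₂ * x₁ ^ 2 + W.a₄ * x₁ + W.a₆) +
          (x₂ ^ 3 + W.a₂ * x₂ ^ 2 + W.a₄ * x₂ + W.a₆) - (W.a₂ + x₁ + x₂) * (x₁ - x₂) ^ 2 +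
          (2 * y₁ * y₂ + W.a₁ * (x₂ * y₁ + x₁ * y₂) + W.a₃ * (y₁ + y₂)) +
          W.a₁ ^ 2 * x₁ * x₂ + W.a₁ * W.a₃ * (x₁ + x₂) + W.a₃ ^ 2 := by
      field_simp
      linear_combination e₁ + e₂
    refine mul_right_cancel₀ (pow_ne_zero 2 hd) ?_
    rw [show ∀ a b c : F, a * b * c * c = (a * c) * (b * c) by intros; ring, k₁, k₂]
    grind
  · field_simp
    ring

lemma exists_two_nsmul {x y : F} (h : W.Nonsingular x y) (h2 : W.psiTwo x y ≠ 0) :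
    ∃ X Y, ∃ h' : W.Nonsingular X Y, 2 • some x y h = some X Y h' ∧
      (x - X) * W.psiTwo x y ^ 2 = W.psiThree x := by
  have hy : y ≠ W.negY x y := fun hy ↦ h2 <| by
    simp only [negY] at hy
    simp only [psiTwo]
    linear_combination hy
  have e := (equation_iff ..).mp h.1
  refine ⟨_, _, _, by rw [two_nsmul, add_self_of_Y_ne hy], ?_⟩
  rw [slope_of_Y_ne rfl hy]
  have h3 : y - W.negY x y = W.psiTwo x y := by simp only [negY, psiTwo]; ring
  rw [h3]
  simp only [addX]
  field_simp
  simp only [psiTwo, psiThree, b₂, b₄, b₆, b₈]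
  grind

/-- The quadratic with roots `x((m + 2)P)` and `x(mP)` is known from `exists_add_sub`; here it is
evaluated at `x(P)` and at `x((m + 1)P)`. -/
lemma exists_succ_pred_nsmul {x y a b : F} (h : W.Nonsingular x y) (h' : W.Nonsingular a b)
    {m : ℕ} (hm : (m + 1) • some x y h = some a b h') (ha : a ≠ x) :
    ∃ X Y, ∃ k : W.Nonsingular X Y, ∃ X' Y', ∃ k' : W.Nonsingular X' Y',
      (m + 2) • some x y h = some X Y k ∧ m • some x y h = some X' Y' k' ∧
      (x - X) * (x - X') * (a - x) ^ 2 = W.psiTwo x y ^ 2 * (x - a) - W.psiThree x ∧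
      (a - X) * (a - X') * (a - x) ^ 2 = W.psiTwo a b ^ 2 * (a - x) - W.psiThree a ∧
      (X' - X) * (a - x) ^ 2 = W.psiTwo a b * W.psiTwo x y := by
  obtain ⟨X, Y, k, X', Y', k', hX, hX', s, p, d⟩ := exists_add_sub h' h ha
  refine ⟨X, Y, k, X', Y', k', ?_, ?_, ?_, ?_, d⟩
  · rw [← hX, ← hm, succ_nsmul _ (m + 1)]
  · rw [← hX', ← hm, succ_nsmul, add_sub_cancel_right]
  · rw [psiTwo_sq h.1, psiThree]
    linear_combination (-x) * s + p
  · rw [psiTwo_sq h'.1, psiThree]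
    linear_combination (-a) * s + p

/-- This carries the `y`-coordinate through the induction: the difference `x(mP) - x((m + 2)P)`,
rewritten by division polynomials, becomes the even recurrence. -/
lemma psiTwo_nsmul {x y : F} (h : W.Nonsingular x y) {m : ℕ} (h2 : W.psiTwo x y ≠ 0)
    (h₀ : W.psiVal x y m ≠ 0) (h₁ : W.psiVal x y (m + 1) ≠ 0) (h₃ : W.psiVal x y (m + 2) ≠ 0)
    (e : ∀ j : ℕ, m ≤ j → j ≤ m + 2 → ∃ X Y, ∃ h' : W.Nonsingular X Y,
      j • some x y h = some X Y h' ∧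
        (x - X) * W.psiVal x y j ^ 2 = W.psiVal x y (j + 1) * W.psiVal x y (j - 1))
    {a b : F} {h' : W.Nonsingular a b} (hm : (m + 1) • some x y h = some a b h') :
    W.psiTwo a b * W.psiVal x y (m + 1) ^ 4 = W.psiVal x y (2 * (m + 1)) := by
  obtain ⟨x₁, _, _, e₁, f₁⟩ := e (m + 1) (by omega) (by omega)
  obtain ⟨x₀, _, _, e₀, f₀⟩ := e m (by omega) (by omega)
  obtain ⟨x₂, _, _, e₂, f₂⟩ := e (m + 2) (by omega) (by omega)
  obtain rfl := some_X_inj (e₁.symm.trans hm)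
  push_cast at f₁ f₂
  rw [add_assoc, add_sub_cancel_right] at f₁
  rw [add_assoc, show (m : ℤ) + 2 - 1 = m + 1 by ring] at f₂
  have ha : x₁ ≠ x := by
    rintro rfl
    simp [h₀] at f₁
    exact h₃ (by simpa using f₁)
  obtain ⟨X, _, _, X', _, _, g, g', -, -, d⟩ := exists_succ_pred_nsmul h h' hm ha
  obtain rfl := some_X_inj (e₂.symm.trans g)
  obtain rfl := some_X_inj (e₀.symm.trans g')
  have key := psiVal_even (W := W) x y (m + 1)
  rw [add_sub_cancel_right, show (m : ℤ) + 1 - 2 = m - 1 by ring, add_assoc, add_assoc] at key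
  rw [show (m : ℤ) + (1 + 2) = m + (2 + 1) by ring, show (m : ℤ) + (1 + 1) = m + 2 by ring] at key
  rw [show (m : ℤ) + (1 + 1) = m + 2 by ring] at f₁
  refine mul_right_cancel₀ h2 ?_
  linear_combination -key - W.psiVal x y (m + 1) ^ 4 * d +
    (x₀ - x₂) * ((x - x₁) * W.psiVal x y (m + 1) ^ 2 + W.psiVal x y (m + 2) * W.psiVal x y m) * f₁ +
    W.psiVal x y m ^ 2 * f₂ - W.psiVal x y (m + 2) ^ 2 * f₀

/-- Since `2P - P = P`, the sum formula for `x(2P + P) + x(2P - P)` already determines `x(3P)`. -/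
lemma three_nsmul {x y a b : F} (h : W.Nonsingular x y) (h' : W.Nonsingular a b)
    (e2 : 2 • some x y h = some a b h') (h2 : W.psiTwo x y ≠ 0) (h3 : W.psiThree x ≠ 0)
    (ha : (x - a) * W.psiTwo x y ^ 2 = W.psiThree x) :
    ∃ X Y, ∃ k : W.Nonsingular X Y, 3 • some x y h = some X Y k ∧
      (x - X) * W.psiThree x ^ 2 = W.prePsiFour x * W.psiTwo x y ^ 2 := by
  have hax : a ≠ x := by
    rintro rfl
    simp [h3.symm] at ha
  obtain ⟨X, Y, k, X', _, _, hX, hX', s, -, -⟩ := exists_add_sub h' h hax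
  rw [← e2, two_nsmul, add_sub_cancel_right] at hX'
  obtain rfl := some_X_inj hX'
  refine ⟨X, Y, k, by rw [← hX, ← e2, ← succ_nsmul], ?_⟩
  have e := psiTwo_sq h.1
  rw [prePsiFour_eq, ← e, ← ha]
  linear_combination -W.psiTwo x y ^ 4 * s + W.psiTwo x y ^ 4 * e

/-- As long as no division polynomial of index at most `n` vanishes at a point, the division
polynomials give the `x`-coordinate of its `n`-th multiple. -/
theorem exists_nsmul {x y : F} (h : W.Nonsingular x y) (n : ℕ) (hn : 1 ≤ n)
    (hne : ∀ j : ℕ, 1 ≤ j → j ≤ n → W.psiVal x y j ≠ 0) :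
    ∃ X Y, ∃ h' : W.Nonsingular X Y, n • some x y h = some X Y h' ∧
      (x - X) * W.psiVal x y n ^ 2 = W.psiVal x y (n + 1) * W.psiVal x y (n - 1) := by
  induction n using Nat.strong_induction_on with
  | _ n ih =>
  replace ih (j : ℕ) (h1 : 1 ≤ j) (h2 : j < n) := ih j h2 h1 fun i hi hij ↦ hne i hi (by omega)
  obtain rfl | rfl | rfl | hn4 : n = 1 ∨ n = 2 ∨ n = 3 ∨ 4 ≤ n := by omega
  · exact ⟨x, y, h, one_nsmul _, by simp [psiVal_zero]⟩
  · have h2 := hne 2 (by simp) le_rfl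
    rw [Nat.cast_ofNat, psiVal_two] at h2
    obtain ⟨X, Y, k, e, f⟩ := exists_two_nsmul h h2
    refine ⟨X, Y, k, e, ?_⟩
    norm_num
    rw [psiVal_two, psiVal_one, psiVal_three, f, mul_one]
  · have h2 := hne 2 (by simp) (by simp)
    have h3 := hne 3 (by simp) le_rfl
    rw [Nat.cast_ofNat, psiVal_two] at h2
    rw [Nat.cast_ofNat, psiVal_three] at h3
    obtain ⟨a, b, k, e, f⟩ := exists_two_nsmul h h2
    obtain ⟨X, Y, k', e', f'⟩ := three_nsmul h k e h2 h3 f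
    refine ⟨X, Y, k', e', ?_⟩
    norm_num
    rw [psiVal_two, psiVal_four, psiVal_three, f']
    ring
  have h2 := hne 2 (by simp) (by omega)
  rw [Nat.cast_ofNat, psiVal_two] at h2
  -- An even multiple is the double of `(m + 1)P`; an odd one is `(m + 2)P + (m + 1)P`, whose
  -- summands differ by `P`. Small `n` is separate because `m = 0` would need `ψ₀ ≠ 0`.
  obtain ⟨m, rfl | rfl⟩ : ∃ m, n = 2 * (m + 1) ∨ n = 2 * (m + 1) + 1 :=
    ⟨(n - 2) / 2, by omega⟩
  · obtain ⟨a, b, h', ea, f₁⟩ := ih (m + 1) (by omega) (by omega)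
    have hY := psiTwo_nsmul h h2 (hne m (by omega) (by omega))
      (by exact_mod_cast hne (m + 1) (by omega) (by omega))
      (by exact_mod_cast hne (m + 2) (by omega) (by omega))
      (fun j hj hj' ↦ ih j (by omega) (by omega)) ea
    have hA : W.psiTwo a b ≠ 0 := fun h0 ↦ hne (2 * (m + 1)) (by omega) le_rfl <| by
      push_cast
      rw [← hY, h0, zero_mul]
    obtain ⟨Z, Y, k, eZ, fZ⟩ := exists_two_nsmul h' hA
    refine ⟨Z, Y, k, by rw [mul_comm, mul_nsmul, ea, eZ], ?_⟩
    obtain ⟨x₀, _, _, e₀, f₀⟩ := ih m (by omega) (by omega)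
    obtain ⟨x₂, _, _, e₂, f₂⟩ := ih (m + 2) (by omega) (by omega)
    push_cast at f₁ f₂ ⊢
    rw [add_sub_cancel_right, show (m : ℤ) + 1 + 1 = m + 2 by ring] at f₁
    rw [show (m : ℤ) + 2 - 1 = m + 1 by ring, show (m : ℤ) + 2 + 1 = m + 3 by ring] at f₂
    have hax : a ≠ x := by
      rintro rfl
      rw [sub_self, zero_mul, eq_comm, mul_eq_zero] at f₁
      rcases f₁ with f | f
      · exact hne (m + 2) (by omega) (by omega) (by exact_mod_cast f)
      · exact hne m (by omega) (by omega) f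
    obtain ⟨X, _, _, X', _, _, g, g', -, d, -⟩ := exists_succ_pred_nsmul h h' ea hax
    obtain rfl := some_X_inj (e₂.symm.trans g)
    obtain rfl := some_X_inj (e₀.symm.trans g')
    have k₁ := psiVal_odd (W := W) x y (m + 1)
    have k₀ := psiVal_odd (W := W) x y m
    rw [show (m : ℤ) + 1 + 2 = m + 3 by ring, show (m : ℤ) + 1 - 1 = m by ring,
      show (m : ℤ) + 1 + 1 = m + 2 by ring] at k₁
    rw [show 2 * ((m : ℤ) + 1) - 1 = 2 * m + 1 by ring, k₁, k₀, ← hY]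
    have l₁ : (a - x₂) * (W.psiVal x y (m + 2) ^ 2 * W.psiVal x y (m + 1) ^ 2) =
        W.psiVal x y (m + 3) * W.psiVal x y (m + 1) ^ 3 -
          W.psiVal x y m * W.psiVal x y (m + 2) ^ 3 := by
      linear_combination W.psiVal x y (m + 1) ^ 2 * f₂ - W.psiVal x y (m + 2) ^ 2 * f₁
    have l₀ : (a - x₀) * (W.psiVal x y m ^ 2 * W.psiVal x y (m + 1) ^ 2) =
        -(W.psiVal x y (m + 2) * W.psiVal x y m ^ 3 -
          W.psiVal x y (m - 1) * W.psiVal x y (m + 1) ^ 3) := by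
      linear_combination W.psiVal x y (m + 1) ^ 2 * f₀ - W.psiVal x y m ^ 2 * f₁
    rw [← l₁, ← neg_eq_iff_eq_neg.mpr l₀]
    linear_combination W.psiVal x y (m + 1) ^ 8 * (fZ + d) - (a - x₂) * (a - x₀) *
      W.psiVal x y (m + 1) ^ 4 * ((x - a) * W.psiVal x y (m + 1) ^ 2 +
        W.psiVal x y (m + 2) * W.psiVal x y m) * f₁
  · obtain ⟨a, s, ha, ea, fa⟩ := ih (m + 2) (by omega) (by omega)
    obtain ⟨b, t, hb, eb, fb⟩ := ih (m + 1) (by omega) (by omega)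
    have hYa := psiTwo_nsmul (m := m + 1) h h2
      (by exact_mod_cast hne (m + 1) (by omega) (by omega))
      (by exact_mod_cast hne (m + 2) (by omega) (by omega))
      (by exact_mod_cast hne (m + 3) (by omega) (by omega))
      (fun j hj hj' ↦ ih j (by omega) (by omega)) ea
    have hYb := psiTwo_nsmul h h2 (hne m (by omega) (by omega))
      (by exact_mod_cast hne (m + 1) (by omega) (by omega))
      (by exact_mod_cast hne (m + 2) (by omega) (by omega))
      (fun j hj hj' ↦ ih j (by omega) (by omega)) eb
    push_cast at fa fb hYa hYb ⊢
    rw [add_sub_cancel_right, show (m : ℤ) + 1 + 1 = m + 2 by ring] at fb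
    rw [show (m : ℤ) + 2 - 1 = m + 1 by ring, show (m : ℤ) + 2 + 1 = m + 3 by ring] at fa
    rw [show (m : ℤ) + 1 + 1 = m + 2 by ring] at hYa
    have k := psiVal_odd (W := W) x y (m + 1)
    rw [show (m : ℤ) + 1 + 2 = m + 3 by ring, show (m : ℤ) + 1 - 1 = m by ring,
      show (m : ℤ) + 1 + 1 = m + 2 by ring] at k
    have l : (b - a) * (W.psiVal x y (m + 1) ^ 2 * W.psiVal x y (m + 2) ^ 2) =
        W.psiVal x y (2 * (m + 1) + 1) := by
      linear_combination W.psiVal x y (m + 1) ^ 2 * fa - W.psiVal x y (m + 2) ^ 2 * fb - k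
    have hab : a ≠ b := by
      rintro rfl
      rw [sub_self, zero_mul] at l
      exact hne (2 * (m + 1) + 1) (by omega) le_rfl (by exact_mod_cast l.symm)
    obtain ⟨X, Y, k, X', _, _, g, g', -, -, d⟩ := exists_add_sub ha hb hab
    rw [← ea, ← eb, succ_nsmul _ (m + 1), add_sub_cancel_left] at g'
    obtain rfl := some_X_inj g'
    refine ⟨X, Y, k, ?_, ?_⟩
    · rw [← g, ← ea, ← eb, ← add_nsmul]
      congr 1
      omega
    rw [← l, show 2 * ((m : ℤ) + 1) + 1 + 1 = 2 * (m + 2) by ring, add_sub_cancel_right, ← hYa,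
      ← hYb]
    linear_combination W.psiVal x y (m + 1) ^ 4 * W.psiVal x y (m + 2) ^ 4 * d

/-- If the `n`-th division polynomial is the first to vanish at a point, the point has order `n`. -/
theorem nsmul_eq_zero {x y : F} (h : W.Nonsingular x y) (n : ℕ) (hn : 2 ≤ n)
    (hne : ∀ j : ℕ, 1 ≤ j → j < n → W.psiVal x y j ≠ 0) (h0 : W.psiVal x y n = 0) :
    n • some x y h = 0 := by
  obtain rfl | hn3 : n = 2 ∨ 3 ≤ n := by omega
  · rw [Nat.cast_ofNat, psiVal_two] at h0
    rw [two_nsmul, add_self_of_Y_eq]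
    simp only [psiTwo] at h0
    simp only [negY]
    linear_combination h0
  obtain ⟨k, rfl⟩ : ∃ k, n = k + 3 := ⟨n - 3, by omega⟩
  obtain ⟨X, Y, h', e, f⟩ := exists_nsmul h (k + 2) (by omega) fun j hj hj' ↦ hne j hj (by omega)
  rw [Nat.cast_add, Nat.cast_ofNat, show (k : ℤ) + 2 + 1 = (k + 3 : ℕ) by push_cast; ring, h0,
    zero_mul, mul_eq_zero, sub_eq_zero] at f
  have hX := f.resolve_right (pow_ne_zero 2 (by exact_mod_cast hne (k + 2) (by omega) (by omega)))
  subst hX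
  -- Now `(n - 1)P = ± P`. The sign `+` would give `(n - 2)P = 0`, but `exists_nsmul` makes `(n -
  -- 2)P` an affine point.
  rcases Y_eq_of_X_eq h.1 h'.1 rfl with hY | hY
  · subst hY
    exfalso
    obtain ⟨X, Y, h'', e', -⟩ := exists_nsmul h (k + 1) (by omega) fun j hj hj' ↦
      hne j hj (by omega)
    rw [succ_nsmul, e'] at e
    simp at e
  · rw [succ_nsmul, e, add_of_Y_eq rfl]
    rw [hY, negY_negY]

end Point
end WeierstrassCurve.Affine

/-! ### Elliptic divisibility sequences and their zeros. -/

open WeierstrassCurve WeierstrassCurve.Affine WeierstrassCurve.Affine.Point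

/-- A specialisation without zeros at positive indices, so no such term of the generic sequence
vanishes. The last parameter is the fourth term divided by the second, hence `2`. -/
lemma normEDS_two_three_two (n : ℕ) : normEDS (2 : ℤ) 3 2 n = n := by
  induction n using Nat.strong_induction_on with
  | _ n ih =>
  obtain h | h := lt_or_ge n 5
  · interval_cases n <;> simp
  obtain ⟨m, rfl | rfl⟩ : ∃ m, n = 2 * (m + 2) ∨ n = 2 * (m + 2) + 1 := ⟨(n - 4) / 2, by omega⟩
  · have k := normEDS_even (2 : ℤ) 3 2 (m + 2)
    have h₀ := ih m (by omega)
    have h₁ := ih (m + 1) (by omega)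
    have h₂ := ih (m + 2) (by omega)
    have h₃ := ih (m + 3) (by omega)
    have h₄ := ih (m + 4) (by omega)
    push_cast at *
    rw [show (m : ℤ) + 2 - 1 = m + 1 by ring, show (m : ℤ) + 2 - 2 = m by ring,
      show (m : ℤ) + 2 + 1 = m + 3 by ring, show (m : ℤ) + 2 + 2 = m + 4 by ring,
      h₀, h₁, h₂, h₃, h₄] at k
    refine mul_right_cancel₀ two_ne_zero (k.trans ?_)
    ring
  · have k := normEDS_odd (2 : ℤ) 3 2 (m + 2)
    have h₁ := ih (m + 1) (by omega)
    have h₂ := ih (m + 2) (by omega)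
    have h₃ := ih (m + 3) (by omega)
    have h₄ := ih (m + 4) (by omega)
    push_cast at *
    rw [show (m : ℤ) + 2 - 1 = m + 1 by ring,
      show (m : ℤ) + 2 + 1 = m + 3 by ring, show (m : ℤ) + 2 + 2 = m + 4 by ring,
      h₁, h₂, h₃, h₄] at k
    rw [k]
    ring

namespace WeierstrassCurve.Affine.Point

variable {F : Type*} [Field F] [DecidableEq F] {W : Affine F}

/-- The product `(x(A + B) - x(C)) (x(A - B) - x(C)) (x(A) - x(B)) ^ 2` is symmetric in `B`
and `C`. -/
lemma add_sub_symm {a a' b b' c c' p p' q q' r r' s s' : F} {hA : W.Nonsingular a a'}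
    {hB : W.Nonsingular b b'} {hC : W.Nonsingular c c'} {hp : W.Nonsingular p p'}
    {hq : W.Nonsingular q q'} {hr : W.Nonsingular r r'} {hs : W.Nonsingular s s'}
    (hab : a ≠ b) (hac : a ≠ c)
    (ep : some a a' hA + some b b' hB = some p p' hp)
    (eq : some a a' hA - some b b' hB = some q q' hq)
    (er : some a a' hA + some c c' hC = some r r' hr)
    (es : some a a' hA - some c c' hC = some s s' hs) :
    (p - c) * (q - c) * (a - b) ^ 2 = (r - b) * (s - b) * (a - c) ^ 2 := by
  obtain ⟨X, _, _, X', _, _, g, g', e₁, e₂, -⟩ := exists_add_sub hA hB hab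
  obtain rfl := some_X_inj (g.symm.trans ep)
  obtain rfl := some_X_inj (g'.symm.trans eq)
  obtain ⟨Z, _, _, Z', _, _, k, k', f₁, f₂, -⟩ := exists_add_sub hA hC hac
  obtain rfl := some_X_inj (k.symm.trans er)
  obtain rfl := some_X_inj (k'.symm.trans es)
  linear_combination e₂ - c * e₁ - f₂ + b * f₁

/-- The differences of `x`-coordinates of multiples of a point of infinite order. -/
lemma psiVal_mul_psiVal {x y : F} (h : W.Nonsingular x y)
    (hne : ∀ j : ℕ, 1 ≤ j → W.psiVal x y j ≠ 0) {X Y : ℕ → F}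
    {k : ∀ j, W.Nonsingular (X j) (Y j)}
    (e : ∀ j : ℕ, 1 ≤ j → j • some x y h = some (X j) (Y j) (k j))
    (f : ∀ j : ℕ, (x - X (j + 1)) * W.psiVal x y (j + 1 : ℕ) ^ 2 =
      W.psiVal x y (j + 2 : ℕ) * W.psiVal x y j) (n t : ℕ) :
    W.psiVal x y (2 * n + t + 3 : ℕ) * W.psiVal x y (t + 1 : ℕ) =
      (X (n + 1) - X (n + t + 2)) * W.psiVal x y (n + 1 : ℕ) ^ 2 *
        W.psiVal x y (n + t + 2 : ℕ) ^ 2 := by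
  -- With `N = n + 1` and `M = n + t + 2` the claim is `ψ_{M+N} ψ_{M-N} = (x(NP) - x(MP)) ψ_N²
  -- ψ_M²`; the gap `t` keeps `M - N` positive.
  have hX1 : X 1 = x := some_X_inj ((e 1 le_rfl).symm.trans (one_nsmul _))
  induction n using Nat.strong_induction_on generalizing t with
  | _ n ih =>
  have hX (i j : ℕ) (hi : i < n) : X (i + 1) ≠ X (i + j + 2) := by
    intro h'
    refine mul_ne_zero (hne (2 * i + j + 3) (by omega)) (hne (j + 1) (by omega)) ?_
    rw [ih i hi j, h', sub_self, zero_mul, zero_mul]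
  obtain rfl | rfl | ⟨n, rfl⟩ : n = 0 ∨ n = 1 ∨ ∃ l, n = l + 2 := by
    by_cases h3 : 2 ≤ n
    · exact Or.inr (Or.inr ⟨n - 2, by omega⟩)
    · omega
  · have f₀ : (x - X (t + 2)) * W.psiVal x y (t + 2 : ℕ) ^ 2 =
      W.psiVal x y (t + 3 : ℕ) * W.psiVal x y (t + 1 : ℕ) := f (t + 1)
    rw [mul_zero, zero_add, zero_add, hX1, Nat.cast_one, psiVal_one, one_pow, mul_one, f₀]
  · have hx : X (t + 3) ≠ x := by
      have := (hX 0 (t + 1) one_pos).symm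
      rwa [show 0 + (t + 1) + 2 = t + 3 by omega, zero_add, hX1] at this
    obtain ⟨_, _, _, _, _, _, g, g', d, -⟩ := exists_succ_pred_nsmul h _ (e (t + 3) (by omega)) hx
    obtain rfl := some_X_inj ((e (t + 4) (by omega)).symm.trans g)
    obtain rfl := some_X_inj ((e (t + 2) (by omega)).symm.trans g')
    have fp : (x - X (t + 4)) * W.psiVal x y (t + 4 : ℕ) ^ 2 =
      W.psiVal x y (t + 5 : ℕ) * W.psiVal x y (t + 3 : ℕ) := f (t + 3)
    have fm : (x - X (t + 2)) * W.psiVal x y (t + 2 : ℕ) ^ 2 =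
      W.psiVal x y (t + 3 : ℕ) * W.psiVal x y (t + 1 : ℕ) := f (t + 1)
    have f₀ : (x - X (t + 3)) * W.psiVal x y (t + 3 : ℕ) ^ 2 =
      W.psiVal x y (t + 4 : ℕ) * W.psiVal x y (t + 2 : ℕ) := f (t + 2)
    have f₂ : (x - X 2) * W.psiVal x y (2 : ℕ) ^ 2 =
      W.psiVal x y (3 : ℕ) * W.psiVal x y (1 : ℕ) := f 1
    rw [Nat.cast_one, Nat.cast_ofNat, Nat.cast_ofNat, psiVal_one, psiVal_two, psiVal_three] at f₂
    rw [show 1 + t + 2 = t + 3 by omega, show 2 * 1 + t + 3 = t + 5 by omega,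
      show 1 + 1 = 2 from rfl, Nat.cast_ofNat, psiVal_two]
    refine mul_right_cancel₀ (pow_ne_zero 2 (hne (t + 3) (by omega))) ?_
    generalize W.psiVal x y (t + 1 : ℕ) = p₀ at *
    generalize W.psiVal x y (t + 2 : ℕ) = p₁ at *
    generalize W.psiVal x y (t + 3 : ℕ) = p₂ at *
    generalize W.psiVal x y (t + 4 : ℕ) = p₃ at *
    generalize W.psiVal x y (t + 5 : ℕ) = p₄ at *
    linear_combination (-(p₂ * p₀)) * fp - (x - X (t + 4)) * p₃ ^ 2 * fm -
      (x - X (t + 4)) * (x - X (t + 2)) * ((x - X (t + 3)) * p₂ ^ 2 + p₃ * p₁) * f₀ +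
      p₂ ^ 4 * d + p₂ ^ 4 * f₂
  · have hk : X (n + 2) ≠ x := by
      have := (hX 0 n (by omega)).symm
      rwa [zero_add, zero_add, hX1] at this
    have hm := hX (n + 1) (t + 1) (by omega)
    rw [show n + 1 + (t + 1) + 2 = n + t + 4 by omega] at hm
    have q₁ := ih (n + 1) (by omega) (t + 1)
    have q₀ := ih n (by omega) (t + 2)
    rw [show 2 * (n + 1) + (t + 1) + 3 = 2 * n + t + 6 by omega,
      show n + 1 + (t + 1) + 2 = n + t + 4 by omega] at q₁
    rw [show 2 * n + (t + 2) + 3 = 2 * n + t + 5 by omega,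
      show n + (t + 2) + 2 = n + t + 4 by omega] at q₀
    have fp : (x - X (2 * n + t + 6)) * W.psiVal x y (2 * n + t + 6 : ℕ) ^ 2 =
      W.psiVal x y (2 * n + t + 7 : ℕ) * W.psiVal x y (2 * n + t + 5 : ℕ) := f (2 * n + t + 5)
    have fm : (x - X (t + 2)) * W.psiVal x y (t + 2 : ℕ) ^ 2 =
      W.psiVal x y (t + 3 : ℕ) * W.psiVal x y (t + 1 : ℕ) := f (t + 1)
    have f₀ : (x - X (n + 2)) * W.psiVal x y (n + 2 : ℕ) ^ 2 =
      W.psiVal x y (n + 3 : ℕ) * W.psiVal x y (n + 1 : ℕ) := f (n + 1)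
    -- Taking `A = (n + 2)P`, `B = P` and `C = (n + t + 4)P` links the wanted difference `x((n +
    -- 3)P) - x(C)` to those covered by `q₀` and `q₁`.
    have symm := add_sub_symm (p := X (n + 3)) (q := X (n + 1)) (r := X (2 * n + t + 6))
      (s := X (t + 2)) (hA := k (n + 2)) (hB := h) (hC := k (n + t + 4)) (hp := k _) (hq := k _)
      (hr := k _) (hs := (nonsingular_neg (X (t + 2)) (Y (t + 2))).mpr (k (t + 2))) hk hm
      (by rw [← e _ (by omega), ← e _ (by omega), ← succ_nsmul])
      (by rw [← e _ (by omega), ← e _ (by omega), succ_nsmul _ (n + 1), add_sub_cancel_right])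
      (by
        rw [← e _ (by omega), ← e _ (by omega), ← e _ (by omega), ← add_nsmul]
        congr 1
        omega)
      (by
        rw [← neg_some (k (t + 2)), ← e _ (by omega), ← e _ (by omega), ← e _ (by omega), sub_eq_iff_eq_add,
          eq_neg_add_iff_add_eq, ← add_nsmul]
        congr 1
        omega)
    rw [show 2 * (n + 2) + t + 3 = 2 * n + t + 7 by omega,
      show n + 2 + t + 2 = n + t + 4 by omega]
    refine mul_right_cancel₀ (mul_ne_zero (hne (2 * n + t + 5) (by omega))
      (hne (t + 3) (by omega))) ?_
    rw [show t + 1 + 1 = t + 2 by omega, show n + 1 + 1 = n + 2 by omega] at q₁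
    rw [show t + 2 + 1 = t + 3 by omega] at q₀
    rw [show n + 2 + 1 = n + 3 by omega]
    generalize W.psiVal x y (t + 1 : ℕ) = r₁ at *
    generalize W.psiVal x y (t + 2 : ℕ) = r₂ at *
    generalize W.psiVal x y (t + 3 : ℕ) = r₃ at *
    generalize W.psiVal x y (n + 1 : ℕ) = s₁ at *
    generalize W.psiVal x y (n + 2 : ℕ) = s₂ at *
    generalize W.psiVal x y (n + 3 : ℕ) = s₃ at *
    generalize W.psiVal x y (n + t + 4 : ℕ) = M at *
    generalize W.psiVal x y (2 * n + t + 5 : ℕ) = p₅ at *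
    generalize W.psiVal x y (2 * n + t + 6 : ℕ) = p₆ at *
    generalize W.psiVal x y (2 * n + t + 7 : ℕ) = p₇ at *
    linear_combination (-(r₃ * r₁)) * fp - (x - X (2 * n + t + 6)) * p₆ ^ 2 * fm +
      (x - X (2 * n + t + 6)) * (x - X (t + 2)) *
        (p₆ * r₂ + (X (n + 2) - X (n + t + 4)) * s₂ ^ 2 * M ^ 2) * q₁ - s₂ ^ 4 * M ^ 4 * symm +
      (X (n + 3) - X (n + t + 4)) * (X (n + 1) - X (n + t + 4)) * M ^ 4 *
        ((x - X (n + 2)) * s₂ ^ 2 + s₃ * s₁) * f₀ -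
      (X (n + 3) - X (n + t + 4)) * s₃ ^ 2 * M ^ 2 * q₀

end WeierstrassCurve.Affine.Point

section EllipticSequence

/-- A Weierstrass curve on which the point `(0, 0)` has division polynomial values
`normEDS b c d`. -/
def tateCurve {F : Type*} [Field F] (b c d : F) : WeierstrassCurve F :=
  ⟨(d + b ^ 4) / (b * c), c / b ^ 2, b, 0, 0⟩

/-- The sequence consists of the division polynomial values at `(0, 0)` on `tateCurve b c d`, so the
addition law applies. The curve may be singular; only the point `(0, 0)` must be nonsingular, which
is `b ≠ 0`. -/
lemma normEDS_add_mul_sub_of_ne_zero {F : Type*} [Field F] (b c d : F)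
    (hne : ∀ j : ℕ, 1 ≤ j → normEDS b c d j ≠ 0) (n t : ℕ) :
    normEDS b c d (2 * n + t + 3 : ℕ) * normEDS b c d (t + 1 : ℕ) =
      normEDS b c d (n + t + 3 : ℕ) * normEDS b c d (n + t + 1 : ℕ) *
        normEDS b c d (n + 1 : ℕ) ^ 2 -
      normEDS b c d (n + 2 : ℕ) * normEDS b c d n * normEDS b c d (n + t + 2 : ℕ) ^ 2 := by
  classical
  have hb : b ≠ 0 := by simpa using hne 2 (by simp)
  have hc : c ≠ 0 := by simpa using hne 3 (by simp)
  set W : Affine F := tateCurve b c d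
  have h2 : W.psiTwo 0 0 = b := by simp [psiTwo, W, tateCurve]
  have h3 : W.psiThree 0 = c := by
    simp only [psiThree, W, tateCurve, b₂, b₄, b₆, b₈]
    field_simp
    ring
  have h4 : W.prePsiFour 0 = d := by
    simp only [prePsiFour, W, tateCurve, b₂, b₄, b₆, b₈]
    field_simp
    ring
  have hval (j : ℤ) : W.psiVal 0 0 j = normEDS b c d j := by rw [psiVal, h2, h3, h4]
  have hns : W.Nonsingular 0 0 := by
    rw [nonsingular_iff]
    exact ⟨by simp [equation_iff, W, tateCurve], Or.inr <| by simpa [W, tateCurve] using hb⟩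
  simp only [← hval] at hne ⊢
  have key (j : ℕ) : ∃ X Y, ∃ k : W.Nonsingular X Y, 1 ≤ j → (j • some 0 0 hns = some X Y k ∧
      (0 - X) * W.psiVal 0 0 j ^ 2 = W.psiVal 0 0 (j + 1) * W.psiVal 0 0 (j - 1)) := by
    by_cases hj : 1 ≤ j
    · obtain ⟨X, Y, k, e, f⟩ := exists_nsmul hns j hj fun i hi _ ↦ hne i hi
      exact ⟨X, Y, k, fun _ ↦ ⟨e, f⟩⟩
    · exact ⟨0, 0, hns, fun h ↦ absurd h hj⟩
  choose X Y k e using key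
  have f (j : ℕ) : (0 - X (j + 1)) * W.psiVal 0 0 (j + 1 : ℕ) ^ 2 =
      W.psiVal 0 0 (j + 2 : ℕ) * W.psiVal 0 0 j := by
    have := (e (j + 1) (by omega)).2
    push_cast at this ⊢
    rwa [add_sub_cancel_right, add_assoc, one_add_one_eq_two] at this
  rw [psiVal_mul_psiVal hns hne (fun j hj ↦ (e j hj).1) f]
  have f₁ : (0 - X (n + t + 2)) * W.psiVal 0 0 (n + t + 2 : ℕ) ^ 2 =
    W.psiVal 0 0 (n + t + 3 : ℕ) * W.psiVal 0 0 (n + t + 1 : ℕ) := f (n + t + 1)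
  linear_combination W.psiVal 0 0 (n + 1 : ℕ) ^ 2 * f₁ - W.psiVal 0 0 (n + t + 2 : ℕ) ^ 2 * f n

variable {R : Type*} [CommRing R]

open MvPolynomial in
/-- A normalised elliptic divisibility sequence is an elliptic sequence. -/
theorem normEDS_add_mul_sub (b c d : R) {n m : ℕ} (hn : 1 ≤ n) (hm : n < m) :
    normEDS b c d (m + n) * normEDS b c d (m - n) =
      normEDS b c d (m + 1) * normEDS b c d (m - 1) * normEDS b c d n ^ 2 -
        normEDS b c d (n + 1) * normEDS b c d (n - 1) * normEDS b c d m ^ 2 := by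
  obtain ⟨n, rfl⟩ : ∃ k, n = k + 1 := ⟨n - 1, by omega⟩
  obtain ⟨t, rfl⟩ : ∃ k, m = n + k + 2 := ⟨m - n - 2, by omega⟩
  -- The identity is proved for the generic sequence over the fraction field of `ℤ[b, c, d]`, where
  -- no relevant term vanishes, and then specialised.
  let A := MvPolynomial (Fin 3) ℤ
  let E : ℤ → A := normEDS (X 0) (X 1) (X 2)
  have hE (j : ℕ) (hj : 1 ≤ j) : E j ≠ 0 := by
    intro h
    have key : aeval ![(2 : ℤ), 3, 2] (E j) = 0 := by rw [h, _root_.map_zero]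
    simp only [E, map_normEDS, aeval_X] at key
    have := (normEDS_two_three_two j).symm.trans key
    omega
  have key := normEDS_add_mul_sub_of_ne_zero (algebraMap A (FractionRing A) (X 0))
    (algebraMap A (FractionRing A) (X 1)) (algebraMap A (FractionRing A) (X 2))
    (fun j hj ↦ by
      rw [← map_normEDS]
      exact (map_ne_zero_iff _ (IsFractionRing.injective A _)).mpr (hE j hj)) n t
  simp only [← map_normEDS, ← map_mul, ← map_pow, ← map_sub] at key
  replace key := congrArg (aeval ![b, c, d]) (IsFractionRing.injective A (FractionRing A) key)
  simp only [map_mul, map_sub, map_pow, map_normEDS, aeval_X] at key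
  convert key using 4 <;> (push_cast; ring_nf)

/-- The zeros of a nondegenerate normalised elliptic divisibility sequence are the multiples of the
first one. -/
theorem dvd_of_normEDS_eq_zero {k : Type*} [Field k] {b c d : k} (hbc : b = 0 → c ≠ 0)
    (hcd : c = 0 → d ≠ 0) {r : ℕ} (hr : 2 ≤ r) (h0 : normEDS b c d r = 0)
    (hne : ∀ j : ℕ, 1 ≤ j → j < r → normEDS b c d j ≠ 0) {n : ℕ} (hn : normEDS b c d n = 0) :
    r ∣ n := by
  have E {n m : ℕ} (hn : 1 ≤ n) (hm : n < m) := normEDS_add_mul_sub b c d hn hm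
  -- For `r ≥ 4`, two consecutive zeros at `r` and `r + 1` would force `ψ₃ ψ_{r-1}² = 0`; for `r =
  -- 2, 3` nonvanishing is the nondegeneracy hypothesis.
  have h1 : normEDS b c d (r + 1) ≠ 0 := by
    obtain rfl | rfl | ⟨t, rfl⟩ : r = 2 ∨ r = 3 ∨ ∃ t, r = t + 4 := by
      by_cases h4 : 4 ≤ r
      · exact Or.inr (Or.inr ⟨r - 4, by omega⟩)
      · omega
    · simpa using hbc (by simpa using h0)
    · have hb := hne 2 (by simp) (by simp)
      have hd := hcd (by simpa using h0)
      rw [Nat.cast_ofNat, normEDS_two] at hb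
      rw [Nat.cast_ofNat, show (3 : ℤ) + 1 = 4 by rfl, normEDS_four]
      exact mul_ne_zero hd hb
    · intro h
      have hc := hne 3 (by simp) (by omega)
      have h3 := hne (t + 3) (by omega) (by omega)
      have := E (n := 2) (m := t + 3) (by simp) (by omega)
      push_cast at this h h0 hc h3
      rw [show (t : ℤ) + 3 + 2 = t + 4 + 1 by ring, h, show (t : ℤ) + 3 + 1 = t + 4 by ring, h0,
        normEDS_one, zero_mul, zero_mul,
        zero_mul, mul_one, zero_sub, eq_comm, neg_eq_zero] at this
      exact mul_ne_zero hc (pow_ne_zero 2 h3) this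
  have hpred : normEDS b c d (r - 1) ≠ 0 := by
    have := hne (r - 1) (by omega) (by omega)
    rwa [Nat.cast_sub (by omega), Nat.cast_one] at this
  -- The induction carries nonvanishing on both sides of each multiple of `r`, since the elliptic
  -- relation must be divided by a nearby term.
  have C (q : ℕ) : normEDS b c d ((q + 1) * r : ℕ) = 0 ∧ ∀ s : ℕ, 1 ≤ s → s < r →
      normEDS b c d ((q + 1) * r - s) ≠ 0 ∧ normEDS b c d ((q + 1) * r + s) ≠ 0 := by
    induction q with
    | zero =>
      refine ⟨by simpa using h0, fun s hs hsr ↦ ?_⟩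
      have h2 := hne (r - s) (by omega) (by omega)
      rw [Nat.cast_sub (by omega)] at h2
      have := E hs hsr
      rw [h0, zero_pow two_ne_zero, mul_zero, sub_zero] at this
      have h3 := left_ne_zero_of_mul (this.trans_ne
        (mul_ne_zero (mul_ne_zero h1 hpred) (pow_ne_zero 2 (hne s hs hsr))))
      simpa using ⟨h2, h3⟩
    | succ q ih =>
      obtain ⟨i0, i1⟩ := ih
      have hlt : r ≤ (q + 1) * r := Nat.le_mul_of_pos_left r (by omega)
      have hM : (((q + 1) * r : ℕ) : ℤ) = (q + 1) * r := by push_cast; ring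
      have z : normEDS b c d ((q + 2) * r : ℕ) = 0 := by
        -- The term to divide by lies at distance `r - 2` from the previous zero, so `r = 2` needs
        -- its own argument: even terms contain the factor `b = 0`.
        obtain rfl | hr3 : r = 2 ∨ 3 ≤ r := by omega
        · rw [Nat.cast_ofNat, normEDS_two] at h0
          simp [normEDS, h0]
        · have := E (n := r - 1) (m := (q + 1) * r + 1) (by omega) (by omega)
          rw [Nat.cast_sub (by omega), Nat.cast_add, hM, Nat.cast_one, sub_add_cancel, h0,
            add_sub_cancel_right, ← hM, i0, mul_zero, zero_mul, zero_mul, zero_mul, sub_zero,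
            mul_eq_zero, hM] at this
          have h2 := (i1 (r - 2) (by omega) (by omega)).1
          rw [Nat.cast_sub (by omega)] at h2
          push_cast
          push_cast at h2
          convert this.resolve_right (by convert h2 using 2; ring_nf) using 2
          ring
      have z1 : normEDS b c d ((q + 2) * r + 1) ≠ 0 := by
        have := E (n := r) (m := (q + 1) * r + 1) (by omega) (by omega)
        rw [Nat.cast_add, hM, Nat.cast_one, h0, add_sub_cancel_right, ← hM, i0, mul_zero, zero_mul,
          zero_sub, hM] at this
        have h2 := left_ne_zero_of_mul (this.trans_ne (neg_ne_zero.mpr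
          (mul_ne_zero (mul_ne_zero h1 hpred) (pow_ne_zero 2 (by
            simpa using (i1 1 le_rfl (by omega)).2)))))
        convert h2 using 2
        ring
      have z2 (s : ℕ) (hs : 1 ≤ s) (hsr : s < r) : normEDS b c d ((q + 2) * r - s) ≠ 0 := by
        have := (i1 (r - s) (by omega) (by omega)).2
        rw [Nat.cast_sub (by omega)] at this
        convert this using 2
        ring
      have hq : ((q + 1 : ℕ) : ℤ) + 1 = q + 2 := by push_cast; ring
      refine ⟨z, fun s hs hsr ↦ ?_⟩
      rw [hq]
      refine ⟨z2 s hs hsr, fun h ↦ ?_⟩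
      have hlt' : r ≤ (q + 2) * r := Nat.le_mul_of_pos_left r (by omega)
      have := E (n := s) (m := (q + 2) * r) hs (by omega)
      rw [z] at this
      push_cast at this
      rw [h, zero_pow two_ne_zero, mul_zero, sub_zero, zero_mul, eq_comm] at this
      exact mul_ne_zero (mul_ne_zero z1 (by simpa using z2 1 le_rfl (by omega)))
        (pow_ne_zero 2 (hne s hs hsr)) this
  rcases Nat.eq_zero_or_pos (n % r) with h | h
  · exact Nat.dvd_of_mod_eq_zero h
  have hlt := Nat.mod_lt n (show 0 < r by omega)
  have hdiv := Nat.div_add_mod n r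
  exfalso
  cases hq : n / r with
  | zero =>
    rw [hq, mul_zero, zero_add] at hdiv
    exact hne n (by omega) (by omega) hn
  | succ q =>
    refine ((C q).2 (n % r) h hlt).2 ?_
    rw [hq] at hdiv
    convert hn using 2
    have := congrArg (Nat.cast (R := ℤ)) hdiv
    push_cast at this ⊢
    linarith

end EllipticSequence

/-! ### Division polynomials of supersingular curves. -/

open Polynomial WeierstrassCurve WeierstrassCurve.Affine WeierstrassCurve.Affine.Point

namespace WeierstrassCurve.Affine

variable {F : Type*} [Field F] {W : Affine F}

lemma eval_Ψ₂Sq {x y : F} (h : W.Equation x y) : (Ψ₂Sq W).eval x = W.psiTwo x y ^ 2 := by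
  rw [psiTwo_sq h, Ψ₂Sq]
  simp

lemma psiVal_eq {x y : F} (h : W.Equation x y) (n : ℤ) : W.psiVal x y n =
    (preΨ W n).eval x * if Even n then W.psiTwo x y else 1 := by
  rw [psiVal, normEDS, preΨ, ← coe_evalRingHom, map_preNormEDS]
  simp only [coe_evalRingHom]
  congr 2
  · rw [eval_pow, eval_Ψ₂Sq h]
    ring
  · simp [psiThree, Ψ₃]
  · simp [prePsiFour, preΨ₄]

lemma psiVal_sq {x y : F} (h : W.Equation x y) (n : ℤ) :
    W.psiVal x y n ^ 2 = (ΨSq W n).eval x := by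
  rw [psiVal_eq h, ΨSq]
  split_ifs <;> simp [mul_pow, eval_Ψ₂Sq h]

lemma psiVal_succ_mul_psiVal_pred {x y : F} (h : W.Equation x y) (n : ℤ) :
    W.psiVal x y (n + 1) * W.psiVal x y (n - 1) =
      x * (ΨSq W n).eval x - (WeierstrassCurve.Φ W n).eval x := by
  rw [psiVal_eq h, psiVal_eq h, WeierstrassCurve.Φ]
  by_cases hn : Even n
  · have h1 : ¬ Even (n + 1) := by simpa [Int.even_add_one] using hn
    have h2 : ¬ Even (n - 1) := by simpa [Int.even_sub_one] using hn
    simp [hn, h1, h2]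
  · have h1 : Even (n + 1) := by simpa [Int.even_add_one] using hn
    have h2 : Even (n - 1) := by simpa [Int.even_sub_one] using hn
    simp [hn, h1, h2, eval_Ψ₂Sq h]
    ring

/-- A common zero of the second and third division polynomials would annihilate the discriminant.
This is the nondegeneracy needed for `dvd_of_normEDS_eq_zero`. -/
lemma psiThree_ne_zero [WeierstrassCurve.IsElliptic W] {x y : F} (h : W.Equation x y)
    (h2 : W.psiTwo x y = 0) : W.psiThree x ≠ 0 := by
  intro h3
  have e := psiTwo_sq h
  rw [h2] at e
  refine (WeierstrassCurve.isUnit_Δ W).ne_zero ?_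
  have := W.b_relation
  simp only [psiThree] at h3
  rw [WeierstrassCurve.Δ]
  grind

lemma exists_equation [IsAlgClosed F] (W : Affine F) (x : F) : ∃ y, W.Equation x y := by
  obtain ⟨y, hy⟩ := IsAlgClosed.exists_root (C 1 * X ^ 2 + C (W.a₁ * x + W.a₃) * X +
    C (-(x ^ 3 + W.a₂ * x ^ 2 + W.a₄ * x + W.a₆))) (by
      rw [degree_quadratic one_ne_zero]
      decide)
  refine ⟨y, ?_⟩
  rw [equation_iff]
  simp at hy
  linear_combination hy

variable [DecidableEq F]

/-- At a zero of the `p`-th division polynomial, for a prime `p`, the `p`-th multiple vanishes. -/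
theorem prime_nsmul_eq_zero [WeierstrassCurve.IsElliptic W] {x y : F} (h : W.Nonsingular x y)
    {p : ℕ} (hp : p.Prime) (h0 : W.psiVal x y p = 0) : p • some x y h = 0 := by
  classical
  have hex : ∃ n : ℕ, 1 ≤ n ∧ W.psiVal x y n = 0 := ⟨p, hp.one_lt.le, h0⟩
  have h2 : W.psiTwo x y = 0 → W.psiThree x ≠ 0 := psiThree_ne_zero h.1
  have hr1 := (Nat.find_spec hex).1
  have hr0 := (Nat.find_spec hex).2
  have hmin (j : ℕ) (h1 : 1 ≤ j) (h2 : j < Nat.find hex) : W.psiVal x y j ≠ 0 := fun h ↦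
    Nat.find_min hex h2 ⟨h1, h⟩
  have hr2 : 2 ≤ Nat.find hex := by
    by_contra hlt
    rw [show Nat.find hex = 1 by omega, Nat.cast_one, psiVal_one] at hr0
    exact one_ne_zero hr0
  -- The first index of vanishing divides the prime `p` and is at least `2`, so it equals `p`.
  have hdvd : Nat.find hex ∣ p := dvd_of_normEDS_eq_zero h2 (fun h3 h4 ↦ by
    rw [prePsiFour_eq, h3, zero_mul, zero_sub, neg_eq_zero, ← psiTwo_sq h.1, ← pow_mul] at h4
    exact h2 (eq_zero_of_pow_eq_zero h4) h3) hr2 hr0 hmin h0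
  rw [(Nat.dvd_prime_two_le hp hr2).mp hdvd] at hmin
  exact nsmul_eq_zero h p hp.two_le hmin h0

end WeierstrassCurve.Affine

open SupersingularTorsion in
/-- The `p`-th division polynomial of a supersingular curve is a nonzero constant. -/
theorem SupersingularTorsion.IsSupersingular.coeff_ΨSq {k : Type*} [Field k] {W : WeierstrassCurve k}
    [W.IsElliptic] {p : ℕ} (hp : p.Prime) (hW : IsSupersingular W p) :
    (W.ΨSq p).coeff 0 ≠ 0 ∧ ∀ i, i ≠ 0 → (W.ΨSq p).coeff i = 0 := by
  classical
  -- A root would be the `x`-coordinate of a nonzero `p`-torsion point; having no root over an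
  -- algebraically closed field means degree zero.
  have hroot (x : AlgebraicClosure k) : ¬ ((W.ΨSq p).map (algebraMap k (AlgebraicClosure k))).IsRoot x := by
    intro hx
    let W' : Affine (AlgebraicClosure k) := W.baseChange (AlgebraicClosure k)
    have : WeierstrassCurve.IsElliptic W' :=
      inferInstanceAs (WeierstrassCurve.IsElliptic (W.map (algebraMap k (AlgebraicClosure k))))
    obtain ⟨y, hy⟩ := exists_equation W' x
    have hns : W'.Nonsingular x y := equation_iff_nonsingular.mp hy
    have h0 : W'.psiVal x y p = 0 := by
      refine eq_zero_of_pow_eq_zero (n := 2) ?_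
      rw [psiVal_sq hy]
      change eval x (WeierstrassCurve.ΨSq (W.map (algebraMap k (AlgebraicClosure k))) p) = 0
      rw [map_ΨSq]
      exact hx
    have := hW (some x y hns) (by convert prime_nsmul_eq_zero hns hp h0)
    simp at this
  have hdeg : ((W.ΨSq p).map (algebraMap k (AlgebraicClosure k))).degree = 0 := by
    by_contra h
    obtain ⟨x, hx⟩ := IsAlgClosed.exists_root _ h
    exact hroot x hx
  rw [degree_map] at hdeg
  have hC := eq_C_of_degree_eq_zero hdeg
  refine ⟨fun h ↦ ?_, fun i hi ↦ by rw [hC, coeff_C, if_neg hi]⟩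
  rw [h, _root_.map_zero] at hC
  simp [hC] at hdeg

/-! ### Valuations of polynomial values and integral Weierstrass equations. -/

open scoped NNReal

section PolynomialValuation

variable {L : Type*} [Field L] {v : Valuation L ℝ≥0} {f : L[X]} {x : L}

lemma Valuation.eval_le_one (hf : ∀ i, v (f.coeff i) ≤ 1) (hx : v x ≤ 1) : v (f.eval x) ≤ 1 := by
  rw [eval_eq_sum_range]
  refine v.map_sum_le fun i _ ↦ ?_
  rw [map_mul, map_pow]
  exact mul_le_one' (hf i) (pow_le_one₀ zero_le hx)

lemma Valuation.eval_le_pow (hf : ∀ i, v (f.coeff i) ≤ 1) (hx : 1 ≤ v x) {d : ℕ}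
    (hd : f.natDegree ≤ d) : v (f.eval x) ≤ v x ^ d := by
  rw [eval_eq_sum_range]
  refine v.map_sum_le fun i hi ↦ ?_
  rw [map_mul, map_pow]
  refine (mul_le_of_le_one_left' (hf i)).trans (pow_le_pow_right₀ hx ?_)
  have := Finset.mem_range.mp hi
  omega

lemma Valuation.eval_eq_pow (hf : ∀ i, v (f.coeff i) ≤ 1) (hx : 1 < v x) {d : ℕ}
    (hd : f.natDegree ≤ d) (hd1 : v (f.coeff d) = 1) : v (f.eval x) = v x ^ d := by
  rw [eval_eq_sum_range' (Nat.lt_succ_of_le hd), Finset.sum_range_succ]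
  have h1 : v (f.coeff d * x ^ d) = v x ^ d := by rw [map_mul, map_pow, hd1, one_mul]
  rw [v.map_add_eq_of_lt_right, h1]
  rw [h1]
  refine v.map_sum_lt (pow_ne_zero _ (zero_lt_one.trans hx).ne') fun i hi ↦ ?_
  rw [map_mul, map_pow]
  exact (mul_le_of_le_one_left' (hf i)).trans_lt
    (pow_lt_pow_right₀ hx (Finset.mem_range.mp hi))

lemma Valuation.eval_eq_one (h0 : v (f.coeff 0) = 1) (hf : ∀ i, i ≠ 0 → v (f.coeff i) < 1)
    (hx : v x ≤ 1) : v (f.eval x) = 1 := by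
  rw [eval_eq_sum_range, Finset.sum_range_succ', pow_zero, mul_one, v.map_add_eq_of_lt_right, h0]
  rw [h0]
  refine v.map_sum_lt one_ne_zero fun i _ ↦ ?_
  rw [map_mul, map_pow]
  exact (mul_le_of_le_one_right' (pow_le_one₀ zero_le hx)).trans_lt (hf _ (by omega))

end PolynomialValuation

namespace WeierstrassCurve

variable {L : Type*} [Field L]

/-- The coefficients of a Weierstrass equation are integral for a valuation. -/
structure IntegralAt (W : WeierstrassCurve L) (v : Valuation L ℝ≥0) : Prop where
  a₁ : v W.a₁ ≤ 1
  a₂ : v W.a₂ ≤ 1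
  a₃ : v W.a₃ ≤ 1
  a₄ : v W.a₄ ≤ 1
  a₆ : v W.a₆ ≤ 1

namespace IntegralAt

variable {W : WeierstrassCurve L} {v : Valuation L ℝ≥0}

/-- Descending the equation to the valuation ring makes everything built functorially from it
integral. -/
lemma exists_map_eq (h : W.IntegralAt v) :
    ∃ W₀ : WeierstrassCurve v.integer, W₀.map v.integer.subtype = W :=
  ⟨⟨⟨W.a₁, h.a₁⟩, ⟨W.a₂, h.a₂⟩, ⟨W.a₃, h.a₃⟩, ⟨W.a₄, h.a₄⟩, ⟨W.a₆, h.a₆⟩⟩, rfl⟩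

lemma b (h : W.IntegralAt v) : v W.b₂ ≤ 1 ∧ v W.b₄ ≤ 1 ∧ v W.b₆ ≤ 1 ∧ v W.b₈ ≤ 1 := by
  obtain ⟨W₀, rfl⟩ := h.exists_map_eq
  simp only [map_b₂, map_b₄, map_b₆, map_b₈]
  exact ⟨W₀.b₂.2, W₀.b₄.2, W₀.b₆.2, W₀.b₈.2⟩

lemma coeff_ΨSq (h : W.IntegralAt v) (n : ℤ) (i : ℕ) : v ((W.ΨSq n).coeff i) ≤ 1 := by
  obtain ⟨W₀, rfl⟩ := h.exists_map_eq
  rw [map_ΨSq, coeff_map]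
  exact ((W₀.ΨSq n).coeff i).2

lemma coeff_Φ (h : W.IntegralAt v) (n : ℤ) (i : ℕ) : v ((W.Φ n).coeff i) ≤ 1 := by
  obtain ⟨W₀, rfl⟩ := h.exists_map_eq
  rw [map_Φ, coeff_map]
  exact ((W₀.Φ n).coeff i).2

end IntegralAt

end WeierstrassCurve

/-! ### The group of formal points and its ultrametric. -/

namespace WeierstrassCurve.Affine.Point

variable {L : Type*} [Field L] {W : Affine L}

/-- The points with non-integral `x`-coordinate, and the point at infinity. -/
def IsFormal (v : Valuation L ℝ≥0) : W.Point → Prop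
  | .zero => True
  | .some x _ _ => 1 < v x

/-- The `x`-coordinate of a point, `0` at infinity. -/
def xCoord : W.Point → L
  | .zero => 0
  | .some x _ _ => x

/-- The inverse of the absolute value of the `x`-coordinate: a measure of the distance of a point
from the origin. -/
noncomputable def size (v : Valuation L ℝ≥0) : W.Point → ℝ≥0
  | .zero => 0
  | .some x _ _ => (v x)⁻¹

section

variable {v : Valuation L ℝ≥0}

@[simp] lemma isFormal_zero : IsFormal v (0 : W.Point) := trivial

@[simp] lemma size_zero : size v (0 : W.Point) = 0 := rfl

@[simp] lemma isFormal_some {x y : L} (h : W.Nonsingular x y) :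
    IsFormal v (some x y h) ↔ 1 < v x := Iff.rfl

@[simp] lemma size_some {x y : L} (h : W.Nonsingular x y) : size v (some x y h) = (v x)⁻¹ := rfl

@[simp] lemma xCoord_some {x y : L} (h : W.Nonsingular x y) : xCoord (some x y h) = x := rfl

@[simp] lemma isFormal_neg (P : W.Point) : IsFormal v (-P) ↔ IsFormal v P := by
  cases P <;> rfl

@[simp] lemma size_neg (P : W.Point) : size v (-P) = size v P := by
  cases P <;> rfl

@[simp] lemma xCoord_neg (P : W.Point) : xCoord (-P) = xCoord P := by
  cases P <;> rfl

lemma IsFormal.size_eq_zero_iff {P : W.Point} (h : IsFormal v P) : size v P = 0 ↔ P = 0 := by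
  cases P with
  | zero => simp [← zero_def]
  | some x y k =>
    simp only [isFormal_some] at h
    simp only [size_some, inv_eq_zero, some_ne_zero, iff_false]
    exact (zero_lt_one.trans h).ne'

/-- No case is excluded: at infinity both sides are `0`, because `0⁻¹ = 0`. -/
lemma IsFormal.valuation_xCoord {P : W.Point} : v (xCoord P) = (size v P)⁻¹ := by
  cases P with
  | zero => simp [xCoord, size]
  | some x y k => simp

lemma IsFormal.size_lt_one {P : W.Point} (h : IsFormal v P) : size v P < 1 := by
  cases P with
  | zero => simp [← zero_def]
  | some x y k => exact inv_lt_one_of_one_lt₀ h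

lemma eq_or_eq_neg_of_xCoord_eq {P Q : W.Point} (hP : P ≠ 0) (hQ : Q ≠ 0)
    (h : xCoord P = xCoord Q) : P = Q ∨ P = -Q := by
  cases P with
  | zero => exact absurd rfl hP
  | some x y k =>
  cases Q with
  | zero => exact absurd rfl hQ
  | some x' y' k' =>
  simp only [xCoord_some] at h
  subst h
  rcases Y_eq_of_X_eq k.1 k'.1 rfl with rfl | rfl
  · exact Or.inl rfl
  · exact Or.inr rfl

/-- If `|X| < min(|a|, |b|)`, then the size of the product `X X'` and the bound on the sum give `|X
+ X'| < |X'|`, so `|X| = |X'|`. Then `|X| |a - b| < min · max = |ab|`, against `|X X'| |a - b|² =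
|ab|²`. -/
lemma min_le_valuation_add (hW : IntegralAt W v) {a b X X' : L} (ha : 1 < v a) (hb : 1 < v b)
    (hs : (X + X') * (a - b) ^ 2 =
      2 * a * b * (a + b) + W.b₂ * a * b + W.b₄ * (a + b) + W.b₆)
    (hp : X * X' * (a - b) ^ 2 = a ^ 2 * b ^ 2 - W.b₄ * a * b - W.b₆ * (a + b) - W.b₈) :
    min (v a) (v b) ≤ v X := by
  obtain ⟨h2, h4, h6, h8⟩ := hW.b
  have two : v 2 ≤ 1 := by
    rw [← one_add_one_eq_two]
    exact v.map_add_le (by simp) (by simp)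
  have hab : 1 < v a * v b := one_lt_mul'' ha hb
  have hmul : ∀ r t : L, v r ≤ 1 → v (r * t) ≤ v t := fun r t h ↦ by
    rw [map_mul]
    exact mul_le_of_le_one_left' h
  have hadd : v (a + b) ≤ max (v a) (v b) := v.map_add a b
  have hmax : max (v a) (v b) ≤ v a * v b :=
    max_le (le_mul_of_one_le_right' hb.le) (le_mul_of_one_le_left' ha.le)
  have hN : v X * v X' * v (a - b) ^ 2 = v a ^ 2 * v b ^ 2 := by
    rw [← map_pow, ← map_mul, ← map_mul, hp,
      show a ^ 2 * b ^ 2 - W.b₄ * a * b - W.b₆ * (a + b) - W.b₈ =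
        a ^ 2 * b ^ 2 - (W.b₄ * (a * b) + W.b₆ * (a + b) + W.b₈) by ring, v.map_sub_eq_of_lt_left]
    · simp
    · refine (v.map_add_le (g := v a * v b) (v.map_add_le ?_ ?_) ?_).trans_lt ?_
      · exact (hmul _ _ h4).trans_eq (map_mul ..)
      · exact (hmul _ _ h6).trans (hadd.trans hmax)
      · exact h8.trans hab.le
      · rw [map_mul, map_pow, map_pow, ← mul_pow]
        exact lt_self_pow₀ hab one_lt_two
  have hS : v (X + X') * v (a - b) ^ 2 ≤ v a * v b * max (v a) (v b) := by
    rw [← map_pow, ← map_mul, hs]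
    have hm : 1 ≤ max (v a) (v b) := ha.le.trans (le_max_left ..)
    refine v.map_add_le (v.map_add_le (v.map_add_le ?_ ?_) ?_) ?_
    · rw [mul_assoc 2, mul_assoc 2, map_mul, map_mul, map_mul]
      exact (mul_le_of_le_one_left' two).trans (mul_le_mul_right hadd _)
    · rw [mul_assoc]
      refine (hmul _ _ h2).trans ?_
      rw [map_mul]
      exact le_mul_of_one_le_right' hm
    · exact ((hmul _ _ h4).trans hadd).trans (le_mul_of_one_le_left' hab.le)
    · exact h6.trans (one_le_mul hab.le hm)
  by_contra! hlt
  have hD : v (a - b) ≤ max (v a) (v b) := v.map_sub a b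
  have hmm : min (v a) (v b) * max (v a) (v b) = v a * v b := min_mul_max _ _
  have hpos : 0 < v a ^ 2 * v b ^ 2 := by positivity
  have hD0 : 0 < v (a - b) := by
    refine pos_iff_ne_zero.mpr fun h ↦ ?_
    rw [h] at hN
    simp [← hN] at hpos
  have hX'0 : 0 < v X' := by
    refine pos_iff_ne_zero.mpr fun h ↦ ?_
    rw [h] at hN
    simp [← hN] at hpos
  have h1 : v (X + X') < v X' := by
    have hX0 : 0 < v X := by
      refine pos_iff_ne_zero.mpr fun h ↦ ?_
      rw [h] at hN
      simp [← hN] at hpos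
    refine lt_of_mul_lt_mul_right (a := v X * v (a - b) ^ 2) ?_ zero_le
    calc v (X + X') * (v X * v (a - b) ^ 2) = v X * (v (X + X') * v (a - b) ^ 2) := by ring
      _ ≤ v X * (v a * v b * max (v a) (v b)) := mul_le_mul_right hS _
      _ < min (v a) (v b) * (v a * v b * max (v a) (v b)) :=
          mul_lt_mul_of_pos_right hlt (by positivity)
      _ = v a ^ 2 * v b ^ 2 := by rw [mul_left_comm, hmm]; ring
      _ = v X' * (v X * v (a - b) ^ 2) := by rw [← hN]; ring
  have h2 : v X = v X' := by
    by_contra hne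
    have := v.map_add_of_distinct_val hne
    rw [this] at h1
    exact (le_max_right _ _).not_gt h1
  rw [← h2] at hN
  have h3 : v X * v (a - b) < v a * v b := by
    rw [← hmm]
    exact mul_lt_mul hlt hD hD0 zero_le
  refine (pow_lt_pow_left₀ h3 zero_le two_ne_zero).ne ?_
  rw [mul_pow, mul_pow, ← hN]
  ring

variable [DecidableEq L]

/-- For distinct `x`-coordinates this is `min_le_valuation_add`. For doubling, `|Φ₂(a)| = |a|⁴` and
`|ΨSq₂(a)| ≤ |a|³`, so the new `x`-coordinate is at least as large as `a`. -/
lemma isFormal_add_size_add (hW : IntegralAt W v) {P Q : W.Point} (hP : IsFormal v P)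
    (hQ : IsFormal v Q) : IsFormal v (P + Q) ∧ size v (P + Q) ≤ max (size v P) (size v Q) := by
  cases P with
  | zero => simpa [← zero_def] using hQ
  | some a a' k =>
  cases Q with
  | zero => simpa [← zero_def] using hP
  | some b b' k' =>
  simp only [isFormal_some] at hP hQ
  have key {X Y : L} {h : W.Nonsingular X Y} (hX : min (v a) (v b) ≤ v X) :
      IsFormal v (some X Y h) ∧
        size v (some X Y h) ≤ max (size v (some a a' k)) (size v (some b b' k')) := by
    refine ⟨(lt_min hP hQ).trans_le hX, ?_⟩
    simp only [size_some]
    rcases min_le_iff.mp hX with h | h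
    · exact le_max_of_le_left (inv_anti₀ (zero_lt_one.trans hP) h)
    · exact le_max_of_le_right (inv_anti₀ (zero_lt_one.trans hQ) h)
  by_cases hab : a = b
  · subst hab
    rcases Y_eq_of_X_eq k.1 k'.1 rfl with rfl | hY
    · by_cases h2 : W.psiTwo a a' = 0
      · rw [← two_nsmul, nsmul_eq_zero k 2 le_rfl (fun j h1 h2 ↦ by
          obtain rfl : j = 1 := by omega
          simp [psiVal_one]) (by simpa [psiVal_two] using h2)]
        simp
      · obtain ⟨X, Y, h, e, f⟩ := exists_two_nsmul k h2
        rw [← two_nsmul, e]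
        refine key ?_
        rw [min_self]
        obtain ⟨b2, b4, b6, b8⟩ := hW.b
        have f' : X * W.psiTwo a a' ^ 2 = (WeierstrassCurve.Φ W 2).eval a := by
          have e2 := psiTwo_sq k.1
          simp only [psiThree] at f
          simp only [Φ_two, eval_sub, eval_pow, eval_X, eval_mul, eval_C]
          linear_combination -f + a * e2
        have e3 : v ((WeierstrassCurve.Φ W 2).eval a) = v a ^ 4 :=
          Valuation.eval_eq_pow (hW.coeff_Φ 2) hP (natDegree_Φ_le ..)
            (by rw [show (4 : ℕ) = (2 : ℤ).natAbs ^ 2 from rfl, coeff_Φ, map_one])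
        have e4 : v (W.psiTwo a a' ^ 2) ≤ v a ^ 3 := by
          rw [← eval_Ψ₂Sq k.1, ← ΨSq_two]
          exact Valuation.eval_le_pow (hW.coeff_ΨSq 2) hP.le (natDegree_ΨSq_le ..)
        have h2' : 0 < v (W.psiTwo a a' ^ 2) := by simpa [pos_iff_ne_zero] using h2
        refine le_of_mul_le_mul_right ?_ h2'
        rw [← map_mul v X, f', e3, pow_succ' _ 3]
        exact mul_le_mul_right e4 _
    · rw [add_of_Y_eq rfl hY]
      simp
  · obtain ⟨X, Y, h, X', Y', h', e, e', s, p, -⟩ := exists_add_sub k k' hab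
    rw [e]
    exact key (min_le_valuation_add hW hP hQ s p)

/-- The points with non-integral `x`-coordinate form a subgroup. -/
def formalSubgroup (hW : IntegralAt W v) : AddSubgroup W.Point where
  carrier := {P | IsFormal v P}
  add_mem' hP hQ := (isFormal_add_size_add hW hP hQ).1
  zero_mem' := isFormal_zero (W := W) (v := v)
  neg_mem' h := (isFormal_neg _).mpr h

end

end WeierstrassCurve.Affine.Point

/-! ### Multiplication by `p` on formal points. -/

lemma Valuation.natCast_le_one {L : Type*} [Field L] (v : Valuation L ℝ≥0) (n : ℕ) :
    v (n : L) ≤ 1 := natCast_mem v.integer n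

lemma Valuation.natCast_eq_one {L : Type*} [Field L] (v : Valuation L ℝ≥0) {p n : ℕ}
    (hp : v (p : L) < 1) (h : n.Coprime p) : v (n : L) = 1 := by
  refine le_antisymm (v.natCast_le_one n) (not_lt.mp fun hn ↦ ?_)
  have key : ((1 : ℤ) : L) = ((n * n.gcdA p + p * n.gcdB p : ℤ) : L) := by
    rw [← Nat.gcd_eq_gcd_ab, Nat.coprime_iff_gcd_eq_one.mp h, Nat.cast_one]
  have hz (z : ℤ) : v (z : L) ≤ 1 := intCast_mem v.integer z
  have : v (((n * n.gcdA p + p * n.gcdB p : ℤ) : L)) < 1 := by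
    push_cast
    refine v.map_add_lt ?_ ?_
    · rw [map_mul]
      exact (mul_le_of_le_one_right' (hz _)).trans_lt hn
    · rw [map_mul]
      exact (mul_le_of_le_one_right' (hz _)).trans_lt hp
  rw [← key] at this
  simp at this

namespace WeierstrassCurve.Affine.Point

variable {L : Type*} [Field L] {W : Affine L} {v : Valuation L ℝ≥0} {p : ℕ}

lemma valuation_Φ (hW : IntegralAt W v) {x : L} (hx : 1 < v x) (n : ℕ) :
    v ((WeierstrassCurve.Φ W n).eval x) = v x ^ (n ^ 2) :=
  Valuation.eval_eq_pow (hW.coeff_Φ n) hx ((natDegree_Φ_le ..).trans_eq (by simp))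
    (by simpa using congrArg v (coeff_Φ W n))

/-- For `0 < j < p` the leading coefficient `j ^ 2` of `ΨSq_j` is a unit, so the leading term
dominates at `|x| > 1`. Thus `p` is the first index at which vanishing is possible. -/
lemma psiVal_ne_zero (hW : IntegralAt W v) (hp : p.Prime) (hv : v (p : L) < 1) {x y : L}
    (h : W.Nonsingular x y) (hx : 1 < v x) {j : ℕ} (hj : 1 ≤ j) (hjp : j < p) :
    W.psiVal x y j ≠ 0 := by
  intro h0
  have h1 : v ((WeierstrassCurve.ΨSq W j).eval x) = v x ^ (j ^ 2 - 1) :=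
    Valuation.eval_eq_pow (hW.coeff_ΨSq j) hx ((natDegree_ΨSq_le ..).trans_eq (by simp)) (by
      have := coeff_ΨSq W j
      rw [Int.natAbs_natCast] at this
      rw [this, map_pow, Int.cast_natCast, v.natCast_eq_one hv
        ((hp.coprime_iff_not_dvd.mpr fun h ↦ hjp.not_ge (Nat.le_of_dvd hj h)).symm), one_pow])
  rw [← psiVal_sq h.1, h0] at h1
  simp at h1
  exact pow_ne_zero _ (zero_lt_one.trans hx).ne' h1.symm

/-- A polynomial whose roots are the `x`-coordinates of the points `P` with `p • P = Q`. -/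
noncomputable def fiberPoly (W : Affine L) (p : ℕ) (c : L) : L[X] :=
  WeierstrassCurve.Φ W p - C c * WeierstrassCurve.ΨSq W p

lemma monic_fiberPoly (hp : 0 < p) (c : L) :
    (fiberPoly W p c).Monic ∧ (fiberPoly W p c).natDegree = p ^ 2 := by
  have h1 : (WeierstrassCurve.Φ W p).natDegree = p ^ 2 := by simp [natDegree_Φ]
  have h2 : (WeierstrassCurve.Φ W p).Monic := leadingCoeff_Φ ..
  have h3 : (C c * WeierstrassCurve.ΨSq W p).natDegree < (WeierstrassCurve.Φ W p).natDegree := by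
    rw [h1]
    refine (natDegree_C_mul_le _ _).trans_lt ((natDegree_ΨSq_le ..).trans_lt ?_)
    rw [Int.natAbs_natCast]
    have : 0 < p ^ 2 := by positivity
    omega
  refine ⟨h2.sub_of_left (degree_lt_degree h3), ?_⟩
  rw [fiberPoly, natDegree_sub_eq_left_of_natDegree_lt h3, h1]

variable [DecidableEq L]

/-- Multiplication by `p` in terms of division polynomials, near the origin. -/
lemma IsFormal.prime_nsmul (hW : IntegralAt W v) (hp : p.Prime) (hv : v (p : L) < 1) {x y : L}
    (h : W.Nonsingular x y) (hx : 1 < v x) :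
    ((WeierstrassCurve.ΨSq W p).eval x = 0 → p • some x y h = 0) ∧
      ((WeierstrassCurve.ΨSq W p).eval x ≠ 0 → ∃ X Y, ∃ h' : W.Nonsingular X Y,
        p • some x y h = some X Y h' ∧
        X * (WeierstrassCurve.ΨSq W p).eval x = (WeierstrassCurve.Φ W p).eval x) := by
  have hne (j : ℕ) (h1 : 1 ≤ j) (h2 : j < p) := psiVal_ne_zero hW hp hv h hx h1 h2
  rw [← psiVal_sq h.1]
  refine ⟨fun h0 ↦ nsmul_eq_zero h p hp.two_le hne (eq_zero_of_pow_eq_zero h0), fun h0 ↦ ?_⟩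
  obtain ⟨X, Y, h', e, f⟩ := exists_nsmul h p hp.one_lt.le fun j h1 h2 ↦ by
    obtain h2 | rfl := h2.lt_or_eq
    · exact hne j h1 h2
    · exact fun h ↦ h0 (by rw [h, zero_pow two_ne_zero])
  refine ⟨X, Y, h', e, ?_⟩
  rw [psiVal_succ_mul_psiVal_pred h.1, ← psiVal_sq h.1] at f
  linear_combination -f

lemma IsFormal.prime_nsmul_eq_zero_iff (hW : IntegralAt W v) (hp : p.Prime) (hv : v (p : L) < 1)
    {P : W.Point} (hP : IsFormal v P) (hP0 : P ≠ 0) :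
    p • P = 0 ↔ (WeierstrassCurve.ΨSq W p).eval (xCoord P) = 0 := by
  cases P with
  | zero => exact absurd rfl hP0
  | some x y h =>
  obtain ⟨h1, h2⟩ := prime_nsmul hW hp hv h hP
  refine ⟨fun e ↦ ?_, h1⟩
  by_contra h0
  obtain ⟨X, Y, h', e', -⟩ := h2 h0
  simp [e'] at e

lemma IsFormal.xCoord_prime_nsmul (hW : IntegralAt W v) (hp : p.Prime) (hv : v (p : L) < 1)
    {P : W.Point} (hP : IsFormal v P) (hP0 : p • P ≠ 0) :
    xCoord (p • P) * (WeierstrassCurve.ΨSq W p).eval (xCoord P) =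
      (WeierstrassCurve.Φ W p).eval (xCoord P) := by
  cases P with
  | zero => simp [← zero_def] at hP0
  | some x y h =>
  obtain ⟨h1, h2⟩ := prime_nsmul hW hp hv h hP
  obtain ⟨X, Y, h', e, f⟩ := h2 fun h ↦ hP0 (h1 h)
  rw [e]
  exact f

end WeierstrassCurve.Affine.Point

/-- An integral Weierstrass equation whose reduction at the valuation `v` of residue characteristic
`p` is supersingular: the square of the `p`-th division polynomial reduces to a constant. -/
structure WeierstrassCurve.SupersingularAt {L : Type*} [Field L] (W : WeierstrassCurve L)
    (v : Valuation L ℝ≥0) (p : ℕ) : Prop where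
  integralAt : W.IntegralAt v
  prime : p.Prime
  natCast_lt_one : v (p : L) < 1
  coeff_zero : v ((W.ΨSq p).coeff 0) = 1
  coeff_lt_one : ∀ i, i ≠ 0 → v ((W.ΨSq p).coeff i) < 1

/-! ### Fibres of multiplication by `p`, the formal `p`-torsion and the product formula. -/

namespace WeierstrassCurve.Affine.Point

variable {L : Type*} [Field L] {W : Affine L} {v : Valuation L ℝ≥0} {p : ℕ}

section

variable (S : SupersingularAt W v p)

include S

/-- Supersingularity enters here: for `|x| ≤ 1` one has `|ΨSq_p(x)| = 1`, so `c ΨSq_p(x)` is too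
large to equal `Φ_p(x)`. -/
lemma one_lt_of_isRoot_fiberPoly {c x : L} (hc : 1 < v c) (hx : (fiberPoly W p c).IsRoot x) :
    1 < v x := by
  by_contra! h
  have h1 := Valuation.eval_le_one (S.integralAt.coeff_Φ p) h
  have h2 := Valuation.eval_eq_one S.coeff_zero S.coeff_lt_one h
  simp only [fiberPoly, IsRoot, eval_sub, eval_mul, eval_C, sub_eq_zero] at hx
  rw [hx, map_mul, h2, mul_one] at h1
  exact h1.not_gt hc

lemma eval_Φ_ne_zero {x : L} (hx : 1 < v x) : (WeierstrassCurve.Φ W p).eval x ≠ 0 := by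
  intro h
  have := valuation_Φ S.integralAt hx p
  rw [h, _root_.map_zero] at this
  exact pow_ne_zero _ (zero_lt_one.trans hx).ne' this.symm

/-- A multiple root of `Φ - c Ψ` is a root of the Wronskian `Φ' Ψ - Φ Ψ'`. Its coefficient in degree
`2 p² - 2` is `p⁴ - p² (p² - 1) = p² ≠ 0`, so only finitely many `c = Φ/Ψ` are bad. -/
lemma fiberPoly_roots_nodup [CharZero L] : ∃ B : Finset L, ∀ c, 1 < v c → c ∉ B →
    (fiberPoly W p c).roots.Nodup := by
  classical
  set f := WeierstrassCurve.Φ W p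
  set g := WeierstrassCurve.ΨSq W p
  set d := derivative f * g - f * derivative g with hd
  have hp := S.prime.one_lt.le
  have hp2 : 2 ≤ p ^ 2 := S.prime.two_le.trans (Nat.le_self_pow two_ne_zero p)
  have hd0 : d ≠ 0 := by
    intro h
    have hf : f.natDegree ≤ p ^ 2 := (natDegree_Φ_le ..).trans_eq (by simp)
    have hg : g.natDegree ≤ p ^ 2 - 1 := (natDegree_ΨSq_le ..).trans_eq (by simp)
    have hf' : (derivative f).natDegree ≤ p ^ 2 - 1 :=
      (natDegree_derivative_le _).trans (by omega)
    have hg' : (derivative g).natDegree ≤ p ^ 2 - 2 :=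
      (natDegree_derivative_le _).trans (by omega)
    have cf : f.coeff (p ^ 2) = 1 := by simpa using coeff_Φ W (p : ℤ)
    have cg : g.coeff (p ^ 2 - 1) = (p : L) ^ 2 := by
      have := coeff_ΨSq W (p : ℤ)
      rwa [Int.natAbs_natCast, Int.cast_natCast] at this
    have cf' : (derivative f).coeff (p ^ 2 - 1) = (p : L) ^ 2 := by
      rw [coeff_derivative, Nat.sub_add_cancel (by omega), cf, one_mul, Nat.cast_sub (by omega)]
      push_cast
      ring
    have cg' : (derivative g).coeff (p ^ 2 - 2) = (p : L) ^ 2 * (p ^ 2 - 1) := by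
      rw [coeff_derivative, show p ^ 2 - 2 + 1 = p ^ 2 - 1 by omega, cg, Nat.cast_sub (by omega)]
      push_cast
      ring
    have e1 := coeff_mul_add_eq_of_natDegree_le hf' hg
    have e2 := coeff_mul_add_eq_of_natDegree_le hf hg'
    have e3 := congrArg (coeff · (p ^ 2 - 1 + (p ^ 2 - 1))) h
    rw [cf', cg] at e1
    rw [cf, cg', show p ^ 2 + (p ^ 2 - 2) = p ^ 2 - 1 + (p ^ 2 - 1) by omega] at e2
    simp only [hd, coeff_sub, e1, e2, coeff_zero] at e3
    have : (p : L) ^ 2 = 0 := by linear_combination e3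
    simp [S.prime.ne_zero] at this
  refine ⟨d.roots.toFinset.image fun x ↦ f.eval x / g.eval x, fun c hc hB ↦ ?_⟩
  have h0 : fiberPoly W p c ≠ 0 := (monic_fiberPoly S.prime.pos c).1.ne_zero
  rw [Multiset.nodup_iff_count_le_one]
  intro x
  rw [count_roots]
  by_contra! hx
  obtain ⟨r1, r2⟩ := (one_lt_rootMultiplicity_iff_isRoot h0).mp hx
  have hf0 := eval_Φ_ne_zero S (one_lt_of_isRoot_fiberPoly S hc r1)
  simp only [fiberPoly, IsRoot, eval_sub, eval_mul, eval_C, sub_eq_zero, derivative_sub,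
    derivative_C_mul] at r1 r2
  refine hB (Finset.mem_image.mpr ⟨x, ?_, ?_⟩)
  · rw [Multiset.mem_toFinset, mem_roots hd0, IsRoot, hd, eval_sub, eval_mul, eval_mul]
    linear_combination g.eval x * r2 - (derivative g).eval x * r1
  · have hg0 : g.eval x ≠ 0 := fun h ↦ hf0 (by rw [r1, h, mul_zero])
    rw [div_eq_iff hg0, r1]

end

lemma IsFormal.iff_one_lt {P : W.Point} (hP : P ≠ 0) : IsFormal v P ↔ 1 < v (xCoord P) := by
  cases P with
  | zero => exact absurd rfl hP
  | some x y h => rfl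

section

variable [DecidableEq L]

lemma two_nsmul_eq_zero_iff {P : W.Point} (hP : P ≠ 0) :
    2 • P = 0 ↔ (Ψ₂Sq W).eval (xCoord P) = 0 := by
  cases P with
  | zero => exact absurd rfl hP
  | some x y h =>
  rw [xCoord_some, eval_Ψ₂Sq h.1, sq_eq_zero_iff]
  refine ⟨fun e ↦ ?_, fun e ↦ nsmul_eq_zero h 2 le_rfl (fun j h1 h2 ↦ by
    obtain rfl : j = 1 := by omega
    simp [psiVal_one]) (by simpa [psiVal_two] using e)⟩
  by_contra h2
  obtain ⟨X, Y, h', e', -⟩ := exists_two_nsmul h h2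
  simp [e'] at e

variable (hW : IntegralAt W v)

include hW

lemma IsFormal.add {P Q : W.Point} (hP : IsFormal v P) (hQ : IsFormal v Q) : IsFormal v (P + Q) :=
  (isFormal_add_size_add hW hP hQ).1

lemma IsFormal.nsmul {P : W.Point} (hP : IsFormal v P) (n : ℕ) : IsFormal v (n • P) :=
  (formalSubgroup hW).nsmul_mem hP n

lemma size_nsmul_le {P : W.Point} (hP : IsFormal v P) (n : ℕ) : size v (n • P) ≤ size v P := by
  induction n with
  | zero => simp
  | succ n ih =>
    rw [succ_nsmul]
    exact (isFormal_add_size_add hW (hP.nsmul hW n) hP).2.trans (max_le ih le_rfl)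

lemma size_add_eq {P Q : W.Point} (hP : IsFormal v P) (hQ : IsFormal v Q)
    (h : size v Q < size v P) : size v (P + Q) = size v P := by
  refine le_antisymm ((isFormal_add_size_add hW hP hQ).2.trans (max_le le_rfl h.le)) ?_
  have := (isFormal_add_size_add hW (hP.add hW hQ) ((isFormal_neg Q).mpr hQ)).2
  rw [add_neg_cancel_right, size_neg] at this
  exact (le_max_iff.mp this).resolve_right h.not_ge

end

variable [IsAlgClosed L] [WeierstrassCurve.IsElliptic W]

lemma exists_xCoord_eq (x : L) : ∃ P : W.Point, P ≠ 0 ∧ xCoord P = x := by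
  obtain ⟨y, h⟩ := exists_equation W x
  exact ⟨some x y (equation_iff_nonsingular.mp h), some_ne_zero _, rfl⟩

/-- The points with `x = p ^ (-k)` provide infinitely many candidates tending to the origin. -/
lemma exists_isFormal_size_lt [CharZero L] (hp : p ≠ 0) (hv : v (p : L) < 1) (B : Finset L)
    {r : ℝ≥0} (hr : 0 < r) :
    ∃ P : W.Point, P ≠ 0 ∧ IsFormal v P ∧ size v P < r ∧ xCoord P ∉ B := by
  have h0 : v (p : L) ≠ 0 := by simpa using hp
  have hinj : Function.Injective fun k : ℕ ↦ ((p : L) ^ k)⁻¹ := by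
    intro j k h
    have := congrArg v (inv_injective h)
    rw [map_pow, map_pow] at this
    exact pow_right_injective₀ (pos_iff_ne_zero.mpr h0) hv.ne this
  have h1 := (B.finite_toSet.preimage hinj.injOn).eventually_cofinite_notMem
  rw [Nat.cofinite_eq_atTop] at h1
  have h2 := (NNReal.tendsto_pow_atTop_nhds_zero_of_lt_one hv).eventually
    (gt_mem_nhds (lt_min hr zero_lt_one))
  obtain ⟨k, hk1, hk2⟩ := (h1.and h2).exists
  obtain ⟨P, hP, e⟩ := exists_xCoord_eq (W := W) ((p : L) ^ k)⁻¹
  refine ⟨P, hP, (IsFormal.iff_one_lt hP).mpr ?_, ?_, by simpa [e] using hk1⟩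
  · rw [e, map_inv₀, map_pow]
    exact (one_lt_inv₀ (by positivity)).mpr (hk2.trans_le (min_le_right ..))
  · rw [← inv_inv (size v P), ← IsFormal.valuation_xCoord, e, map_inv₀, map_pow, inv_inv]
    exact hk2.trans_le (min_le_left ..)

section

variable [DecidableEq L] (S : SupersingularAt W v p)

include S

lemma exists_prime_nsmul_eq_of_isRoot {Q : W.Point} (hQ : IsFormal v Q) (hQ0 : Q ≠ 0) {x : L}
    (hx : (fiberPoly W p (xCoord Q)).IsRoot x) :
    ∃ P : W.Point, IsFormal v P ∧ xCoord P = x ∧ p • P = Q := by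
  have hx1 := one_lt_of_isRoot_fiberPoly S ((IsFormal.iff_one_lt hQ0).mp hQ) hx
  obtain ⟨P, hP0, e⟩ := exists_xCoord_eq (W := W) x
  have hP : IsFormal v P := (IsFormal.iff_one_lt hP0).mpr (e ▸ hx1)
  have hf0 := eval_Φ_ne_zero S hx1
  simp only [fiberPoly, IsRoot, eval_sub, eval_mul, eval_C, sub_eq_zero] at hx
  have hg0 : (WeierstrassCurve.ΨSq W p).eval x ≠ 0 := fun h ↦ hf0 (by rw [hx, h, mul_zero])
  have h0 : p • P ≠ 0 := by
    rwa [Ne, hP.prime_nsmul_eq_zero_iff S.integralAt S.prime S.natCast_lt_one hP0, e]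
  have key := hP.xCoord_prime_nsmul S.integralAt S.prime S.natCast_lt_one h0
  rw [e, hx] at key
  rcases eq_or_eq_neg_of_xCoord_eq h0 hQ0 (mul_right_cancel₀ hg0 key) with h | h
  · exact ⟨P, hP, e, h⟩
  · exact ⟨-P, by simpa, by simpa, by rw [smul_neg, h, neg_neg]⟩

lemma exists_prime_nsmul_eq {Q : W.Point} (hQ : IsFormal v Q) :
    ∃ P : W.Point, IsFormal v P ∧ p • P = Q := by
  by_cases hQ0 : Q = 0
  · exact ⟨0, by simp, by simp [hQ0]⟩
  · obtain ⟨m, d⟩ := monic_fiberPoly (W := W) S.prime.pos (xCoord Q)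
    obtain ⟨x, hx⟩ := IsAlgClosed.exists_root (fiberPoly W p (xCoord Q)) (by
      rw [degree_eq_natDegree m.ne_zero, d]
      exact_mod_cast (pow_pos S.prime.pos 2).ne')
    obtain ⟨P, h1, -, h2⟩ := exists_prime_nsmul_eq_of_isRoot S hQ hQ0 hx
    exact ⟨P, h1, h2⟩

/-- If `p • P` is not of order two, its preimages under `p` correspond to roots of `fiberPoly`. -/
lemma bijOn_fiber {P : W.Point} (hP : IsFormal v P) (h2 : 2 • p • P ≠ 0) :
    Set.BijOn (fun T ↦ xCoord (P + T)) {T : W.Point | IsFormal v T ∧ p • T = 0}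
      (fiberPoly W p (xCoord (p • P))).roots.toFinset := by
  have hP0 : p • P ≠ 0 := fun h ↦ h2 (by rw [h, smul_zero])
  have key (T : W.Point) (hT : p • T = 0) : p • (P + T) = p • P := by rw [smul_add, hT, add_zero]
  have hne (T : W.Point) (hT : p • T = 0) : P + T ≠ 0 := fun h ↦ hP0 (by
    rw [← key T hT, h, smul_zero])
  have m := (monic_fiberPoly (W := W) S.prime.pos (xCoord (p • P))).1.ne_zero
  refine ⟨fun T hT ↦ ?_, fun T hT T' hT' h ↦ ?_, fun x hx ↦ ?_⟩
  · have := (hP.add S.integralAt hT.1).xCoord_prime_nsmul S.integralAt S.prime S.natCast_lt_one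
      (by rwa [key T hT.2])
    rw [key T hT.2] at this
    rw [Finset.mem_coe, Multiset.mem_toFinset, mem_roots m, fiberPoly, IsRoot, eval_sub, eval_mul,
      eval_C, ← this, sub_self]
  · rcases eq_or_eq_neg_of_xCoord_eq (hne T hT.2) (hne T' hT'.2) h with h | h
    · exact add_left_cancel h
    -- The sign ambiguity of `x`-coordinates would give `p • P = -(p • P)`, which `h2` excludes.
    · have e := congrArg (p • ·) h
      simp only [smul_neg, key T hT.2, key T' hT'.2] at e
      exact absurd (by rw [two_nsmul]; nth_rw 1 [e]; simp) h2
  · rw [Finset.mem_coe, Multiset.mem_toFinset, mem_roots m] at hx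
    obtain ⟨P', h1, h2, h3⟩ := exists_prime_nsmul_eq_of_isRoot S (hP.nsmul S.integralAt p) hP0 hx
    refine ⟨P' - P, ⟨?_, by rw [smul_sub, h3, sub_self]⟩, by simp [h2]⟩
    exact (formalSubgroup S.integralAt).sub_mem h1 hP

/-- Over a point outside the finite bad set the fibre polynomial has `p ^ 2` distinct roots, and
`bijOn_fiber` matches them with the formal `p`-torsion. -/
lemma exists_kernel [CharZero L] : ∃ k : Finset W.Point,
    (∀ T, T ∈ k ↔ IsFormal v T ∧ p • T = 0) ∧ k.card = p ^ 2 := by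
  obtain ⟨B, hB⟩ := fiberPoly_roots_nodup S
  obtain ⟨Q, hQ0, hQ, -, hQB⟩ := exists_isFormal_size_lt (W := W) (v := v) S.prime.ne_zero
    S.natCast_lt_one (B ∪ (Ψ₂Sq W).roots.toFinset) zero_lt_one
  rw [Finset.notMem_union] at hQB
  obtain ⟨P, hP, rfl⟩ := exists_prime_nsmul_eq S hQ
  have h2 : 2 • p • P ≠ 0 := by
    intro h
    exact hQB.2 (by
      rw [Multiset.mem_toFinset, mem_roots (Ψ₂Sq_ne_zero W (by simp))]
      exact (two_nsmul_eq_zero_iff hQ0).mp h)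
  have hb := bijOn_fiber S hP h2
  have hfin : {T : W.Point | IsFormal v T ∧ p • T = 0}.Finite :=
    hb.finite_iff_finite.mpr (Finset.finite_toSet _)
  refine ⟨hfin.toFinset, fun T ↦ by simp, ?_⟩
  rw [← Set.ncard_eq_toFinset_card _ hfin, ← hb.injOn.ncard_image, hb.image_eq,
    Set.ncard_coe_finset, Multiset.toFinset_card_of_nodup
      (hB _ ((IsFormal.iff_one_lt hQ0).mp hQ) hQB.1),
    ← (IsAlgClosed.splits _).natDegree_eq_card_roots, (monic_fiberPoly S.prime.pos _).2]

variable {k : Finset W.Point} (hk : ∀ T, T ∈ k ↔ IsFormal v T ∧ p • T = 0) (hkc : k.card = p ^ 2)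

include hk hkc

/-- The `x(P + T)` are all the roots of the monic fibre polynomial, so their product is, up to sign,
`Φ(0) - c ΨSq(0)` with `c = x(p • P)`. As `|ΨSq(0)| = 1` and `|c| > 1`, its absolute value is `|c|`.
-/
lemma prod_size_add_of_two_nsmul_ne_zero {P : W.Point} (hP : IsFormal v P)
    (h2 : 2 • p • P ≠ 0) : ∏ T ∈ k, size v (P + T) = size v (p • P) := by
  have hP0 : p • P ≠ 0 := fun h ↦ h2 (by rw [h, smul_zero])
  have hb := bijOn_fiber S hP h2
  have hk' : {T : W.Point | IsFormal v T ∧ p • T = 0} = k := by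
    ext T
    simp [hk]
  rw [hk'] at hb
  obtain ⟨m, d⟩ := monic_fiberPoly (W := W) S.prime.pos (xCoord (p • P))
  set f := fiberPoly W p (xCoord (p • P)) with hf
  have hs := IsAlgClosed.splits f
  have hval : f.roots.toFinset.val = f.roots := by
    refine Multiset.eq_of_le_of_card_le (Multiset.dedup_le _) ?_
    rw [← hs.natDegree_eq_card_roots, d, ← hkc]
    exact Finset.card_le_card_of_injOn _ hb.mapsTo hb.injOn
  have h1 : f.roots.prod = ∏ T ∈ k, xCoord (P + T) := by
    have := Finset.prod_nbij (t := f.roots.toFinset) (f := fun T ↦ xCoord (P + T)) (g := id)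
      (fun T ↦ xCoord (P + T)) hb.mapsTo hb.injOn hb.surjOn fun _ _ ↦ rfl
    rw [this, Finset.prod_eq_multiset_prod, hval, Multiset.map_id]
  have h3 := hs.coeff_zero_eq_prod_roots_of_monic m
  have hc := (IsFormal.iff_one_lt hP0).mp (hP.nsmul S.integralAt p)
  have h4 : v (f.coeff 0) = v (xCoord (p • P)) := by
    have e : v (xCoord (p • P) * (WeierstrassCurve.ΨSq W p).coeff 0) = v (xCoord (p • P)) := by
      rw [map_mul, S.coeff_zero, mul_one]
    rw [hf, fiberPoly, coeff_sub, coeff_C_mul, Valuation.map_sub_eq_of_lt_right, e]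
    rw [e]
    exact (S.integralAt.coeff_Φ _ _).trans_lt hc
  rw [h3, h1, map_mul, map_pow, Valuation.map_neg, _root_.map_one, one_pow, one_mul, map_prod] at h4
  simp only [IsFormal.valuation_xCoord] at h4
  rw [Finset.prod_inv_distrib] at h4
  exact inv_injective h4

/-- The product formula for the isogeny `p`. -/
theorem prod_size_add [CharZero L] {P : W.Point} (hP : IsFormal v P) (h0 : p • P ≠ 0) :
    ∏ T ∈ k, size v (P + T) = size v (p • P) := by
  by_cases h2 : 2 • p • P = 0
  swap
  · exact prod_size_add_of_two_nsmul_ne_zero S hk hkc hP h2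
  have hne (T : W.Point) (hT : T ∈ k) : 0 < size v (P + T) := by
    rw [pos_iff_ne_zero, Ne, (hP.add S.integralAt ((hk T).mp hT).1).size_eq_zero_iff]
    intro h
    have e := congrArg (p • ·) h
    simp only [smul_add, smul_zero, ((hk T).mp hT).2, add_zero] at e
    exact h0 e
  obtain ⟨T₀, hT₀, hmin⟩ := k.exists_min_image (fun T ↦ size v (P + T)) ⟨0, by simp [hk]⟩
  have hpos : 0 < size v (p • P) := by
    rwa [pos_iff_ne_zero, Ne, (hP.nsmul S.integralAt p).size_eq_zero_iff]
  -- When `p • P` has order two, `P` is perturbed by a point `E` so small that no size changes, yet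
  -- `p • (P + E)` is no longer `2`-torsion.
  obtain ⟨E, hE0, hE, hlt, hEB⟩ := exists_isFormal_size_lt (W := W) (v := v) S.prime.ne_zero
    S.natCast_lt_one ((WeierstrassCurve.ΨSq W p).roots.toFinset ∪
      (Ψ₂Sq W).roots.toFinset.biUnion fun e ↦ (fiberPoly W p e).roots.toFinset)
    (lt_min (hne T₀ hT₀) hpos)
  rw [Finset.notMem_union] at hEB
  obtain ⟨hlt1, hlt2⟩ := lt_min_iff.mp hlt
  have hpE0 : p • E ≠ 0 := by
    intro h
    refine hEB.1 ?_
    rw [Multiset.mem_toFinset, mem_roots (ΨSq_ne_zero W (by simpa using S.prime.ne_zero))]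
    exact (hE.prime_nsmul_eq_zero_iff S.integralAt S.prime S.natCast_lt_one hE0).mp h
  have h2E : 2 • p • (P + E) ≠ 0 := by
    rw [smul_add, smul_add, h2, zero_add]
    intro h
    refine hEB.2 (Finset.mem_biUnion.mpr ⟨xCoord (p • E), ?_, ?_⟩)
    · rw [Multiset.mem_toFinset, mem_roots (Ψ₂Sq_ne_zero W (by simp))]
      exact (two_nsmul_eq_zero_iff hpE0).mp h
    · rw [Multiset.mem_toFinset, mem_roots (monic_fiberPoly S.prime.pos _).1.ne_zero, fiberPoly,
        IsRoot, eval_sub, eval_mul, eval_C,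
        ← hE.xCoord_prime_nsmul S.integralAt S.prime S.natCast_lt_one hpE0, sub_self]
  rw [← size_add_eq S.integralAt (hP.nsmul S.integralAt p) (hE.nsmul S.integralAt p)
    ((size_nsmul_le S.integralAt hE p).trans_lt hlt2), ← smul_add,
    ← prod_size_add_of_two_nsmul_ne_zero S hk hkc (hP.add S.integralAt hE) h2E]
  refine Finset.prod_congr rfl fun T hT ↦ ?_
  rw [add_right_comm, size_add_eq S.integralAt (hP.add S.integralAt ((hk T).mp hT).1) hE
    (hlt1.trans_le (hmin T hT))]

end

end WeierstrassCurve.Affine.Point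

/-! ### Abstract divisible groups with a valuation, and the shape of a fibre. -/

/-- A valuation `ν` on the nonzero elements of a `p`-divisible abelian group with finite
`p`-torsion `k` of rank two, such that multiplication by `p` is given by a product over `k`. -/
structure DivisibleValuation {G : Type*} [AddCommGroup G] (p : ℕ) (ν : G → ℝ) (k : Finset G) :
    Prop where
  prime : p.Prime
  pos : ∀ P, P ≠ 0 → 0 < ν P
  min_le : ∀ P Q, P ≠ 0 → Q ≠ 0 → P + Q ≠ 0 → min (ν P) (ν Q) ≤ ν (P + Q)
  neg : ∀ P, ν (-P) = ν P
  mem_iff : ∀ T, T ∈ k ↔ p • T = 0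
  card_eq : k.card = p ^ 2
  exists_nsmul_eq : ∀ Q : G, ∃ P : G, p • P = Q
  sum_add : ∀ P, p • P ≠ 0 → ∑ T ∈ k, ν (P + T) = ν (p • P)

/-- The situation of `DivisibleValuation` with a canonical subgroup `C` of the `p`-torsion: the
valuation is `u` on `C` and `w < u` on the remaining `p`-torsion. -/
structure CanonicalValuation {G : Type*} [AddCommGroup G] (p : ℕ) (ν : G → ℝ) (k : Finset G)
    (C : AddSubgroup G) (u w : ℝ) : Prop extends DivisibleValuation p ν k where
  nsmul_eq_zero : ∀ T ∈ C, p • T = 0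
  card_subgroup : Nat.card C = p
  eq_of_mem : ∀ T ∈ C, T ≠ 0 → ν T = u
  eq_of_notMem : ∀ T, p • T = 0 → T ∉ C → ν T = w
  pos_w : 0 < w
  lt : w < u

namespace DivisibleValuation

variable {G : Type*} [AddCommGroup G] {p : ℕ} {ν : G → ℝ} {k : Finset G}

section

variable (H : DivisibleValuation p ν k)

include H

lemma add_eq_of_lt {P Q : G} (hP : P ≠ 0) (hQ : Q ≠ 0) (h : ν P < ν Q) : ν (P + Q) = ν P := by
  have h0 : P + Q ≠ 0 := fun e ↦ h.ne (by rw [eq_neg_of_add_eq_zero_left e, H.neg])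
  refine le_antisymm ?_ (by simpa [h.le] using H.min_le P Q hP hQ h0)
  have := H.min_le (P + Q) (-Q) h0 (neg_ne_zero.mpr hQ) (by simpa)
  rw [add_neg_cancel_right, H.neg] at this
  exact (min_le_iff.mp this).resolve_right h.not_ge

lemma le_nsmul {P : G} (hP : P ≠ 0) (n : ℕ) (h : n • P ≠ 0) : ν P ≤ ν (n • P) := by
  induction n with
  | zero => simp at h
  | succ n ih =>
    rw [succ_nsmul] at h ⊢
    by_cases h0 : n • P = 0
    · simp [h0]
    · exact (le_min (ih h0) le_rfl).trans (H.min_le _ _ h0 hP h)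

lemma le_zsmul {P : G} (hP : P ≠ 0) (n : ℤ) (h : n • P ≠ 0) : ν P ≤ ν (n • P) := by
  rcases n.eq_nat_or_neg with ⟨m, rfl | rfl⟩
  · rw [natCast_zsmul] at h ⊢
    exact H.le_nsmul hP m h
  · rw [neg_smul, natCast_zsmul] at h ⊢
    rw [H.neg]
    exact H.le_nsmul hP m (neg_ne_zero.mp h)

/-- An integer prime to `p` is invertible on `p`-torsion, so `le_zsmul` applies in both directions.
-/
lemma zsmul_eq {P : G} (hP : p • P = 0) (n : ℤ) (h : n • P ≠ 0) : ν (n • P) = ν P := by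
  have hP0 : P ≠ 0 := fun e ↦ h (by simp [e])
  refine le_antisymm ?_ (H.le_zsmul hP0 n h)
  have hn : IsCoprime n p := by
    refine ((Nat.prime_iff_prime_int.mp H.prime).coprime_iff_not_dvd.mpr ?_).symm
    rintro ⟨d, rfl⟩
    rw [mul_comm, mul_smul, natCast_zsmul, hP, smul_zero] at h
    exact h rfl
  obtain ⟨a, b, hab⟩ := hn
  have e : a • n • P = P := by
    rw [smul_smul, eq_sub_of_add_eq hab, sub_smul, one_smul, mul_smul, natCast_zsmul, hP, smul_zero,
      sub_zero]
  have := H.le_zsmul h a (by rwa [e])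
  rwa [e] at this

/-- A point of the `p`-torsion of maximal valuation generates a canonical subgroup. -/
theorem canonicalValuation {R Q : G} (hR : p • R = 0) (hQ : p • Q = 0) (hR0 : R ≠ 0) (hQ0 : Q ≠ 0)
    (hlt : ν Q < ν R) :
    CanonicalValuation p ν k (AddSubgroup.zmultiples R) (ν R) (ν Q) := by
  have := Fact.mk H.prime
  have hmem : ∀ T ∈ AddSubgroup.zmultiples R, T ≠ 0 → ν T = ν R := by
    rintro _ ⟨n, rfl⟩ h
    exact H.zsmul_eq hR n h
  have hcard : Nat.card (AddSubgroup.zmultiples R) = p := by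
    rw [Nat.card_zmultiples, addOrderOf_eq_prime hR hR0]
  have hQR : Q ∉ AddSubgroup.zmultiples R := fun h ↦ hlt.ne (hmem Q h hQ0)
  -- The order of the span divides `p ^ 2` and exceeds `p` because `Q` is not a multiple of `R`; so
  -- `R` and `Q` generate the whole `p`-torsion.
  have hker : AddSubgroup.zmultiples R ⊔ AddSubgroup.zmultiples Q =
      (nsmulAddMonoidHom (α := G) p).ker := by
    have hk : ((nsmulAddMonoidHom (α := G) p).ker : Set G) = k := by
      ext T
      simp [H.mem_iff]
    have hkc : Nat.card (nsmulAddMonoidHom (α := G) p).ker = p ^ 2 := by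
      rw [← H.card_eq, ← Set.ncard_coe_finset, ← hk]
      rfl
    have hfin : Finite (nsmulAddMonoidHom (α := G) p).ker :=
      Nat.finite_of_card_ne_zero (by rw [hkc]; exact (pow_pos H.prime.pos 2).ne')
    have hle : AddSubgroup.zmultiples R ⊔ AddSubgroup.zmultiples Q ≤
        (nsmulAddMonoidHom (α := G) p).ker := by
      rw [sup_le_iff, AddSubgroup.zmultiples_le, AddSubgroup.zmultiples_le]
      exact ⟨hR, hQ⟩
    have hd := AddSubgroup.card_dvd_of_le hle
    have hfin' : Finite (AddSubgroup.zmultiples R ⊔ AddSubgroup.zmultiples Q :) :=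
      Finite.of_injective _ (AddSubgroup.inclusion_injective hle)
    rw [hkc, Nat.dvd_prime_pow H.prime] at hd
    obtain ⟨i, hi, e⟩ := hd
    have hd' := AddSubgroup.card_dvd_of_le
      (le_sup_left : AddSubgroup.zmultiples R ≤ _ ⊔ AddSubgroup.zmultiples Q)
    have hne : i ≠ 1 := by
      rintro rfl
      rw [pow_one, ← hcard] at e
      have := AddSubgroup.eq_of_le_of_card_ge
        (le_sup_left : AddSubgroup.zmultiples R ≤ _ ⊔ AddSubgroup.zmultiples Q) e.le
      exact hQR (this ▸ AddSubgroup.mem_sup_right (AddSubgroup.mem_zmultiples Q))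
    have hne' : i ≠ 0 := by
      rintro rfl
      rw [pow_zero] at e
      rw [e, hcard, Nat.dvd_one] at hd'
      exact H.prime.one_lt.ne' hd'
    obtain rfl : i = 2 := by omega
    exact AddSubgroup.eq_of_le_of_card_ge hle (by rw [e, hkc])
  refine { H with
    nsmul_eq_zero := ?_, card_subgroup := hcard, eq_of_mem := hmem, eq_of_notMem := ?_,
    pos_w := H.pos Q hQ0, lt := hlt }
  · rintro _ ⟨n, rfl⟩
    simp only
    rw [smul_comm, hR, smul_zero]
  · intro T hT hTR
    have : T ∈ AddSubgroup.zmultiples R ⊔ AddSubgroup.zmultiples Q := hker ▸ hT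
    obtain ⟨_, ⟨a, rfl⟩, _, ⟨b, rfl⟩, rfl⟩ := AddSubgroup.mem_sup.mp this
    simp only at hTR ⊢
    have hb : b • Q ≠ 0 := fun e ↦ hTR (by rw [e, add_zero]; exact ⟨a, rfl⟩)
    rw [add_comm]
    by_cases ha : a • R = 0
    · rw [ha, add_zero, H.zsmul_eq hQ b hb]
    · rw [H.add_eq_of_lt hb ha (by rwa [H.zsmul_eq hQ b hb, H.zsmul_eq hR a ha]),
        H.zsmul_eq hQ b hb]

omit H in
-- With a base point chosen in each fibre over `A`, the part of `B` in that fibre is a translate of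
-- `D`.
lemma ncard_of_fibers {A B D : Set G} (hD : ∀ T ∈ D, p • T = 0) (hB : ∀ P ∈ B, p • P ∈ A)
    (h : ∀ S ∈ A, ∃ P, p • P = S ∧ ∀ T, p • T = 0 → (P + T ∈ B ↔ T ∈ D)) :
    B.ncard = A.ncard * D.ncard := by
  choose! f hf1 hf2 using h
  rw [← Set.ncard_prod]
  refine (Set.BijOn.ncard_eq (f := fun x : G × G ↦ f x.1 + x.2) ⟨?_, ?_, ?_⟩).symm
  · rintro ⟨S, T⟩ ⟨hS, hT⟩
    exact (hf2 S hS T (hD T hT)).mpr hT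
  · rintro ⟨S, T⟩ ⟨hS, hT⟩ ⟨S', T'⟩ ⟨hS', hT'⟩ e
    simp only at hS hS' hT hT' e
    have e' := congrArg (p • ·) e
    simp only [smul_add, hf1 S hS, hf1 S' hS', hD T hT, hD T' hT', add_zero] at e'
    subst e'
    rw [add_left_cancel e]
  · intro P hP
    have h1 := hB P hP
    have h2 : p • (P - f (p • P)) = 0 := by rw [smul_sub, hf1 _ h1, sub_self]
    refine ⟨(p • P, P - f (p • P)), ⟨h1, (hf2 _ h1 _ h2).mp (by simpa)⟩, by simp⟩

end

end DivisibleValuation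

namespace CanonicalValuation

variable {G : Type*} [AddCommGroup G] {p : ℕ} {ν : G → ℝ} {k : Finset G} {C : AddSubgroup G}
  {u w : ℝ}

variable (H : CanonicalValuation p ν k C u w)

include H

/-- The term at `0` is kept apart because `ν 0` has no meaning. -/
lemma sum_kernel (f : ℝ → ℝ) (a : ℝ) (g : G → ℝ) (h0 : g 0 = a)
    (hg : ∀ T, p • T = 0 → T ≠ 0 → g T = f (ν T)) :
    ∑ T ∈ k, g T = a + (p - 1) * f u + (p ^ 2 - p) * f w := by
  classical
  have hCk : (C : Set G).ncard = p := H.card_subgroup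
  have h0k : (0 : G) ∈ k := by simp [H.mem_iff]
  have hsub : (k.filter (· ∈ C)).card = p := by
    rw [← Set.ncard_coe_finset, ← hCk]
    congr 1
    ext T
    simp only [Finset.coe_filter, Set.mem_ofPred_eq, SetLike.mem_coe, and_iff_right_iff_imp]
    exact fun h ↦ (H.mem_iff T).mpr (H.nsmul_eq_zero T h)
  have hp1 := H.prime.one_lt.le
  have h1 : ∑ T ∈ (k.filter (· ∈ C)).erase 0, g T = (p - 1) * f u := by
    rw [Finset.sum_congr rfl (g := fun _ ↦ f u), Finset.sum_const,
      Finset.card_erase_of_mem (by simp [h0k, C.zero_mem]), hsub, nsmul_eq_mul, Nat.cast_sub hp1,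
      Nat.cast_one]
    intro T hT
    simp only [Finset.mem_erase, Finset.mem_filter, H.mem_iff] at hT
    rw [hg T hT.2.1 hT.1, H.eq_of_mem T hT.2.2 hT.1]
  have h2 : ∑ T ∈ k.filter (· ∉ C), g T = (p ^ 2 - p) * f w := by
    have hc := Finset.card_filter_add_card_filter_not (s := k) (· ∈ C)
    rw [hsub, H.card_eq] at hc
    have : ((k.filter (· ∉ C)).card : ℝ) = (p : ℝ) ^ 2 - p := by
      rw [eq_sub_iff_add_eq']
      exact_mod_cast hc
    rw [Finset.sum_congr rfl (g := fun _ ↦ f w), Finset.sum_const, nsmul_eq_mul, this]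
    intro T hT
    simp only [Finset.mem_filter, H.mem_iff] at hT
    rw [hg T hT.1 (fun e ↦ hT.2 (e ▸ C.zero_mem)), H.eq_of_notMem T hT.1 hT.2]
  rw [← Finset.sum_filter_add_sum_filter_not k (· ∈ C),
    ← Finset.add_sum_erase _ g (a := 0) (by simp [h0k, C.zero_mem]), h0, h1, h2]

/-- Take `P` of maximal valuation in its fibre. The ultrametric law gives the minimum except when `ν
P = ν T`, where maximality prevents a larger value. The product formula becomes an equation for `ν
P`. -/
lemma exists_fiber {S : G} (hS : S ≠ 0) : ∃ P, p • P = S ∧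
    (∀ T, p • T = 0 → T ≠ 0 → ν (P + T) = min (ν P) (ν T)) ∧
    ν S = ν P + (p - 1) * min (ν P) u + (p ^ 2 - p) * min (ν P) w := by
  obtain ⟨P, rfl⟩ := H.exists_nsmul_eq S
  obtain ⟨T₀, hT₀, hmax⟩ := k.exists_max_image (fun T ↦ ν (P + T)) ⟨0, by simp [H.mem_iff]⟩
  rw [H.mem_iff] at hT₀
  have e : p • (P + T₀) = p • P := by rw [smul_add, hT₀, add_zero]
  have hne (T : G) (hT : p • T = 0) : P + T ≠ 0 := fun h ↦ hS (by
    have := congrArg (p • ·) h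
    simpa [smul_add, hT] using this)
  have key (T : G) (hT : p • T = 0) (hT0 : T ≠ 0) :
      ν (P + T₀ + T) = min (ν (P + T₀)) (ν T) := by
    rcases lt_trichotomy (ν (P + T₀)) (ν T) with h | h | h
    · rw [H.add_eq_of_lt (hne _ hT₀) hT0 h, min_eq_left h.le]
    · refine le_antisymm ?_ (H.min_le _ _ (hne _ hT₀) hT0 ?_)
      · rw [h, min_self, ← h, add_assoc]
        exact hmax _ ((H.mem_iff _).mpr (by rw [smul_add, hT₀, hT, add_zero]))
      · rw [add_assoc]
        exact hne _ (by rw [smul_add, hT₀, hT, add_zero])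
    · rw [add_comm, H.add_eq_of_lt hT0 (hne _ hT₀) h, min_eq_right h.le]
  refine ⟨P + T₀, e, key, ?_⟩
  rw [← H.sum_kernel (fun t ↦ min (ν (P + T₀)) t) _ (fun T ↦ ν (P + T₀ + T)) (by simp) key, ← e,
    H.sum_add _ (by rwa [e])]

lemma two_le : (2 : ℝ) ≤ p := by exact_mod_cast H.prime.two_le

lemma sq_sub_pos : 0 < (p : ℝ) ^ 2 - p := by
  nlinarith [H.two_le]

/-- If the maximal preimage had valuation above `w`, the product formula would exceed `p ^ 2 * w`.
Hence every minimum in `exists_fiber` is `ν P₀`, and the fibre has constant valuation. -/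
lemma eq_of_le {P : G} (h0 : p • P ≠ 0) (h : ν (p • P) ≤ p ^ 2 * w) :
    ν P = ν (p • P) / p ^ 2 := by
  obtain ⟨P₀, e, h1, h2⟩ := H.exists_fiber h0
  have hp := H.two_le
  have hp' := H.sq_sub_pos
  have hle : ν P₀ ≤ w := by
    by_contra! hlt
    rw [min_eq_right hlt.le] at h2
    have : w < min (ν P₀) u := lt_min hlt H.lt
    nlinarith
  rw [min_eq_left hle, min_eq_left (hle.trans H.lt.le)] at h2
  have hP : ν P = ν P₀ := by
    have hT : p • (P - P₀) = 0 := by rw [smul_sub, e, sub_self]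
    by_cases hT0 : P - P₀ = 0
    · rw [sub_eq_zero.mp hT0]
    · have := h1 _ hT hT0
      rw [add_sub_cancel] at this
      rw [this, min_eq_left]
      by_cases hC : P - P₀ ∈ C
      · rw [H.eq_of_mem _ hC hT0]
        exact hle.trans H.lt.le
      · rwa [H.eq_of_notMem _ hT hC]
  rw [hP, h2]
  field_simp
  ring

/-- Here the maximal valuation lies in `(w, u]`: at most `w` would give `ν S ≤ p ^ 2 * w`, while
above `u` the relation `hsum` would give `ν S > u + 1`. So the fibre splits into one coset of `C`
and the rest. -/
lemma exists_fiber_of_lt (hsum : (p - 1) * u + (p ^ 2 - p) * w = 1) {S : G} (hS : S ≠ 0)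
    (h : p ^ 2 * w < ν S) (h' : ν S ≤ u) : ∃ P, p • P = S ∧
      (∀ T ∈ C, ν (P + T) = (ν S - (p ^ 2 - p) * w) / p) ∧
      ∀ T, p • T = 0 → T ∉ C → ν (P + T) = w := by
  obtain ⟨P₀, e, h1, h2⟩ := H.exists_fiber hS
  have hp := H.two_le
  have hp' := H.sq_sub_pos
  have hw : w < ν P₀ := by
    by_contra! hle
    rw [min_eq_left hle, min_eq_left (hle.trans H.lt.le)] at h2
    nlinarith
  have hu : ν P₀ ≤ u := by
    by_contra! hlt
    rw [min_eq_right hw.le, min_eq_right hlt.le] at h2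
    linarith
  rw [min_eq_right hw.le, min_eq_left hu] at h2
  have h3 : ν P₀ = (ν S - (p ^ 2 - p) * w) / p := by
    rw [h2]
    field_simp
    ring
  refine ⟨P₀, e, fun T hT ↦ ?_, fun T hT hC ↦ ?_⟩
  · rw [← h3]
    by_cases hT0 : T = 0
    · simp [hT0]
    · rw [h1 T (H.nsmul_eq_zero T hT) hT0, H.eq_of_mem T hT hT0, min_eq_left hu]
  · rw [h1 T hT (fun e ↦ hC (e ▸ C.zero_mem)), H.eq_of_notMem T hT hC, min_eq_right hw.le]

end CanonicalValuation

/-! ### Counting torsion above and not above the canonical subgroup. -/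

namespace CanonicalValuation

variable {G : Type*} [AddCommGroup G] {p : ℕ} {ν : G → ℝ} {k : Finset G} {C : AddSubgroup G}
  {u w : ℝ}

/-- The elements of order `p ^ (m + 1)` above the subgroup `C` of the `p`-torsion. -/
def above (p : ℕ) (C : AddSubgroup G) (m : ℕ) : Set G := {P | p ^ m • P ∈ C ∧ p ^ m • P ≠ 0}

/-- The elements of order `p ^ (m + 1)` not above the subgroup `C` of the `p`-torsion. -/
def notAbove (p : ℕ) (C : AddSubgroup G) (m : ℕ) : Set G :=
  {P | p • p ^ m • P = 0 ∧ p ^ m • P ∉ C}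

/-- The largest valuation of an element of `above p C m`, as long as `m` is small. -/
noncomputable def branch (p : ℕ) (w : ℝ) (m : ℕ) : ℝ :=
  (1 - (p : ℝ) ^ m * (((p : ℝ) ^ 2 - p) * w)) / ((p : ℝ) ^ m * (p - 1))

lemma mem_above_succ {P : G} {m : ℕ} : P ∈ above p C (m + 1) ↔ p • P ∈ above p C m := by
  simp only [above, Set.mem_ofPred_eq, smul_smul, pow_succ]

lemma mem_notAbove_succ {P : G} {m : ℕ} : P ∈ notAbove p C (m + 1) ↔ p • P ∈ notAbove p C m := by
  simp only [notAbove, Set.mem_ofPred_eq, smul_smul, pow_succ, mul_assoc]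

lemma ne_zero_of_mem_above {P : G} {m : ℕ} (h : P ∈ above p C m) : P ≠ 0 := by
  rintro rfl
  simp [above] at h

lemma ne_zero_of_mem_notAbove {P : G} {m : ℕ} (h : P ∈ notAbove p C m) : P ≠ 0 := by
  rintro rfl
  simp [notAbove, C.zero_mem] at h

variable (H : CanonicalValuation p ν k C u w)

include H

lemma ncard_kernel : {T : G | p • T = 0}.ncard = p ^ 2 := by
  rw [← H.card_eq, ← Set.ncard_coe_finset]
  congr 1
  ext T
  simp [H.mem_iff]

lemma ncard_kernel_diff : {T : G | p • T = 0 ∧ T ∉ C}.ncard = p ^ 2 - p := by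
  have h1 : {T : G | p • T = 0 ∧ T ∉ C} = {T : G | p • T = 0} \ C := rfl
  have h2 : (C : Set G).ncard = p := H.card_subgroup
  have h3 : (C : Set G) ⊆ {T : G | p • T = 0} := fun T hT ↦ H.nsmul_eq_zero T hT
  rw [h1, Set.ncard_sdiff h3
    (Set.finite_of_ncard_ne_zero (by rw [h2]; exact H.prime.ne_zero)), h2, H.ncard_kernel]

/-- With `μ = (p ^ 2 - p) * w` this identifies `s` as the first level at which fibres over the main
branch no longer split. -/
lemma lt_branch_iff (m : ℕ) : p ^ 2 * w < branch p w m ↔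
    ((p : ℝ) ^ 2 - p) * w < 1 / ((p : ℝ) ^ m * (p + 1)) := by
  have hp := H.two_le
  have : 0 < (p : ℝ) ^ m := by positivity
  have h1 : 0 < (p : ℝ) - 1 := by linarith
  rw [branch, lt_div_iff₀ (by positivity), lt_div_iff₀ (by positivity), lt_sub_iff_add_lt]
  ring_nf

lemma branch_succ (m : ℕ) : branch p w (m + 1) = (branch p w m - (p ^ 2 - p) * w) / p := by
  have hp := H.two_le
  have h1 : (p : ℝ) - 1 ≠ 0 := by linarith
  have h2 : (p : ℝ) ≠ 0 := by linarith
  rw [branch, branch]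
  field_simp
  ring

lemma w_lt : w < p ^ 2 * w :=
  lt_mul_of_one_lt_left H.pos_w (one_lt_pow₀ (by linarith [H.two_le]) two_ne_zero)

lemma w_le : w ≤ p ^ 2 * w := H.w_lt.le

section

variable (hsum : (p - 1) * u + (p ^ 2 - p) * w = 1)

include hsum

lemma branch_zero : branch p w 0 = u := by
  have hp := H.two_le
  have h1 : (p : ℝ) - 1 ≠ 0 := by linarith
  rw [branch, pow_zero, one_mul, one_mul, div_eq_iff h1]
  linear_combination -hsum

lemma branch_bounds {m : ℕ} (hm : ∀ i < m, p ^ 2 * w < branch p w i) :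
    w < branch p w m ∧ branch p w m ≤ u := by
  have hp := H.two_le
  induction m with
  | zero => simp [H.branch_zero hsum, H.lt]
  | succ m ih =>
    have h1 := hm m m.lt_succ_self
    have h2 := (ih fun i hi ↦ hm i (hi.trans m.lt_succ_self)).2
    have hp0 : (0 : ℝ) < p := by linarith
    have hw := H.pos_w
    have := H.sq_sub_pos
    rw [H.branch_succ]
    refine ⟨?_, ?_⟩
    · rw [lt_div_iff₀ hp0]
      nlinarith
    · rw [div_le_iff₀ hp0]
      nlinarith [mul_pos this hw]

lemma eq_or_eq_of_lt {P : G} (h0 : p • P ≠ 0) (h : p ^ 2 * w < ν (p • P)) (h' : ν (p • P) ≤ u) :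
    ν P = (ν (p • P) - (p ^ 2 - p) * w) / p ∨ ν P = w := by
  obtain ⟨P₀, e, h1, h2⟩ := H.exists_fiber_of_lt hsum h0 h h'
  have hT : p • (P - P₀) = 0 := by rw [smul_sub, e, sub_self]
  by_cases hC : P - P₀ ∈ C
  · left
    rw [← h1 _ hC, add_sub_cancel]
  · right
    rw [← h2 _ hT hC, add_sub_cancel]

/-- A preimage of a main-branch element either stays on the branch or drops to `w`; an element at or
below `w` has only preimages below `w`. -/
lemma eq_branch_or_le {m : ℕ} (hm : ∀ i < m, p ^ 2 * w < branch p w i) {P : G}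
    (hP : P ∈ above p C m) : ν P = branch p w m ∨ ν P ≤ w := by
  induction m generalizing P with
  | zero =>
    rw [H.branch_zero hsum]
    simp only [above, pow_zero, one_smul, Set.mem_ofPred_eq] at hP
    exact Or.inl (H.eq_of_mem P hP.1 hP.2)
  | succ m ih =>
    have hm' (i : ℕ) (hi : i < m) := hm i (hi.trans m.lt_succ_self)
    rw [mem_above_succ] at hP
    have h0 := ne_zero_of_mem_above hP
    rcases ih hm' hP with h | h
    · rcases H.eq_or_eq_of_lt hsum h0 (h ▸ hm m m.lt_succ_self)
        (h ▸ (H.branch_bounds hsum hm').2) with h' | h'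
      · exact Or.inl (by rw [h', h, H.branch_succ])
      · exact Or.inr h'.le
    · right
      rw [H.eq_of_le h0 (h.trans H.w_le), div_le_iff₀ (by have := H.two_le; positivity), mul_comm]
      exact h.trans H.w_le

end

/-- The two conditions put every fibre involved in the range of `eq_of_le`, where one level
multiplies counts by `p ^ 2` and divides valuations by `p ^ 2`. -/
lemma ncard_above_succ {m : ℕ} {r : ℝ}
    (h1 : ∀ P ∈ above p C (m + 1), ν P = r → ν (p • P) ≤ p ^ 2 * w)
    (h2 : ∀ P ∈ above p C m, ν P = p ^ 2 * r → ν P ≤ p ^ 2 * w) :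
    {P | P ∈ above p C (m + 1) ∧ ν P = r}.ncard =
      {P | P ∈ above p C m ∧ ν P = p ^ 2 * r}.ncard * p ^ 2 := by
  have hp0 : (p : ℝ) ≠ 0 := by have := H.two_le; positivity
  rw [← H.ncard_kernel]
  refine DivisibleValuation.ncard_of_fibers (p := p) (fun T hT ↦ hT) ?_ ?_
  · rintro P ⟨hP, rfl⟩
    have h := mem_above_succ.mp hP
    refine ⟨h, ?_⟩
    rw [H.eq_of_le (ne_zero_of_mem_above h) (h1 P hP rfl)]
    field_simp
  · rintro S ⟨hS, hr⟩
    obtain ⟨P, rfl⟩ := H.exists_nsmul_eq S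
    refine ⟨P, rfl, fun T hT ↦ ⟨fun _ ↦ hT, fun _ ↦ ?_⟩⟩
    have e : p • (P + T) = p • P := by rw [smul_add, hT, add_zero]
    refine ⟨by rwa [mem_above_succ, e], ?_⟩
    rw [H.eq_of_le (e ▸ ne_zero_of_mem_above hS) (e ▸ h2 _ hS hr), e, hr]
    field_simp

/-- The elements not above `C` all have the same valuation. -/
lemma eq_of_mem_notAbove {m : ℕ} {P : G} (hP : P ∈ notAbove p C m) :
    ν P = w / p ^ (2 * m) := by
  have hp := H.two_le
  induction m generalizing P with
  | zero =>
    simp only [notAbove, pow_zero, one_smul, Set.mem_ofPred_eq] at hP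
    simp [H.eq_of_notMem P hP.1 hP.2]
  | succ m ih =>
    rw [mem_notAbove_succ] at hP
    rw [H.eq_of_le (ne_zero_of_mem_notAbove hP), ih hP, div_div, ← pow_add, mul_add, mul_one]
    rw [ih hP, div_le_iff₀ (by positivity)]
    refine H.w_le.trans (le_mul_of_one_le_right ?_ (one_le_pow₀ (by linarith)))
    have := H.pos_w
    positivity

lemma ncard_notAbove (m : ℕ) : (notAbove p C m).ncard = p ^ (2 * m) * (p ^ 2 - p) := by
  induction m with
  | zero => simpa [notAbove] using H.ncard_kernel_diff
  | succ m ih =>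
    have : (notAbove p C (m + 1)).ncard = (notAbove p C m).ncard * {T : G | p • T = 0}.ncard := by
      refine DivisibleValuation.ncard_of_fibers (p := p) (fun T hT ↦ hT)
        (fun P hP ↦ mem_notAbove_succ.mp hP) fun S hS ↦ ?_
      obtain ⟨P, rfl⟩ := H.exists_nsmul_eq S
      refine ⟨P, rfl, fun T hT ↦ ⟨fun _ ↦ hT, fun _ ↦ ?_⟩⟩
      rwa [mem_notAbove_succ, smul_add, hT, add_zero]
    rw [this, ih, H.ncard_kernel]
    ring

variable (hsum : (p - 1) * u + (p ^ 2 - p) * w = 1)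

include hsum

lemma ncard_above_branch {m : ℕ} (hm : ∀ i < m, p ^ 2 * w < branch p w i) :
    {P | P ∈ above p C m ∧ ν P = branch p w m}.ncard = p ^ m * (p - 1) := by
  induction m with
  | zero =>
    have h1 : {P | P ∈ above p C 0 ∧ ν P = branch p w 0} = (C : Set G) \ {0} := by
      ext P
      simp only [above, pow_zero, one_smul, Set.mem_ofPred_eq, H.branch_zero hsum, Set.mem_sdiff,
        SetLike.mem_coe, Set.mem_singleton_iff, and_iff_left_iff_imp]
      exact fun h ↦ H.eq_of_mem P h.1 h.2
    have h2 : (C : Set G).ncard = p := H.card_subgroup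
    rw [h1, Set.ncard_sdiff_singleton_of_mem C.zero_mem, h2, pow_zero, one_mul]
  | succ m ih =>
    have hm' (i : ℕ) (hi : i < m) := hm i (hi.trans m.lt_succ_self)
    have h2 : (C : Set G).ncard = p := H.card_subgroup
    have hb := (H.branch_bounds hsum hm).1
    have : {P | P ∈ above p C (m + 1) ∧ ν P = branch p w (m + 1)}.ncard =
        {P | P ∈ above p C m ∧ ν P = branch p w m}.ncard * (C : Set G).ncard := by
      refine DivisibleValuation.ncard_of_fibers (p := p) H.nsmul_eq_zero ?_ ?_
      · rintro P ⟨hP, hr⟩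
        rw [mem_above_succ] at hP
        -- An image off the branch has valuation at most `w`, which leaves at most `w / p ^ 2` for
        -- its preimages, less than the next branch value.
        refine ⟨hP, (H.eq_branch_or_le hsum hm' hP).resolve_right fun h ↦ ?_⟩
        have := H.eq_of_le (ne_zero_of_mem_above hP) (h.trans H.w_le)
        rw [eq_div_iff (by have := H.two_le; positivity)] at this
        nlinarith [H.two_le, H.pos_w, H.w_le]
      · rintro S ⟨hS, hr⟩
        obtain ⟨P, e, f1, f2⟩ := H.exists_fiber_of_lt hsum (ne_zero_of_mem_above hS)
          (hr ▸ hm m m.lt_succ_self) (hr ▸ (H.branch_bounds hsum hm').2)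
        refine ⟨P, e, fun T hT ↦ ⟨fun h ↦ ?_, fun h ↦ ⟨?_, ?_⟩⟩⟩
        · by_contra hC
          exact hb.ne (by rw [← h.2, f2 T hT hC])
        · rwa [mem_above_succ, smul_add, hT, add_zero, e]
        · rw [f1 T h, H.branch_succ, hr]
    rw [this, ih hm', h2]
    ring

/-- These are exactly the preimages of main-branch elements lying outside the coset of `C` that
continues the branch. -/
lemma ncard_above_w {m : ℕ} (hm : ∀ i < m + 1, p ^ 2 * w < branch p w i) :
    {P | P ∈ above p C (m + 1) ∧ ν P = w}.ncard = (p ^ 2 - p) * (p ^ m * (p - 1)) := by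
  have hm' (i : ℕ) (hi : i < m) := hm i (hi.trans m.lt_succ_self)
  have hb := (H.branch_bounds hsum hm).1
  rw [mul_comm, ← H.ncard_above_branch hsum hm', ← H.ncard_kernel_diff]
  refine DivisibleValuation.ncard_of_fibers (p := p) (fun T hT ↦ hT.1) ?_ ?_
  · rintro P ⟨hP, hr⟩
    rw [mem_above_succ] at hP
    refine ⟨hP, (H.eq_branch_or_le hsum hm' hP).resolve_right fun h ↦ ?_⟩
    have := H.eq_of_le (ne_zero_of_mem_above hP) (h.trans H.w_le)
    rw [eq_div_iff (by have := H.two_le; positivity)] at this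
    linarith [H.w_lt, hr ▸ this]
  · rintro S ⟨hS, hr⟩
    obtain ⟨P, e, f1, f2⟩ := H.exists_fiber_of_lt hsum (ne_zero_of_mem_above hS)
      (hr ▸ hm m m.lt_succ_self) (hr ▸ (H.branch_bounds hsum hm').2)
    refine ⟨P, e, fun T hT ↦ ⟨fun h ↦ ⟨hT, fun hC ↦ ?_⟩, fun h ↦ ⟨?_, f2 T hT h.2⟩⟩⟩
    · exact hb.ne (h.2.symm.trans ((f1 T hC).trans (by rw [H.branch_succ, hr])))
    · rwa [mem_above_succ, smul_add, hT, add_zero, e]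

/-- The index `j` records where the side branch leaves the main one: at order `p ^ j`, with
valuation `w`. Each of the `m + 1 - j` further levels is an instance of `ncard_above_succ`. -/
lemma ncard_above_side {m j : ℕ} (hm : ∀ i < m, p ^ 2 * w < branch p w i) (hj : 2 ≤ j)
    (hjm : j ≤ m + 1) : {P | P ∈ above p C m ∧ ν P = w / p ^ (2 * (m + 1 - j))}.ncard =
      p ^ (2 * (m + 1 - j)) * (p ^ 2 - p) * p ^ (j - 2) * (p - 1) := by
  have hp := H.two_le
  induction m with
  | zero => omega
  | succ m ih =>
    have hm' (i : ℕ) (hi : i < m) := hm i (hi.trans m.lt_succ_self)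
    obtain rfl | hlt := hjm.eq_or_lt
    · rw [Nat.sub_self, mul_zero, pow_zero, pow_zero, div_one, H.ncard_above_w hsum hm,
        show m + 1 + 1 - 2 = m from rfl]
      ring
    · have e : m + 1 + 1 - j = m + 1 - j + 1 := by omega
      have hr : w / (p : ℝ) ^ (2 * (m + 1 + 1 - j)) < w := by
        refine div_lt_self H.pos_w (one_lt_pow₀ (by linarith) (by omega))
      have hr' : p ^ 2 * (w / (p : ℝ) ^ (2 * (m + 1 + 1 - j))) = w / p ^ (2 * (m + 1 - j)) := by
        rw [e, mul_add, pow_add]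
        field_simp
        ring
      rw [H.ncard_above_succ, hr', ih hm' (by omega), e]
      · ring
      · intro P hP hPr
        rw [mem_above_succ] at hP
        by_contra! h
        rcases H.eq_branch_or_le hsum hm' hP with h' | h'
        · rcases H.eq_or_eq_of_lt hsum (ne_zero_of_mem_above hP) h
            (h' ▸ (H.branch_bounds hsum hm').2) with h3 | h3
          · rw [h', ← H.branch_succ, hPr] at h3
            exact (hr.trans (H.branch_bounds hsum hm).1).ne h3
          · exact hr.ne (hPr ▸ h3)
        · exact (h'.trans H.w_le).not_gt h
      · intro P hP hPr
        rw [hPr]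
        have : 0 < (p : ℝ) ^ 2 := by positivity
        nlinarith

lemma le_of_mem_above_add {s : ℕ} (hs : ∀ i < s, p ^ 2 * w < branch p w i)
    (hs' : branch p w s ≤ p ^ 2 * w) (j : ℕ) {P : G} (hP : P ∈ above p C (s + j)) :
    ν P ≤ p ^ 2 * w := by
  induction j generalizing P with
  | zero =>
    rcases H.eq_branch_or_le hsum hs hP with h | h
    · rwa [h]
    · exact h.trans H.w_le
  | succ j ih =>
    rw [← add_assoc, mem_above_succ] at hP
    have h := ih hP
    rw [H.eq_of_le (ne_zero_of_mem_above hP) h]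
    refine (div_le_iff₀ (by have := H.two_le; positivity)).mpr (h.trans ?_)
    refine le_mul_of_one_le_right ?_ (one_le_pow₀ (by linarith [H.two_le]))
    exact H.pos_w.le.trans H.w_le

/-- Beyond level `s` no fibre splits any more, so the whole distribution at `s` is only rescaled. -/
lemma ncard_above_add {s : ℕ} (hs : ∀ i < s, p ^ 2 * w < branch p w i)
    (hs' : branch p w s ≤ p ^ 2 * w) (j : ℕ) (r : ℝ) :
    {P | P ∈ above p C (s + j) ∧ ν P = r / p ^ (2 * j)}.ncard =
      p ^ (2 * j) * {P | P ∈ above p C s ∧ ν P = r}.ncard := by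
  have hp := H.two_le
  induction j with
  | zero => simp
  | succ j ih =>
    have hr' : p ^ 2 * (r / (p : ℝ) ^ (2 * (j + 1))) = r / p ^ (2 * j) := by
      rw [mul_add, pow_add]
      field_simp
      ring
    rw [← add_assoc, H.ncard_above_succ, hr', ih]
    · ring
    · exact fun P hP _ ↦ H.le_of_mem_above_add hsum hs hs' j (mem_above_succ.mp hP)
    · exact fun P hP _ ↦ H.le_of_mem_above_add hsum hs hs' j hP

omit hsum in
lemma addOrderOf_eq_iff {P : G} {m : ℕ} :
    addOrderOf P = p ^ (m + 1) ↔ p • p ^ m • P = 0 ∧ p ^ m • P ≠ 0 := by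
  have := Fact.mk H.prime
  constructor
  · intro h
    rw [smul_smul, ← pow_succ', ← h]
    refine ⟨addOrderOf_nsmul_eq_zero P, fun h0 ↦ ?_⟩
    have := addOrderOf_dvd_of_nsmul_eq_zero h0
    rw [h] at this
    exact absurd (Nat.pow_dvd_pow_iff_le_right H.prime.one_lt |>.mp this) (by omega)
  · rintro ⟨h1, h2⟩
    exact addOrderOf_eq_prime_pow h2 (by rwa [pow_succ', mul_smul])

omit hsum in
lemma addOrderOf_eq_and_iff {P : G} {m : ℕ} :
    addOrderOf P = p ^ (m + 1) ∧ p ^ m • P ∈ C ↔ P ∈ above p C m := by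
  rw [H.addOrderOf_eq_iff, above]
  exact ⟨fun h ↦ ⟨h.2, h.1.2⟩, fun h ↦ ⟨⟨H.nsmul_eq_zero _ h.1, h.2⟩, h.1⟩⟩

omit hsum in
lemma addOrderOf_eq_and_notMem_iff {P : G} {m : ℕ} :
    addOrderOf P = p ^ (m + 1) ∧ p ^ m • P ∉ C ↔ P ∈ notAbove p C m := by
  rw [H.addOrderOf_eq_iff, notAbove]
  exact ⟨fun h ↦ ⟨h.1.1, h.2⟩, fun h ↦ ⟨⟨h.1, fun e ↦ h.2 (e ▸ C.zero_mem)⟩, h.2⟩⟩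

omit hsum in
-- Elements not above `C` have valuation `w / p ^ (2 * m)`, which is excluded by `i < m`.
lemma setOf_addOrderOf_eq {m i : ℕ} (hi : i < m) :
    {P | addOrderOf P = p ^ (m + 1) ∧ ν P = w / p ^ (2 * i)} =
      {P | P ∈ above p C m ∧ ν P = w / p ^ (2 * i)} := by
  ext P
  refine and_congr_left fun h ↦ ⟨fun h1 ↦ H.addOrderOf_eq_and_iff.mp ⟨h1, ?_⟩,
    fun h1 ↦ (H.addOrderOf_eq_and_iff.mpr h1).1⟩
  by_contra hC
  have h2 := H.eq_of_mem_notAbove (H.addOrderOf_eq_and_notMem_iff.mp ⟨h1, hC⟩)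
  have hp := H.two_le
  rw [h, div_eq_div_iff (by positivity) (by positivity)] at h2
  have := pow_right_injective₀ (by linarith) (by linarith) (mul_left_cancel₀ H.pos_w.ne' h2)
  omega

end CanonicalValuation

/-! ### Coefficients of division polynomials and the valuations of the `p`-torsion. -/

/-- This coefficient is an elementary symmetric function of degree `A.card`; the product over `A`
strictly dominates every other monomial, as each of those uses a root from `B`. -/
lemma Valuation.coeff_prod_X_sub_C {L : Type*} [Field L] [DecidableEq L] {v : Valuation L ℝ≥0}
    {A B : Finset L} (hAB : Disjoint A B) {α β : ℝ≥0} (hA : ∀ x ∈ A, v x = α)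
    (hB : ∀ x ∈ B, v x = β) (hβ : 0 < β) (h : β < α) :
    v ((∏ x ∈ A ∪ B, (X - C x)).coeff B.card) = α ^ A.card := by
  have hc := Finset.card_union_of_disjoint hAB
  have hA' : A ∈ Finset.powersetCard A.card (A ∪ B) :=
    Finset.mem_powersetCard.mpr ⟨Finset.subset_union_left, rfl⟩
  have e : ∏ x ∈ A ∪ B, (X - C x) = ∏ x ∈ A ∪ B, (X + C (-x)) := by
    simp [sub_eq_add_neg]
  have hA1 : v (∏ x ∈ A, -x) = α ^ A.card := by
    rw [map_prod, Finset.prod_congr rfl fun x hx ↦ by rw [v.map_neg, hA x hx], Finset.prod_const]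
  rw [e, Finset.prod_X_add_C_coeff _ _ (by omega), hc, Nat.add_sub_cancel,
    ← Finset.add_sum_erase _ _ hA', v.map_add_eq_of_lt_left, hA1]
  rw [hA1]
  refine v.map_sum_lt (pow_ne_zero _ (hβ.trans h).ne') fun t ht ↦ ?_
  rw [Finset.mem_erase, Finset.mem_powersetCard] at ht
  obtain ⟨h1, h2, h3⟩ := ht
  have hv (x : L) (hx : x ∈ t) : v x = α ∨ v x = β := by
    rcases Finset.mem_union.mp (h2 hx) with h | h
    · exact Or.inl (hA x h)
    · exact Or.inr (hB x h)
  have hnot : ¬ t ⊆ A := fun hs ↦ h1 (Finset.eq_of_subset_of_card_le hs h3.ge)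
  obtain ⟨x, hx, hxA⟩ := Finset.not_subset.mp hnot
  rw [map_prod, ← h3, ← Finset.prod_const]
  refine Finset.prod_lt_prod (fun y hy ↦ ?_) (fun y hy ↦ ?_) ⟨x, hx, ?_⟩
  · rw [v.map_neg]
    rcases hv y hy with e | e <;> rw [e]
    exacts [hβ.trans h, hβ]
  · rw [v.map_neg]
    rcases hv y hy with e | e <;> rw [e]
    exact h.le
  · rw [v.map_neg, hB x ((Finset.mem_union.mp (h2 hx)).resolve_left hxA)]
    exact h

namespace WeierstrassCurve.Affine.Point

variable {L : Type*} [Field L] [DecidableEq L] {W : Affine L} {v : Valuation L ℝ≥0} {p : ℕ}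

/-- Coefficients of a polynomial whose roots are the `x`-coordinates of two sets of points, each
with points of constant size, where `e` points have the same `x`-coordinate. -/
lemma exists_coeff_eq [IsAlgClosed L] {f : L[X]} (hf : f ≠ 0) {c d : Finset W.Point} {e : ℕ}
    (he : 0 < e) (hdeg : e * f.natDegree = c.card + d.card)
    (hc : ∀ T ∈ c, f.IsRoot (xCoord T)) (hd : ∀ T ∈ d, f.IsRoot (xCoord T)) {ρ σ : ℝ≥0}
    (hc' : ∀ T ∈ c, size v T = ρ) (hd' : ∀ T ∈ d, size v T = σ) (hρ : 0 < ρ) (h : ρ < σ)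
    (hce : ∀ T ∈ c, (c.filter (xCoord · = xCoord T)).card = e)
    (hde : ∀ T ∈ d, (d.filter (xCoord · = xCoord T)).card = e) :
    ∃ a b, e * a = c.card ∧ e * b = d.card ∧ v (f.coeff b) * ρ ^ a = v f.leadingCoeff ∧
      v (f.coeff 0) * ρ ^ a * σ ^ b = v f.leadingCoeff := by
  have card_eq (s : Finset W.Point) (hs : ∀ T ∈ s, (s.filter (xCoord · = xCoord T)).card = e) :
      e * (s.image xCoord).card = s.card := by
    rw [Finset.card_eq_sum_card_image xCoord s, Finset.sum_congr rfl (g := fun _ ↦ e),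
      Finset.sum_const, smul_eq_mul, mul_comm]
    intro x hx
    obtain ⟨T, hT, rfl⟩ := Finset.mem_image.mp hx
    exact hs T hT
  set A := c.image xCoord with hA
  set B := d.image xCoord with hB
  have hA1 : ∀ x ∈ A, v x = ρ⁻¹ := by
    intro x hx
    obtain ⟨T, hT, rfl⟩ := Finset.mem_image.mp hx
    rw [IsFormal.valuation_xCoord, hc' T hT]
  have hB1 : ∀ x ∈ B, v x = σ⁻¹ := by
    intro x hx
    obtain ⟨T, hT, rfl⟩ := Finset.mem_image.mp hx
    rw [IsFormal.valuation_xCoord, hd' T hT]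
  have hσ := hρ.trans h
  have hlt : σ⁻¹ < ρ⁻¹ := inv_strictAnti₀ hρ h
  have hAB : Disjoint A B := Finset.disjoint_left.mpr fun x h1 h2 ↦
    hlt.ne ((hB1 x h2).symm.trans (hA1 x h1))
  have hs := IsAlgClosed.splits f
  have hcard : (A ∪ B).card = f.natDegree := by
    refine Nat.eq_of_mul_eq_mul_left he ?_
    rw [Finset.card_union_of_disjoint hAB, mul_add, card_eq c hce, card_eq d hde, hdeg]
  have hroots : f.roots = (A ∪ B).val := by
    refine (Multiset.eq_of_le_of_card_le ((Multiset.le_iff_subset (A ∪ B).nodup).mpr ?_) ?_).symm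
    · intro x hx
      rw [mem_roots hf]
      rcases Finset.mem_union.mp (Finset.mem_def.mpr hx) with hx | hx <;>
      obtain ⟨T, hT, rfl⟩ := Finset.mem_image.mp hx
      exacts [hc T hT, hd T hT]
    · rw [← hs.natDegree_eq_card_roots, ← hcard]
      rfl
  have hprod : f = C f.leadingCoeff * ∏ x ∈ A ∪ B, (X - C x) := by
    conv_lhs => rw [hs.eq_prod_roots, hroots]
    rfl
  have h0 : v (f.coeff 0) = v f.leadingCoeff * (ρ⁻¹ ^ A.card * σ⁻¹ ^ B.card) := by
    conv_lhs => rw [hprod]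
    rw [coeff_C_mul, map_mul, coeff_zero_eq_eval_zero, eval_prod, map_prod,
      Finset.prod_union hAB]
    congr 2
    · rw [← Finset.prod_const]
      exact Finset.prod_congr rfl fun x hx ↦ by simp [hA1 x hx]
    · rw [← Finset.prod_const]
      exact Finset.prod_congr rfl fun x hx ↦ by simp [hB1 x hx]
  have h1 : v (f.coeff B.card) = v f.leadingCoeff * ρ⁻¹ ^ A.card := by
    conv_lhs => rw [hprod]
    rw [coeff_C_mul, map_mul,
      Valuation.coeff_prod_X_sub_C hAB hA1 hB1 (inv_pos.mpr hσ) hlt]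
  refine ⟨A.card, B.card, card_eq c hce, card_eq d hde, ?_, ?_⟩
  · rw [h1, mul_assoc, ← mul_pow, inv_mul_cancel₀ hρ.ne', one_pow, mul_one]
  · calc _ = v f.leadingCoeff * (ρ⁻¹ * ρ) ^ A.card * (σ⁻¹ * σ) ^ B.card := by
          rw [h0]
          ring
      _ = _ := by
        rw [inv_mul_cancel₀ hρ.ne', inv_mul_cancel₀ hσ.ne', one_pow, one_pow, mul_one, mul_one]

end WeierstrassCurve.Affine.Point

namespace WeierstrassCurve.Affine.Point

/-- The valuation of the parameter of a formal point, normalized to be `1` at `p`. -/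
noncomputable def paramValuation {L : Type*} [Field L] {W : Affine L} (v : Valuation L ℝ≥0)
    (p : ℕ) (P : W.Point) : ℝ :=
  Real.log (size v P) / (2 * Real.log (v (p : L)))

variable {L : Type*} [Field L] {W : Affine L} {v : Valuation L ℝ≥0} {p : ℕ}

lemma IsFormal.size_pos {P : W.Point} (hP : IsFormal v P) (h0 : P ≠ 0) : (0 : ℝ) < size v P := by
  exact_mod_cast pos_iff_ne_zero.mpr (hP.size_eq_zero_iff.not.mpr h0)

section

variable (S : SupersingularAt W v p)

include S

lemma log_valuation_neg [CharZero L] : Real.log (v (p : L)) < 0 := by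
  have h0 : v (p : L) ≠ 0 := by simpa using S.prime.ne_zero
  exact Real.log_neg (by positivity) (by exact_mod_cast S.natCast_lt_one)

variable [CharZero L]

lemma paramValuation_le_iff {P Q : W.Point} (hP : IsFormal v P) (hP0 : P ≠ 0) (hQ : IsFormal v Q)
    (hQ0 : Q ≠ 0) : paramValuation v p P ≤ paramValuation v p Q ↔ size v Q ≤ size v P := by
  have h := log_valuation_neg S
  rw [paramValuation, paramValuation, div_le_div_right_of_neg (by linarith),
    Real.log_le_log_iff (hQ.size_pos hQ0) (hP.size_pos hP0), NNReal.coe_le_coe]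

variable [DecidableEq L] [IsAlgClosed L] [WeierstrassCurve.IsElliptic W]
  {k : Finset W.Point} (hk : ∀ T, T ∈ k ↔ IsFormal v T ∧ p • T = 0) (hkc : k.card = p ^ 2)

include hk hkc

open Classical in
lemma divisibleValuation : DivisibleValuation p
    (fun P : formalSubgroup S.integralAt ↦ paramValuation v p (P : W.Point))
    (k.subtype (· ∈ formalSubgroup S.integralAt)) where
  prime := S.prime
  pos P hP := by
    have h0 : (P : W.Point) ≠ 0 := by simpa using hP
    refine div_pos_of_neg_of_neg (Real.log_neg (IsFormal.size_pos P.2 h0) ?_)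
      (by linarith [log_valuation_neg S])
    exact_mod_cast IsFormal.size_lt_one P.2
  min_le P Q hP hQ hPQ := by
    have hP' : (P : W.Point) ≠ 0 := by simpa using hP
    have hQ' : (Q : W.Point) ≠ 0 := by simpa using hQ
    have hPQ' : (P + Q : W.Point) ≠ 0 := fun h ↦ hPQ (Subtype.ext h)
    have hF := IsFormal.add S.integralAt P.2 Q.2
    rw [min_le_iff, AddSubgroup.coe_add, paramValuation_le_iff S P.2 hP' hF hPQ',
      paramValuation_le_iff S Q.2 hQ' hF hPQ', ← le_max_iff]
    exact (isFormal_add_size_add S.integralAt P.2 Q.2).2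
  neg P := by simp [paramValuation]
  mem_iff T := by
    rw [Finset.mem_subtype, hk, ← Subtype.coe_inj]
    exact and_iff_right T.2
  card_eq := by
    rw [Finset.card_subtype, Finset.filter_true_of_mem (p := (· ∈ formalSubgroup S.integralAt))
      fun T hT ↦ ((hk T).mp hT).1, hkc]
  exists_nsmul_eq Q := by
    obtain ⟨P, hP, e⟩ := exists_prime_nsmul_eq S Q.2
    exact ⟨⟨P, hP⟩, Subtype.ext e⟩
  sum_add P hP := by
    have hP' : p • (P : W.Point) ≠ 0 := fun h ↦ hP (Subtype.ext h)
    have key := prod_size_add S hk hkc P.2 hP'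
    have hmem : ∀ T ∈ k, T ∈ formalSubgroup S.integralAt := fun T hT ↦ ((hk T).mp hT).1
    have := Finset.sum_subtype_of_mem (fun T ↦ paramValuation v p ((P : W.Point) + T)) hmem
    refine this.trans ?_
    simp only [paramValuation, AddSubgroup.coe_nsmul]
    rw [← Finset.sum_div, ← key, NNReal.coe_prod, Real.log_prod fun T hT ↦ ?_]
    refine ((IsFormal.add S.integralAt P.2 (hmem T hT)).size_pos fun h ↦ hP' ?_).ne'
    have := congrArg (p • ·) h
    simpa [smul_add, ((hk T).mp hT).2] using this

variable {R Q : W.Point} (hR : IsFormal v R) (hQ : IsFormal v Q) (hR0 : R ≠ 0) (hQ0 : Q ≠ 0)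
  (hpR : p • R = 0) (hpQ : p • Q = 0) (hlt : size v R < size v Q)

include hR hQ hR0 hQ0 hpR hpQ hlt

open Classical in
lemma canonicalValuation : CanonicalValuation p
    (fun P : formalSubgroup S.integralAt ↦ paramValuation v p (P : W.Point))
    (k.subtype (· ∈ formalSubgroup S.integralAt))
    (AddSubgroup.zmultiples (⟨R, hR⟩ : formalSubgroup S.integralAt))
    (paramValuation v p R) (paramValuation v p Q) := by
  refine (divisibleValuation S hk hkc).canonicalValuation (R := ⟨R, hR⟩) (Q := ⟨Q, hQ⟩)
    (Subtype.ext hpR) (Subtype.ext hpQ) (fun h ↦ hR0 (congrArg Subtype.val h))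
    (fun h ↦ hQ0 (congrArg Subtype.val h)) ?_
  rw [← not_le, paramValuation_le_iff S hR hR0 hQ hQ0, not_le]
  exact hlt

/-- Both counts come from `sum_kernel` applied to an indicator function. -/
lemma card_filter_size : (k.filter fun T ↦ T ≠ 0 ∧ size v T = size v R).card = p - 1 ∧
    (k.filter fun T ↦ T ≠ 0 ∧ size v T = size v Q).card = p ^ 2 - p := by
  classical
  have H := canonicalValuation S hk hkc hR hQ hR0 hQ0 hpR hpQ hlt
  have hmem : ∀ T ∈ k, T ∈ formalSubgroup S.integralAt := fun T hT ↦ ((hk T).mp hT).1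
  have size_iff {T P : W.Point} (hT : IsFormal v T) (hT0 : T ≠ 0) (hP : IsFormal v P)
      (hP0 : P ≠ 0) : size v T = size v P ↔ paramValuation v p T = paramValuation v p P := by
    rw [le_antisymm_iff, le_antisymm_iff, paramValuation_le_iff S hT hT0 hP hP0,
      paramValuation_le_iff S hP hP0 hT hT0, and_comm]
  have key (P : W.Point) (hP : IsFormal v P) (hP0 : P ≠ 0) :
      ((k.filter fun T ↦ T ≠ 0 ∧ size v T = size v P).card : ℝ) =
      (p - 1) * (if paramValuation v p R = paramValuation v p P then 1 else 0) +
      (p ^ 2 - p) * (if paramValuation v p Q = paramValuation v p P then 1 else 0) := by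
    have := H.sum_kernel (fun t ↦ if t = paramValuation v p P then 1 else 0) 0
      (fun T ↦ if (T : W.Point) ≠ 0 ∧ size v (T : W.Point) = size v P then 1 else 0) (by simp)
      fun T hT hT0 ↦ by
        have hT0' : (T : W.Point) ≠ 0 := by simpa using hT0
        simp only [ne_eq, hT0', not_false_eq_true, true_and, size_iff T.2 hT0' hP hP0]
    rw [Finset.card_filter, Nat.cast_sum]
    push_cast
    rw [← zero_add ((_ : ℝ) * _), ← this]
    exact (Finset.sum_subtype_of_mem (fun T : W.Point ↦
      if T ≠ 0 ∧ size v T = size v P then (1 : ℝ) else 0) hmem).symm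
  have h1 := key R hR hR0
  have h2 := key Q hQ hQ0
  rw [if_pos rfl, if_neg H.lt.ne, mul_one, mul_zero, add_zero] at h1
  rw [if_pos rfl, if_neg H.lt.ne', mul_one, mul_zero, zero_add] at h2
  have hp1 := S.prime.one_lt.le
  constructor
  · rw [← Nat.cast_inj (R := ℝ), h1, Nat.cast_sub hp1, Nat.cast_one]
  · rw [← Nat.cast_inj (R := ℝ), h2, Nat.cast_sub (Nat.le_self_pow two_ne_zero p), Nat.cast_pow]

/-- Used with `e = 2` for odd `p`, where `T` and `-T` share a root of `preΨ`, and with `e = 1` where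
they coincide. Vieta, with leading coefficient `p ^ 2` and unit constant term of `f ^ e`, gives both
identities. -/
lemma exists_coeff_pow_eq {f : L[X]} {e : ℕ} (he : 0 < e) (hf : f ^ e = WeierstrassCurve.ΨSq W p)
    (hfib : ∀ s : Finset W.Point, (∀ T ∈ s, T ≠ 0 ∧ p • T = 0 ∧ -T ∈ s) →
      ∀ T ∈ s, (s.filter (xCoord · = xCoord T)).card = e) :
    ∃ b, e * b = p ^ 2 - p ∧ v (f.coeff b) ^ e = size v Q ^ (p ^ 2 - p) ∧
      size v R ^ (p - 1) * size v Q ^ (p ^ 2 - p) = v (p : L) ^ 2 := by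
  obtain ⟨h1, h2⟩ := card_filter_size S hk hkc hR hQ hR0 hQ0 hpR hpQ hlt
  have hp0 : ((p : ℤ) : L) ≠ 0 := by simpa using S.prime.ne_zero
  have hp2 : p ≤ p ^ 2 := Nat.le_self_pow two_ne_zero p
  have hp1 := S.prime.one_lt.le
  have hf0 : f ≠ 0 := by
    rintro rfl
    rw [zero_pow he.ne'] at hf
    exact ΨSq_ne_zero W hp0 hf.symm
  have hdeg : e * f.natDegree = p ^ 2 - 1 := by
    rw [← natDegree_pow, hf, natDegree_ΨSq _ hp0, Int.natAbs_natCast]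
  have hroot (T : W.Point) (hT : T ∈ k) (hT0 : T ≠ 0) : f.IsRoot (xCoord T) := by
    have hT' := (hk T).mp hT
    have := (hT'.1.prime_nsmul_eq_zero_iff S.integralAt S.prime S.natCast_lt_one hT0).mp hT'.2
    rw [← hf, eval_pow] at this
    exact eq_zero_of_pow_eq_zero this
  have hclosed (r : ℝ≥0) : ∀ T ∈ k.filter (fun T ↦ T ≠ 0 ∧ size v T = r),
      T ≠ 0 ∧ p • T = 0 ∧ -T ∈ k.filter (fun T ↦ T ≠ 0 ∧ size v T = r) := by
    intro T hT
    simp only [Finset.mem_filter, hk] at hT ⊢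
    simp [hT, -ne_eq, ne_eq]
  obtain ⟨a, b, ha, hb, e1, e2⟩ := exists_coeff_eq (v := v) hf0 he
    (c := k.filter fun T ↦ T ≠ 0 ∧ size v T = size v R)
    (d := k.filter fun T ↦ T ≠ 0 ∧ size v T = size v Q) (by rw [hdeg, h1, h2]; omega)
    (fun T hT ↦ by
      rw [Finset.mem_filter] at hT
      exact hroot T hT.1 hT.2.1)
    (fun T hT ↦ by
      rw [Finset.mem_filter] at hT
      exact hroot T hT.1 hT.2.1) (fun T hT ↦ (Finset.mem_filter.mp hT).2.2)
    (fun T hT ↦ (Finset.mem_filter.mp hT).2.2)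
    (pos_iff_ne_zero.mpr (hR.size_eq_zero_iff.not.mpr hR0)) hlt
    (hfib _ (hclosed _)) (hfib _ (hclosed _))
  rw [h1] at ha
  rw [h2] at hb
  have hl : v f.leadingCoeff ^ e = v (p : L) ^ 2 := by
    rw [← map_pow, ← leadingCoeff_pow, hf, leadingCoeff_ΨSq _ hp0, map_pow, Int.cast_natCast]
  have h0 : v (f.coeff 0) ^ e = 1 := by
    rw [← map_pow, ← S.coeff_zero, ← hf, coeff_zero_eq_eval_zero, coeff_zero_eq_eval_zero, eval_pow]
  have e1' := congrArg (· ^ e) e1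
  have e2' := congrArg (· ^ e) e2
  simp only [mul_pow, ← pow_mul, hl, h0, one_mul, mul_comm _ e, ha, hb] at e1' e2'
  refine ⟨b, hb, ?_, e2'⟩
  have hne : size v R ^ (p - 1) ≠ 0 := pow_ne_zero _ (hR.size_eq_zero_iff.not.mpr hR0)
  rw [← e2', mul_comm] at e1'
  exact mul_left_cancel₀ hne e1'

end

end WeierstrassCurve.Affine.Point

namespace WeierstrassCurve.Affine.Point

variable {L : Type*} [Field L] {W : Affine L} {v : Valuation L ℝ≥0} {p : ℕ}

/-- Hence `|x / y|² = |x|⁻¹`, the source of the factor `2` in `paramValuation`. -/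
lemma valuation_sq_eq (hW : IntegralAt W v) {x y : L} (h : W.Equation x y) (hx : 1 < v x) :
    v y ^ 2 = v x ^ 3 := by
  obtain ⟨h1, h2, h3, h4, h6⟩ := hW
  have hx0 : 0 < v x := zero_lt_one.trans hx
  have e : y * (y + (W.a₁ * x + W.a₃)) = x ^ 3 + (W.a₂ * x ^ 2 + W.a₄ * x + W.a₆) := by
    linear_combination (equation_iff x y).mp h
  have hr : v (x ^ 3 + (W.a₂ * x ^ 2 + W.a₄ * x + W.a₆)) = v x ^ 3 := by
    rw [v.map_add_eq_of_lt_left, map_pow]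
    rw [map_pow]
    have hlt2 : v x ^ 2 < v x ^ 3 := pow_lt_pow_right₀ hx (by norm_num)
    have hlt1 : v x ^ 1 < v x ^ 3 := pow_lt_pow_right₀ hx (by norm_num)
    have hlt0 : v x ^ 0 < v x ^ 3 := pow_lt_pow_right₀ hx (by norm_num)
    refine v.map_add_lt (v.map_add_lt ?_ ?_) ?_
    · rw [map_mul, map_pow]
      exact (mul_le_of_le_one_left' h2).trans_lt hlt2
    · rw [map_mul]
      exact (mul_le_of_le_one_left' h4).trans_lt (by simpa using hlt1)
    · exact h6.trans_lt (by simpa using hlt0)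
  have hl : v (W.a₁ * x + W.a₃) ≤ v x := by
    refine v.map_add_le ?_ (h3.trans hx.le)
    rw [map_mul]
    exact mul_le_of_le_one_left' h1
  rw [← e, map_mul] at hr
  rcases le_or_gt (v y) (v x) with hy | hy
  · have := mul_le_mul' hy (v.map_add_le hy hl)
    rw [hr, ← sq] at this
    exact absurd this (pow_lt_pow_right₀ hx (by norm_num)).not_ge
  · rw [v.map_add_eq_of_lt_left (hl.trans_lt hy)] at hr
    rw [sq, hr]

section

variable [DecidableEq L]

lemma card_filter_xCoord_two {s : Finset W.Point}
    (hs : ∀ T ∈ s, T ≠ 0 ∧ 2 • T = 0 ∧ -T ∈ s) :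
    ∀ T ∈ s, (s.filter (xCoord · = xCoord T)).card = 1 := by
  intro T hT
  rw [Finset.card_eq_one]
  refine ⟨T, Finset.ext fun P ↦ ?_⟩
  rw [Finset.mem_filter, Finset.mem_singleton]
  refine ⟨fun ⟨h1, h2⟩ ↦ ?_, fun h ↦ ⟨h ▸ hT, h ▸ rfl⟩⟩
  rcases eq_or_eq_neg_of_xCoord_eq (hs P h1).1 (hs T hT).1 h2 with h | h
  · exact h
  · rw [h, neg_eq_iff_add_eq_zero, ← two_nsmul, (hs T hT).2.1]

lemma card_filter_xCoord_odd (hp : Odd p) {s : Finset W.Point}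
    (hs : ∀ T ∈ s, T ≠ 0 ∧ p • T = 0 ∧ -T ∈ s) :
    ∀ T ∈ s, (s.filter (xCoord · = xCoord T)).card = 2 := by
  intro T hT
  rw [Finset.card_eq_two]
  refine ⟨T, -T, fun h ↦ (hs T hT).1 ?_, Finset.ext fun P ↦ ?_⟩
  · obtain ⟨q, rfl⟩ := hp
    have h2 := (hs T hT).2.1
    rw [eq_neg_iff_add_eq_zero, ← two_nsmul] at h
    rwa [add_smul, one_smul, mul_comm, mul_smul, h, smul_zero, zero_add] at h2
  · rw [Finset.mem_filter, Finset.mem_insert, Finset.mem_singleton]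
    refine ⟨fun ⟨h1, h2⟩ ↦ eq_or_eq_neg_of_xCoord_eq (hs P h1).1 (hs T hT).1 h2, ?_⟩
    rintro (rfl | rfl)
    · exact ⟨hT, rfl⟩
    · exact ⟨(hs T hT).2.2, by simp⟩

variable [CharZero L] [IsAlgClosed L] [WeierstrassCurve.IsElliptic W] (S : SupersingularAt W v p)
  {k : Finset W.Point} (hk : ∀ T, T ∈ k ↔ IsFormal v T ∧ p • T = 0) (hkc : k.card = p ^ 2)
  {R Q : W.Point} (hR : IsFormal v R) (hQ : IsFormal v Q) (hR0 : R ≠ 0) (hQ0 : Q ≠ 0)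
  (hpR : p • R = 0) (hpQ : p • Q = 0) (hlt : size v R < size v Q)

include S hk hkc hR hQ hR0 hQ0 hpR hpQ hlt

/-- The coefficient of the division polynomial defining the Hasse invariant, for odd `p`. -/
lemma coeff_preΨ_odd (hp2 : p ≠ 2) :
    (W.preΨ p).coeff ((p ^ 2 - p) / 2) ≠ 0 ∧
      Real.log (v ((W.preΨ p).coeff ((p ^ 2 - p) / 2))) / Real.log (v (p : L)) =
        (p ^ 2 - p) * paramValuation v p Q := by
  have hodd := S.prime.odd_of_ne_two hp2
  obtain ⟨b, hb, e, -⟩ := exists_coeff_pow_eq S hk hkc hR hQ hR0 hQ0 hpR hpQ hlt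
    (f := WeierstrassCurve.preΨ W p) two_pos
    (by rw [WeierstrassCurve.ΨSq, if_neg (by simpa using hodd), mul_one])
    (fun s hs ↦ card_filter_xCoord_odd hodd hs)
  have hb' : (p ^ 2 - p) / 2 = b := by omega
  rw [hb']
  have hσ := hQ.size_pos hQ0
  refine ⟨fun h ↦ ?_, ?_⟩
  · rw [h, _root_.map_zero, zero_pow two_ne_zero] at e
    exact pow_ne_zero _ (NNReal.coe_ne_zero.mp hσ.ne') e.symm
  · have e' := congrArg (fun t : ℝ≥0 ↦ Real.log t) e
    simp only [NNReal.coe_pow, Real.log_pow] at e'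
    rw [Nat.cast_sub (Nat.le_self_pow two_ne_zero p)] at e'
    have h0 := (log_valuation_neg S).ne
    rw [paramValuation]
    field_simp
    push_cast at e'
    linear_combination e'

/-- The coefficient of the division polynomial defining the Hasse invariant, for `p = 2`. -/
lemma coeff_Ψ₂Sq_two (hp2 : p = 2) : W.a₁ ^ 2 + 4 * W.a₂ ≠ 0 ∧
    Real.log (v (W.a₁ ^ 2 + 4 * W.a₂)) / Real.log (v (p : L)) / 2 =
      (p ^ 2 - p) * paramValuation v p Q := by
  subst hp2
  obtain ⟨b, hb, e, -⟩ := exists_coeff_pow_eq S hk hkc hR hQ hR0 hQ0 hpR hpQ hlt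
    (f := WeierstrassCurve.ΨSq W (2 : ℕ)) one_pos (pow_one _)
    (fun s hs ↦ card_filter_xCoord_two hs)
  obtain rfl : b = 2 := by omega
  have hc : (WeierstrassCurve.ΨSq W (2 : ℕ)).coeff 2 = W.a₁ ^ 2 + 4 * W.a₂ := by
    rw [Nat.cast_ofNat, ΨSq_two, Ψ₂Sq]
    simp only [coeff_add, coeff_C_mul, coeff_X_pow, coeff_X, coeff_C]
    norm_num [WeierstrassCurve.b₂]
  rw [hc, pow_one] at e
  have hσ := hQ.size_pos hQ0
  refine ⟨fun h ↦ ?_, ?_⟩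
  · rw [h, _root_.map_zero] at e
    exact pow_ne_zero _ (NNReal.coe_ne_zero.mp hσ.ne') e.symm
  · have h0 := (log_valuation_neg S).ne
    rw [e, paramValuation, NNReal.coe_pow, Real.log_pow]
    push_cast at h0 ⊢
    field_simp
    norm_num

/-- The sizes of the nonzero formal `p`-torsion multiply to `|p|²`; passing from sizes to parameters
halves the exponent. -/
lemma sum_paramValuation :
    (p - 1) * paramValuation v p R + (p ^ 2 - p) * paramValuation v p Q = 1 := by
  have e : size v R ^ (p - 1) * size v Q ^ (p ^ 2 - p) = v (p : L) ^ 2 := by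
    rcases S.prime.eq_two_or_odd' with h2 | hodd
    · obtain ⟨-, -, -, e⟩ := exists_coeff_pow_eq S hk hkc hR hQ hR0 hQ0 hpR hpQ hlt
        (f := WeierstrassCurve.ΨSq W p) one_pos (pow_one _)
        (fun s hs ↦ card_filter_xCoord_two (by rwa [h2] at hs))
      exact e
    · obtain ⟨-, -, -, e⟩ := exists_coeff_pow_eq S hk hkc hR hQ hR0 hQ0 hpR hpQ hlt
        (f := WeierstrassCurve.preΨ W p) two_pos
        (by rw [WeierstrassCurve.ΨSq, if_neg (by simpa using hodd), mul_one])
        (fun s hs ↦ card_filter_xCoord_odd hodd hs)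
      exact e
  have e' := congrArg (fun t : ℝ≥0 ↦ Real.log t) e
  simp only [NNReal.coe_pow, NNReal.coe_mul] at e'
  rw [Real.log_mul (pow_ne_zero _ (hR.size_pos hR0).ne') (pow_ne_zero _ (hQ.size_pos hQ0).ne'),
    Real.log_pow, Real.log_pow, Real.log_pow, Nat.cast_sub (Nat.le_self_pow two_ne_zero p),
    Nat.cast_sub S.prime.one_lt.le] at e'
  have h0 := (log_valuation_neg S).ne
  rw [paramValuation, paramValuation]
  field_simp
  push_cast at e'
  linear_combination e'

end

end WeierstrassCurve.Affine.Point

/-! ### The completion of a number field and its algebraic closure. -/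

open IsDedekindDomain NumberField

/-- The spectral norm of an algebraic extension of a complete nonarchimedean field, as a
valuation. -/
lemma exists_valuation_eq_spectralNorm {F L : Type*} [NormedField F] [IsUltrametricDist F]
    [CompleteSpace F] [Field L] [Algebra F L] [Algebra.IsAlgebraic F L]
    (hF : ∃ x : F, 1 < ‖x‖) : ∃ v : Valuation L ℝ≥0, ∀ z, (v z : ℝ) = spectralNorm F L z := by
  let _ : NontriviallyNormedField F := { (inferInstance : NormedField F) with non_trivial := hF }
  refine ⟨⟨⟨⟨fun z ↦ ⟨spectralMulAlgNorm F L z, apply_nonneg _ _⟩, ?_⟩, ?_, ?_⟩, ?_⟩, fun z ↦ rfl⟩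
  · exact Subtype.ext (map_zero (spectralMulAlgNorm F L))
  · exact Subtype.ext (map_one (spectralMulAlgNorm F L))
  · exact fun x y ↦ Subtype.ext (map_mul (spectralMulAlgNorm F L) x y)
  · intro x y
    have := isNonarchimedean_spectralNorm (K := F) (L := L) x y
    exact this

namespace SupersingularTorsion

variable {K : Type*} [Field K] [NumberField K] (𝔭 : HeightOneSpectrum (𝓞 K))

instance : CharZero (𝔭.adicCompletion K) :=
  charZero_of_injective_algebraMap (algebraMap K (𝔭.adicCompletion K)).injective

instance : CharZero (LocalClosure 𝔭) :=
  charZero_of_injective_algebraMap (algebraMap (𝔭.adicCompletion K) (LocalClosure 𝔭)).injective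

instance (W : WeierstrassCurve K) [W.IsElliptic] :
    ((localCurve 𝔭 W).baseChange (LocalClosure 𝔭)).IsElliptic :=
  inferInstanceAs ((W.map _).map _).IsElliptic

variable {𝔭} {p : ℕ}

lemma norm_natCast_lt_one (hp : (p : 𝓞 K) ∈ 𝔭.asIdeal) : ‖(p : 𝔭.adicCompletion K)‖ < 1 := by
  have := (FinitePlace.norm_lt_one_iff_mem (K := K) 𝔭 (p : 𝓞 K)).mpr hp
  rwa [_root_.map_natCast, _root_.map_natCast] at this

lemma exists_valuation [Fact p.Prime] (hp : (p : 𝓞 K) ∈ 𝔭.asIdeal) :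
    ∃ v : Valuation (LocalClosure 𝔭) ℝ≥0, v (p : LocalClosure 𝔭) < 1 ∧
      (∀ x : 𝔭.adicCompletion K, (v (algebraMap _ _ x) : ℝ) = ‖x‖) ∧
      ∀ z, val 𝔭 p z = if z = 0 then ⊤ else
        ((Real.log (v z) / Real.log (v (p : LocalClosure 𝔭)) : ℝ) : WithTop ℝ) := by
  have hlt := norm_natCast_lt_one hp
  have hp0 : (p : 𝔭.adicCompletion K) ≠ 0 := by
    exact_mod_cast (Fact.out : p.Prime).ne_zero
  obtain ⟨v, hv⟩ := exists_valuation_eq_spectralNorm (F := 𝔭.adicCompletion K)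
    (L := LocalClosure 𝔭) ⟨(p : 𝔭.adicCompletion K)⁻¹, by
      rw [norm_inv]
      exact (one_lt_inv₀ (norm_pos_iff.mpr hp0)).mpr hlt⟩
  have hx (x : 𝔭.adicCompletion K) : (v (algebraMap _ _ x) : ℝ) = ‖x‖ := by
    rw [hv, spectralNorm_extends]
  refine ⟨v, ?_, hx, fun z ↦ ?_⟩
  · have := hx p
    rw [_root_.map_natCast] at this
    exact_mod_cast this.trans_lt hlt
  · rw [val, hv, hv]

lemma norm_le_one (x : 𝔭.adicCompletionIntegers K) : ‖(x : 𝔭.adicCompletion K)‖ ≤ 1 := by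
  rw [Valued.toNormedField.norm_le_one_iff]
  exact x.2

lemma norm_lt_one_of_residue (x : 𝔭.adicCompletionIntegers K)
    (h : IsLocalRing.residue _ x = 0) : ‖(x : 𝔭.adicCompletion K)‖ < 1 := by
  refine lt_of_le_of_ne (norm_le_one x) fun h1 ↦ ?_
  rw [IsLocalRing.residue_eq_zero_iff, IsLocalRing.mem_maximalIdeal] at h
  have h0 : (x : 𝔭.adicCompletion K) ≠ 0 := fun h0 ↦ by simp [h0] at h1
  refine h (IsUnit.of_mul_eq_one ⟨(x : 𝔭.adicCompletion K)⁻¹, ?_⟩ (Subtype.ext ?_))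
  · exact (Valued.toNormedField.norm_le_one_iff (x := (x : 𝔭.adicCompletion K)⁻¹)).mp
      (by rw [norm_inv, h1, inv_one])
  · exact mul_inv_cancel₀ h0

lemma norm_eq_one_of_residue (x : 𝔭.adicCompletionIntegers K)
    (h : IsLocalRing.residue _ x ≠ 0) : ‖(x : 𝔭.adicCompletion K)‖ = 1 := by
  rw [IsLocalRing.residue_ne_zero_iff_isUnit] at h
  obtain ⟨y, hy⟩ := h.exists_right_inv
  have e : (x : 𝔭.adicCompletion K) * y = 1 := congrArg Subtype.val hy
  have e' := congrArg norm e
  rw [norm_mul, norm_one] at e'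
  refine le_antisymm (norm_le_one x) ?_
  rw [← e']
  exact mul_le_of_le_one_right (norm_nonneg _) (norm_le_one y)

variable {W : WeierstrassCurve K} {v : Valuation (LocalClosure 𝔭) ℝ≥0}

/-- The coefficients of `ΨSq` for the integral model reduce to those of the special fibre, so their
residues decide between norm `1` and norm below `1`. -/
lemma HasGoodSupersingularReduction.supersingularAt [Fact p.Prime]
    (hv : v (p : LocalClosure 𝔭) < 1)
    (hx : ∀ x : 𝔭.adicCompletion K, (v (algebraMap _ _ x) : ℝ) = ‖x‖)
    (hW : HasGoodSupersingularReduction 𝔭 W p) :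
    SupersingularAt ((localCurve 𝔭 W).baseChange (LocalClosure 𝔭)) v p := by
  obtain ⟨hgood, hss⟩ := hW
  have hell := (hasGoodReduction_iff_isElliptic_reduction (𝔭.adicCompletionIntegers K)).mp hgood
  obtain ⟨c0, c1⟩ := hss.coeff_ΨSq Fact.out
  set W₀ := integralModel (𝔭.adicCompletionIntegers K) (localCurve 𝔭 W) with hW₀
  have e : W₀.baseChange (𝔭.adicCompletion K) = localCurve 𝔭 W :=
    baseChange_integralModel_eq ..
  have e1 : (localCurve 𝔭 W).reduction (𝔭.adicCompletionIntegers K) =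
    W₀.map (IsLocalRing.residue _) := rfl
  rw [e1, map_ΨSq] at c0 c1
  rw [← e]
  have hle (x : 𝔭.adicCompletionIntegers K) :
      v (algebraMap (𝔭.adicCompletion K) (LocalClosure 𝔭) (algebraMap _ _ x)) ≤ 1 := by
    rw [← NNReal.coe_le_coe, hx]
    exact norm_le_one x
  refine ⟨⟨hle _, hle _, hle _, hle _, hle _⟩, Fact.out, hv, ?_, fun i hi ↦ ?_⟩
  · rw [WeierstrassCurve.baseChange, map_ΨSq, WeierstrassCurve.baseChange, map_ΨSq, coeff_map,
      coeff_map, ← NNReal.coe_inj, hx]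
    rw [coeff_map] at c0
    exact norm_eq_one_of_residue _ c0
  · have c := c1 i hi
    rw [coeff_map] at c
    rw [WeierstrassCurve.baseChange, map_ΨSq, WeierstrassCurve.baseChange, map_ΨSq, coeff_map,
      coeff_map, ← NNReal.coe_lt_coe, hx]
    exact norm_lt_one_of_residue _ c

/-- The normalized valuation `val` in terms of a valuation with values in `ℝ≥0`. -/
def IsVal (p : ℕ) (v : Valuation (LocalClosure 𝔭) ℝ≥0) : Prop :=
  ∀ z, val 𝔭 p z = if z = 0 then ⊤ else
    ((Real.log (v z) / Real.log (v (p : LocalClosure 𝔭)) : ℝ) : WithTop ℝ)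

section

variable (hval : IsVal p v) (S : SupersingularAt ((localCurve 𝔭 W).baseChange (LocalClosure 𝔭)) v p)

include hval

lemma IsVal.eq_coe {z : LocalClosure 𝔭} (hz : z ≠ 0) : val 𝔭 p z =
    ((Real.log (v z) / Real.log (v (p : LocalClosure 𝔭)) : ℝ) : WithTop ℝ) := by
  rw [hval, if_neg hz]

include S

lemma inKernelOfReduction_iff (P : LocalPoint 𝔭 W) :
    InKernelOfReduction p P ↔ IsFormal v P := by
  cases P with
  | zero => rfl
  | some x y h =>
  rw [isFormal_some, InKernelOfReduction, hval]
  have h0 := log_valuation_neg S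
  split_ifs with hx
  · simp [hx]
  · rw [← WithTop.coe_zero, WithTop.coe_lt_coe]
    have hpos : (0 : ℝ) < v x := by
      exact_mod_cast pos_iff_ne_zero.mpr (v.ne_zero_iff.mpr hx)
    rw [div_neg_iff]
    simp only [h0, h0.not_gt, and_true, and_false, or_false]
    rw [Real.log_pos_iff hpos.le]
    exact_mod_cast Iff.rfl

lemma val_param {P : LocalPoint 𝔭 W} (hP : IsFormal v P) (hP0 : P ≠ 0) :
    val 𝔭 p (param P) = (paramValuation v p P : WithTop ℝ) := by
  cases P with
  | zero => exact absurd rfl hP0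
  | some x y h =>
  have hx : 1 < v x := hP
  have hx0 : v x ≠ 0 := (zero_lt_one.trans hx).ne'
  have e := valuation_sq_eq S.integralAt h.1 hx
  have hy0 : v y ≠ 0 := by
    intro h0
    rw [h0, zero_pow two_ne_zero] at e
    exact pow_ne_zero _ hx0 e.symm
  have hxy : param (some x y h : LocalPoint 𝔭 W) = -x / y := rfl
  have hne : -x / y ≠ 0 :=
    div_ne_zero (neg_ne_zero.mpr (v.ne_zero_iff.mp hx0)) (v.ne_zero_iff.mp hy0)
  have h0 := (log_valuation_neg S).ne
  rw [hxy, hval.eq_coe hne, WithTop.coe_inj, paramValuation, size_some, map_div₀, v.map_neg]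
  have e' := congrArg (fun t : ℝ≥0 ↦ Real.log t) e
  simp only [NNReal.coe_pow, Real.log_pow] at e'
  rw [NNReal.coe_div, NNReal.coe_inv, Real.log_inv,
    Real.log_div (NNReal.coe_ne_zero.mpr hx0) (NNReal.coe_ne_zero.mpr hy0)]
  field_simp
  push_cast at e'
  linear_combination -e'

variable [W.IsElliptic] {k : Finset (LocalPoint 𝔭 W)}
  (hk : ∀ T, T ∈ k ↔ IsFormal v T ∧ p • T = 0) (hkc : k.card = p ^ 2)
  {R Q : LocalPoint 𝔭 W} (hR : IsFormal v R) (hQ : IsFormal v Q) (hR0 : R ≠ 0) (hQ0 : Q ≠ 0)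
  (hpR : p • R = 0) (hpQ : p • Q = 0) (hlt : size v R < size v Q)

include hk hkc hR hQ hR0 hQ0 hpR hpQ hlt

lemma mu_eq : mu 𝔭 W p = (((p ^ 2 - p) * paramValuation v p Q : ℝ) : WithTop ℝ) := by
  rw [mu]
  split_ifs with hp2
  · obtain ⟨h1, h2⟩ := coeff_Ψ₂Sq_two S hk hkc hR hQ hR0 hQ0 hpR hpQ hlt hp2
    have e : algebraMap (𝔭.adicCompletion K) (LocalClosure 𝔭) (algebraMap K (𝔭.adicCompletion K)
        (W.a₁ ^ 2 + 4 * W.a₂)) = ((localCurve 𝔭 W).baseChange (LocalClosure 𝔭)).a₁ ^ 2 +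
        4 * ((localCurve 𝔭 W).baseChange (LocalClosure 𝔭)).a₂ := by
      simp only [map_add, map_mul, map_pow, _root_.map_ofNat]
      rfl
    rw [valK, e, hval.eq_coe h1, ← h2]
    rfl
  · obtain ⟨h1, h2⟩ := coeff_preΨ_odd S hk hkc hR hQ hR0 hQ0 hpR hpQ hlt hp2
    have e : algebraMap (𝔭.adicCompletion K) (LocalClosure 𝔭) (algebraMap K (𝔭.adicCompletion K)
        ((W.preΨ (p : ℤ)).coeff ((p ^ 2 - p) / 2))) =
        (((localCurve 𝔭 W).baseChange (LocalClosure 𝔭)).preΨ p).coeff ((p ^ 2 - p) / 2) := by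
      rw [WeierstrassCurve.baseChange, map_preΨ, localCurve, WeierstrassCurve.baseChange, map_preΨ,
        coeff_map, coeff_map]
    rw [valK, e, hval.eq_coe h1, h2]

end

end SupersingularTorsion

/-! ### Transfer of the abstract counts to points of the curve. -/

namespace SupersingularTorsion

variable {K : Type*} [Field K] [NumberField K] {𝔭 : HeightOneSpectrum (𝓞 K)} {p : ℕ}
  {W : WeierstrassCurve K} {v : Valuation (LocalClosure 𝔭) ℝ≥0}

section

variable (hval : IsVal p v) (S : SupersingularAt ((localCurve 𝔭 W).baseChange (LocalClosure 𝔭)) v p)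
  {k : Finset (formalSubgroup S.integralAt)} {C' : AddSubgroup (formalSubgroup S.integralAt)}
  {C : AddSubgroup (LocalPoint 𝔭 W)} {u w : ℝ}
  (H : CanonicalValuation p (fun P : formalSubgroup S.integralAt ↦
    paramValuation v p (P : LocalPoint 𝔭 W)) k C' u w)
  (hC : ∀ P : formalSubgroup S.integralAt, P ∈ C' ↔ (P : LocalPoint 𝔭 W) ∈ C)

include hval S in
lemma val_param_eq_iff {P : LocalPoint 𝔭 W} (hP : IsFormal v P) (hP0 : P ≠ 0) {r : ℝ} :
    val 𝔭 p (param P) = (r : WithTop ℝ) ↔ paramValuation v p P = r := by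
  rw [val_param hval S hP hP0, WithTop.coe_inj]

include hval in
lemma mem_formalTorsion_iff {n : ℕ} (P : LocalPoint 𝔭 W) :
    P ∈ formalTorsion 𝔭 W p n ↔ ∃ hP : P ∈ formalSubgroup S.integralAt,
      addOrderOf (⟨P, hP⟩ : formalSubgroup S.integralAt) = p ^ n := by
  rw [formalTorsion, Set.mem_ofPred_eq, inKernelOfReduction_iff hval S, ← exists_prop]
  refine exists_congr fun h ↦ ?_
  rw [← AddSubgroup.addOrderOf_coe]

lemma ne_zero_of_addOrderOf {m : ℕ} {P : formalSubgroup S.integralAt}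
    (h : addOrderOf P = p ^ (m + 1)) : (P : LocalPoint 𝔭 W) ≠ 0 := by
  intro h0
  have : P = 0 := Subtype.ext h0
  rw [this, addOrderOf_zero] at h
  exact (Nat.one_lt_pow m.succ_ne_zero S.prime.one_lt).ne h

include hval

lemma ncard_withVal_formalTorsion (m : ℕ) (r : ℝ) :
    (withVal (formalTorsion 𝔭 W p (m + 1)) p r).ncard =
      {P : formalSubgroup S.integralAt | addOrderOf P = p ^ (m + 1) ∧
        paramValuation v p (P : LocalPoint 𝔭 W) = r}.ncard := by
  rw [← Set.ncard_image_of_injective _ Subtype.val_injective]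
  congr 1
  ext P
  simp only [withVal, Set.mem_ofPred_eq, mem_formalTorsion_iff hval S, Set.mem_image]
  constructor
  · rintro ⟨⟨hP, h1⟩, h2⟩
    exact ⟨⟨P, hP⟩, ⟨h1, (val_param_eq_iff hval S hP (ne_zero_of_addOrderOf S h1)).mp h2⟩,
      rfl⟩
  · rintro ⟨P, ⟨h1, h2⟩, rfl⟩
    exact ⟨⟨P.2, h1⟩, (val_param_eq_iff hval S P.2 (ne_zero_of_addOrderOf S h1)).mpr h2⟩

include H hC

lemma mem_aboveTorsion_iff {m : ℕ} (P : LocalPoint 𝔭 W) :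
    P ∈ aboveTorsion C p (m + 1) ↔ ∃ hP : P ∈ formalSubgroup S.integralAt,
      (⟨P, hP⟩ : formalSubgroup S.integralAt) ∈ CanonicalValuation.above p C' m := by
  rw [aboveTorsion, Set.mem_ofPred_eq, mem_formalTorsion_iff hval S, ← exists_and_right]
  refine exists_congr fun hP ↦ ?_
  rw [← H.addOrderOf_eq_and_iff, hC]
  rfl

lemma ncard_withVal_aboveTorsion (m : ℕ) (r : ℝ) :
    (withVal (aboveTorsion C p (m + 1)) p r).ncard =
      {P : formalSubgroup S.integralAt | P ∈ CanonicalValuation.above p C' m ∧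
        paramValuation v p (P : LocalPoint 𝔭 W) = r}.ncard := by
  rw [← Set.ncard_image_of_injective _ Subtype.val_injective]
  congr 1
  ext P
  have hne {P : formalSubgroup S.integralAt} (h : P ∈ CanonicalValuation.above p C' m) :
      (P : LocalPoint 𝔭 W) ≠ 0 :=
    fun h0 ↦ CanonicalValuation.ne_zero_of_mem_above h (Subtype.ext h0)
  simp only [withVal, Set.mem_ofPred_eq, mem_aboveTorsion_iff hval S H hC, Set.mem_image]
  constructor
  · rintro ⟨⟨hP, h1⟩, h2⟩
    exact ⟨⟨P, hP⟩, ⟨h1, (val_param_eq_iff hval S hP (hne h1)).mp h2⟩, rfl⟩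
  · rintro ⟨P, ⟨h1, h2⟩, rfl⟩
    exact ⟨⟨P.2, h1⟩, (val_param_eq_iff hval S P.2 (hne h1)).mpr h2⟩

lemma formalTorsion_diff_aboveTorsion (m : ℕ) :
    formalTorsion 𝔭 W p (m + 1) \ aboveTorsion C p (m + 1) =
      Subtype.val '' CanonicalValuation.notAbove (G := formalSubgroup S.integralAt) p C' m := by
  ext P
  rw [Set.mem_sdiff, aboveTorsion, Set.mem_ofPred_eq, not_and, Set.mem_image]
  constructor
  · rintro ⟨h1, h2⟩
    obtain ⟨hP, h⟩ := (mem_formalTorsion_iff hval S P).mp h1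
    refine ⟨⟨P, hP⟩, H.addOrderOf_eq_and_notMem_iff.mp ⟨h, ?_⟩, rfl⟩
    rw [hC]
    exact h2 h1
  · rintro ⟨P, hP, rfl⟩
    obtain ⟨h1, h2⟩ := H.addOrderOf_eq_and_notMem_iff.mpr hP
    rw [hC] at h2
    exact ⟨(mem_formalTorsion_iff hval S _).mpr ⟨P.2, h1⟩, fun _ ↦ h2⟩

end

end SupersingularTorsion

lemma exists_isLeast_one_div_le {p : ℕ} (hp : 1 < p) {μ : ℝ} (hμ : 0 < μ) :
    ∃ s : ℕ, IsLeast {k : ℕ | 1 / ((p : ℝ) ^ k * (p + 1)) ≤ μ} s := by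
  classical
  have hp' : (1 : ℝ) < p := by exact_mod_cast hp
  have hex : ∃ k : ℕ, 1 / ((p : ℝ) ^ k * (p + 1)) ≤ μ := by
    obtain ⟨k, hk⟩ := pow_unbounded_of_one_lt (1 / μ) hp'
    refine ⟨k, ?_⟩
    have hpos : (0 : ℝ) < p ^ k := by positivity
    rw [div_lt_iff₀ hμ] at hk
    rw [div_le_iff₀ (by positivity)]
    nlinarith [mul_pos hμ hpos]
  exact ⟨Nat.find hex, Nat.find_spec hex, fun k hk ↦ Nat.find_min' hex hk⟩

/-! ### The main theorem. -/

open SupersingularTorsion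
theorem mainTheorem5 {K : Type*} [Field K] [NumberField K]
    (W : WeierstrassCurve K) [W.IsElliptic] (p : ℕ) [Fact p.Prime]
    (𝔭 : HeightOneSpectrum (𝓞 K)) (hp : (p : 𝓞 K) ∈ 𝔭.asIdeal)
    (hW : HasGoodSupersingularReduction 𝔭 W p)
    (C : AddSubgroup (LocalPoint 𝔭 W)) (hC : IsCanonicalSubgroup p C)
    (n : ℕ) (hn : 1 ≤ n) :
    ∃ μ : ℝ, mu 𝔭 W p = (μ : WithTop ℝ) ∧
    ∃ s : ℕ, IsLeast {k : ℕ | 1 / ((p : ℝ) ^ k * (p + 1)) ≤ μ} s ∧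
      (n ≤ s + 1 →
        (withVal (aboveTorsion C p n) p
          ((1 - (p : ℝ) ^ (n - 1) * μ) / ((p : ℝ) ^ (n - 1) * (p - 1)))).ncard
            = p ^ (n - 1) * (p - 1) ∧
        ∀ j : ℕ, 2 ≤ j → j ≤ n →
          ((withVal (aboveTorsion C p n) p
            (μ / ((p : ℝ) ^ (2 * (n - j)) * ((p : ℝ) ^ 2 - p)))).ncard
              = p ^ (2 * (n - j)) * (p ^ 2 - p) * p ^ (j - 2) * (p - 1) ∧
          (withVal (formalTorsion 𝔭 W p n) p
            (μ / ((p : ℝ) ^ (2 * (n - j)) * ((p : ℝ) ^ 2 - p)))).ncard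
              = p ^ (2 * (n - j)) * (p ^ 2 - p) * p ^ (j - 2) * (p - 1))) ∧
      (s + 1 < n →
        (withVal (aboveTorsion C p n) p
          ((1 - (p : ℝ) ^ s * μ) / ((p : ℝ) ^ (2 * (n - s - 1)) * (p : ℝ) ^ s * (p - 1)))).ncard
            = p ^ (2 * (n - s - 1)) * p ^ s * (p - 1) ∧
        ∀ j : ℕ, 2 ≤ j → j ≤ s + 1 →
          ((withVal (aboveTorsion C p n) p
            (μ / ((p : ℝ) ^ (2 * (n - j)) * ((p : ℝ) ^ 2 - p)))).ncard
              = p ^ (2 * (n - j)) * (p ^ 2 - p) * p ^ (j - 2) * (p - 1) ∧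
          (withVal (formalTorsion 𝔭 W p n) p
            (μ / ((p : ℝ) ^ (2 * (n - j)) * ((p : ℝ) ^ 2 - p)))).ncard
              = p ^ (2 * (n - j)) * (p ^ 2 - p) * p ^ (j - 2) * (p - 1))) ∧
      (formalTorsion 𝔭 W p n \ aboveTorsion C p n).ncard = p ^ (2 * (n - 1)) * (p ^ 2 - p) ∧
      ∀ Q ∈ formalTorsion 𝔭 W p n \ aboveTorsion C p n,
        val 𝔭 p (param Q) =
          ((μ / ((p : ℝ) ^ (2 * (n - 1)) * ((p : ℝ) ^ 2 - p)) : ℝ) : WithTop ℝ) := by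
  classical
  obtain ⟨v, hvp, hvx, hval⟩ := exists_valuation (K := K) hp
  have S := hW.supersingularAt hvp hvx
  obtain ⟨k, hk, hkc⟩ := exists_kernel S
  obtain ⟨R, ⟨hRk, hRo⟩, Q, ⟨hQk, hQo⟩, hlt, rfl⟩ := hC
  have hR : IsFormal v R := (inKernelOfReduction_iff hval S R).mp hRk
  have hQ : IsFormal v Q := (inKernelOfReduction_iff hval S Q).mp hQk
  have hne {P : LocalPoint 𝔭 W} (h : addOrderOf P = p ^ 1) : P ≠ 0 := by
    rintro rfl
    rw [addOrderOf_zero, pow_one] at h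
    exact S.prime.one_lt.ne h
  have hp0 {P : LocalPoint 𝔭 W} (h : addOrderOf P = p ^ 1) : p • P = 0 := by
    rw [← pow_one p, ← h, addOrderOf_nsmul_eq_zero]
  have hlt' : size v R < size v Q := by
    rw [val_param hval S hQ (hne hQo), val_param hval S hR (hne hRo), WithTop.coe_lt_coe,
      ← not_le, paramValuation_le_iff S hR (hne hRo) hQ (hne hQo), not_le] at hlt
    exact hlt
  have H := canonicalValuation S hk hkc hR hQ (hne hRo) (hne hQo) (hp0 hRo) (hp0 hQo) hlt'
  have hsum := sum_paramValuation S hk hkc hR hQ (hne hRo) (hne hQo) (hp0 hRo) (hp0 hQo) hlt'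
  have hmu := mu_eq hval S hk hkc hR hQ (hne hRo) (hne hQo) (hp0 hRo) (hp0 hQo) hlt'
  have hC (P : formalSubgroup S.integralAt) :
      P ∈ AddSubgroup.zmultiples (⟨R, hR⟩ : formalSubgroup S.integralAt) ↔
        (P : LocalPoint 𝔭 W) ∈ AddSubgroup.zmultiples R := by
    rw [AddSubgroup.mem_zmultiples_iff, AddSubgroup.mem_zmultiples_iff]
    refine exists_congr fun i ↦ ?_
    rw [← Subtype.coe_inj]
    rfl
  set w := paramValuation v p Q
  have hsq := H.sq_sub_pos
  have hp2 := H.two_le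
  obtain ⟨s, hs⟩ := exists_isLeast_one_div_le S.prime.one_lt (mul_pos hsq H.pos_w)
  -- Minimality of `s` says fibres split below level `s`; membership gives `hs2`, that splitting
  -- stops at `s`.
  have hs1 : ∀ i < s, p ^ 2 * w < CanonicalValuation.branch p w i := fun i hi ↦
    (H.lt_branch_iff i).mpr (not_le.mp fun h ↦ hi.not_ge (hs.2 h))
  have hs2 : CanonicalValuation.branch p w s ≤ p ^ 2 * w :=
    not_lt.mp ((H.lt_branch_iff s).not.mpr (not_lt.mpr hs.1))
  have hside (i : ℕ) : ((p : ℝ) ^ 2 - p) * w / ((p : ℝ) ^ (2 * i) * ((p : ℝ) ^ 2 - p)) =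
      w / p ^ (2 * i) := by
    rw [mul_comm _ w, mul_div_mul_right _ _ hsq.ne']
  -- Order `p ^ n` is level `m = n - 1` of the abstract counts.
  obtain ⟨m, rfl⟩ : ∃ m, n = m + 1 := ⟨n - 1, by omega⟩
  refine ⟨_, hmu, s, hs, fun hm ↦ ⟨?_, fun j hj hjm ↦ ?_⟩, fun hm ↦ ⟨?_, fun j hj hjs ↦ ?_⟩, ?_, ?_⟩
  · rw [ncard_withVal_aboveTorsion hval S H hC, Nat.add_sub_cancel]
    exact H.ncard_above_branch hsum fun i hi ↦ hs1 i (by omega)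
  · have key := H.ncard_above_side hsum (fun i hi ↦ hs1 i (by omega)) hj hjm
    rw [hside, ncard_withVal_aboveTorsion hval S H hC, ncard_withVal_formalTorsion hval S,
      H.setOf_addOrderOf_eq (by omega)]
    exact ⟨key, key⟩
  -- The distribution at level `s` is rescaled through the remaining `i = n - s - 1` levels.
  · obtain ⟨i, rfl⟩ : ∃ i, m = s + i := ⟨m - s, by omega⟩
    have key := H.ncard_above_add hsum hs1 hs2 i (CanonicalValuation.branch p w s)
    rw [H.ncard_above_branch hsum hs1] at key
    have e : CanonicalValuation.branch p w s / (p : ℝ) ^ (2 * i) =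
        (1 - (p : ℝ) ^ s * (((p : ℝ) ^ 2 - p) * w)) /
          ((p : ℝ) ^ (2 * i) * (p : ℝ) ^ s * (p - 1)) := by
      rw [CanonicalValuation.branch, div_div]
      congr 1
      ring
    rw [e] at key
    rw [ncard_withVal_aboveTorsion hval S H hC, show s + i + 1 - s - 1 = i by omega, key, mul_assoc]
  · obtain ⟨i, rfl⟩ : ∃ i, m = s + i := ⟨m - s, by omega⟩
    have key := H.ncard_above_add hsum hs1 hs2 i (w / p ^ (2 * (s + 1 - j)))
    have e : 2 * (s + i + 1 - j) = 2 * (s + 1 - j) + 2 * i := by omega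
    rw [H.ncard_above_side hsum hs1 hj hjs, div_div, ← pow_add, ← e] at key
    rw [hside, ncard_withVal_aboveTorsion hval S H hC, ncard_withVal_formalTorsion hval S,
      H.setOf_addOrderOf_eq (by omega), and_self, key, e, pow_add]
    ring
  · rw [formalTorsion_diff_aboveTorsion hval S H hC,
      Set.ncard_image_of_injective _ Subtype.val_injective, H.ncard_notAbove, Nat.add_sub_cancel]
  · rw [formalTorsion_diff_aboveTorsion hval S H hC]
    rintro _ ⟨P, hP, rfl⟩
    rw [hside, val_param_eq_iff hval S P.2
      fun h ↦ CanonicalValuation.ne_zero_of_mem_notAbove hP (Subtype.ext h)]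
    exact H.eq_of_mem_notAbove hP
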